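/- Let $d\ge 1$, let $\Sigma_X\in\mathbb R^{d\times d}$ be positive definite, $\Sigma_W\in\mathbb R^{m\times m}$ positive semidefinite, $\sigma\ge 0$, $\theta,\tilde\theta\in\mathbb R^d$, $\gamma,\tilde\gamma\in\mathbb R^m$ with $\tilde\gamma^\top\Sigma_W\tilde\gamma\neq 0$. Let $X\sim\mathcal N(0,\Sigma_X)$, $W\sim\mathcal N(0,\Sigma_W)$, $\epsilon\sim\mathcal N(0,\sigma^2)$ be independent, and put $$Y=W^\top\gamma+X^\top\theta+\epsilon,\qquad \hat Y=X^\top\tilde\theta+W^\top\tilde\gamma,\qquad \ell_t(X,Y)=(Y-X^\top t)^2 .$$ Then $\theta$ is the unique minimizer of $t\mapsto\mathbb E[\ell_t(X,Y)]$. It is estimated from i.i.d. units $(X_i,W_i,\epsilon_i)$, of which the first $n$ are labelled ($Y_i$ observed) and the next $N=N_n\ge 1$ are unlabelled, with $n/N\to r$ as $n\to\infty$. For an imputed loss $g$, a PPI estimator $\hat\theta_g$ is a minimizer over $t$ of $$\frac1n\sum_{i\le n}\ell_t(X_i,Y_i)-\Big(\frac1n\sum_{i\le n}g_t(X_i,\hat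 Y_i)-\frac1N\sum_{n<i\le n+N}g_t(X_i,\hat Y_i)\Big).$$ A sequence of estimators $\hat\theta$ has asymptotic covariance $\Sigma$ if $\sqrt n(\hat\theta-\theta)\xrightarrow{d}\mathcal N(0,\Sigma)$. Let $H=\mathbb E[\nabla^2\ell_\theta(X,Y)]$, and for $\lambda\in\mathbb R$ $$\Sigma_\lambda=H^{-1}\big(r\lambda^2\mathrm{Cov}(\nabla\ell_\theta(X,\hat Y))+\mathrm{Cov}(\nabla\ell_\theta(X,Y)-\lambda\nabla\ell_\theta(X,\hat Y))\big)H^{-1}.$$ (a) The XY-only estimator ($g=0$) has asymptotic covariance $\Sigma^{\mathrm{XY\text{-}only}}=\Sigma_0$, and the PPI estimator ($g=\ell$) has asymptotic covariance $\Sigma^{\mathrm{PPI}}=\Sigma_1$. The function $\lambda\mapsto\mathrm{Tr}(\Sigma_\lambda)$ has a unique minimizer $\lambda^\star$, and the PPI++ estimator ($g=\hat\lambda\,\ell$ with any $\hat\lambda\xrightarrow{p}\lambda^\star$) has asymptotic covariance $\Sigma^{\mathrm{PPI++}}=\Sigma_{\lambda^\star}$. (b) Let $s^\star(X,\hat Y)=\mathbb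 E[\nabla\ell_\theta(X,Y)\mid X,\hat Y]$ and $$\Sigma^{\mathrm{RePPI}}=H^{-1}\Big(\mathrm{Cov}(\nabla\ell_\theta(X,Y))-\tfrac1{1+r}\mathrm{Cov}\big(s^\star(X,\hat Y)\big)\Big)H^{-1}.$$ This is the asymptotic covariance of the PPI estimator with the optimal linear imputed loss $g_t=\frac1{1+r}t^\top s^\star(X,\hat Y)$. If moreover $\gamma^\top\Sigma_W\tilde\gamma\ne0$ (equivalently, $\mathrm{Cov}(s^\star(X,\hat Y))$ is invertible), it is the asymptotic covariance of the cross-fitted RePPI estimator, defined as follows. Split the labelled units evenly into folds $D_1,D_2,D_3$. Using $(D_1,D_2,D_3)$, let $\hat\theta_0$ be the empirical risk minimizer on $D_1$; let $\hat s$ be a learned function, independent of the units in $D_3$ and of the unlabelled units, with $\mathbb E\|\hat s(X,\hat Y)-s^\star(X,\hat Y)\|^2\to0$ at an independent $(X,\hat Y)$; let $\hat M=\widehat{\mathrm{Cov}}(\nabla\ell_{\hat\theta_0}(X,Y),\hat s)\,\widehat{\mathrm{Cov}}(\hat s)^{-1}$ with sample covariances over $D_3$; and let $\hat\theta^1$ be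 the PPI estimator on $D_3$ and the unlabelled units with $g_t=\frac1{1+n/N}t^\top\hat M\hat s(X,\hat Y)$. Obtain $\hat\theta^2,\hat\theta^3$ likewise from the rotations $(D_3,D_1,D_2)$ and $(D_2,D_3,D_1)$. The RePPI estimator is $\sum_{k=1}^3\frac{|D_k|}{n}\hat\theta^k$. (c) The traces are \begin{align*} \mathrm{Tr}(\Sigma^{\mathrm{XY\text{-}only}})&=(\sigma^2+\gamma^\top\Sigma_W\gamma)\,\mathrm{Tr}(\Sigma_X^{-1}),\\ \mathrm{Tr}(\Sigma^{\mathrm{PPI}})&=(1+r)\|\theta-\tilde\theta\|^2+\big(\sigma^2+(1+r)(\theta-\tilde\theta)^\top\Sigma_X(\theta-\tilde\theta)+r\tilde\gamma^\top\Sigma_W\tilde\gamma+(\gamma-\tilde\gamma)^\top\Sigma_W(\gamma-\tilde\gamma)\big)\mathrm{Tr}(\Sigma_X^{-1}),\\ \mathrm{Tr}(\Sigma^{\mathrm{PPI++}})&=\Big(\sigma^2+\gamma^\top\Sigma_W\gamma-\frac1{1+r}\frac{(\gamma^\top\Sigma_W\tilde\gamma)^2}{\tilde\gamma^\top\Sigma_W\tilde\gamma+(\theta-\tilde\theta)^\top\Sigma_X(\theta-\tilde\theta)+\|\theta-\tilde\theta\|^2/\mathrm{Tr}(\Sigma_X^{-1})}\Big)\mathrm{Tr}(\Sigma_X^{-1}),\\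 \mathrm{Tr}(\Sigma^{\mathrm{RePPI}})&=\Big(\sigma^2+\gamma^\top\Sigma_W\gamma-\frac1{1+r}\frac{(\gamma^\top\Sigma_W\tilde\gamma)^2}{\tilde\gamma^\top\Sigma_W\tilde\gamma}\Big)\mathrm{Tr}(\Sigma_X^{-1}). \end{align*} In particular the RePPI trace does not depend on $\theta-\tilde\theta$, and $\mathrm{Tr}(\Sigma^{\mathrm{RePPI}})\le\mathrm{Tr}(\Sigma^{\mathrm{PPI++}})\le\min\{\mathrm{Tr}(\Sigma^{\mathrm{XY\text{-}only}}),\mathrm{Tr}(\Sigma^{\mathrm{PPI}})\}$. -/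

import Mathlib

open MeasureTheory ProbabilityTheory Filter Topology
open scoped ENNReal NNReal Matrix

noncomputable section

namespace PPI

/-- Column vectors of `ℝ^d` with the Euclidean norm. -/
abbrev Vec (d : ℕ) := EuclideanSpace ℝ (Fin d)

/-- One unit `z = (x, w, e)`: covariates `x = z.1`, additional covariates `w = z.2.1`, and
noise `e = z.2.2`. Outcomes and predictions are functions `Obs d m → ℝ`. -/
abbrev Obs (d m : ℕ) := Vec d × Vec m × ℝ

/-- The quadratic form `uᵀ S v`. -/
def bform {k : ℕ} (S : Matrix (Fin k) (Fin k) ℝ) (u v : Vec k) : ℝ :=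
  u.ofLp ⬝ᵥ (S *ᵥ v.ofLp)

/-- The law of `(X, W, ε)`: independent `X ∼ N(0, ΣX)`, `W ∼ N(0, ΣW)`, `ε ∼ N(0, σ²)`. -/
def gaussianLaw {d m : ℕ} (SX : Matrix (Fin d) (Fin d) ℝ) (SW : Matrix (Fin m) (Fin m) ℝ)
    (σ : ℝ≥0) : Measure (Obs d m) :=
  (multivariateGaussian 0 SX).prod ((multivariateGaussian 0 SW).prod (gaussianReal 0 (σ ^ 2)))

/-! ### The loss -/

/-- The squared loss `ℓ_t(x, y) = (y - xᵀt)²`. -/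
def sqLoss {d : ℕ} (t x : Vec d) (y : ℝ) : ℝ := (y - inner ℝ x t) ^ 2

/-- The gradient `∇ℓ_t(x, y)` in the parameter `t`. -/
def gradLoss {d : ℕ} (t x : Vec d) (y : ℝ) : Vec d := gradient (fun u => sqLoss u x y) t

/-- The Hessian matrix `∇²ℓ_t(x, y)` in the parameter `t`. -/
def hessLoss {d : ℕ} (t x : Vec d) (y : ℝ) : Matrix (Fin d) (Fin d) ℝ :=
  Matrix.of fun i j => fderiv ℝ (fun u => gradLoss u x y) t (EuclideanSpace.single j 1) i

/-- The population risk `E[ℓ_t(X, Y)]`. -/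
def risk {d m : ℕ} (μ : Measure (Obs d m)) (Y : Obs d m → ℝ) (t : Vec d) : ℝ :=
  ∫ z, sqLoss t z.1 (Y z) ∂μ

/-! ### Population covariance matrices -/

/-- The (cross-)covariance matrix `Cov(f, g)` of two random vectors. -/
def covMat {d m : ℕ} (μ : Measure (Obs d m)) (f g : Obs d m → Vec d) :
    Matrix (Fin d) (Fin d) ℝ :=
  Matrix.of fun i j => cov[fun z => f z i, fun z => g z j; μ]

/-- `H_t = E[∇²ℓ_t(X, Y)]`. -/
def hessMat {d m : ℕ} (μ : Measure (Obs d m)) (Y : Obs d m → ℝ) (t : Vec d) :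
    Matrix (Fin d) (Fin d) ℝ :=
  Matrix.of fun i j => ∫ z, hessLoss t z.1 (Y z) i j ∂μ

/-- `H_t⁻¹ (r Cov(G) + Cov(∇ℓ_t(X, Y) - G)) H_t⁻¹`, for an imputed loss with gradient `G` at the
target `t`. -/
def avarPPI {d m : ℕ} (μ : Measure (Obs d m)) (Y : Obs d m → ℝ) (t : Vec d) (r : ℝ)
    (G : Obs d m → Vec d) : Matrix (Fin d) (Fin d) ℝ :=
  (hessMat μ Y t)⁻¹ *
    (r • covMat μ G G +
      covMat μ (fun z => gradLoss t z.1 (Y z) - G z) (fun z => gradLoss t z.1 (Y z) - G z)) *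
    (hessMat μ Y t)⁻¹

/-- The PPI matrix for the imputed loss `lam • ℓ`, i.e. `G = lam ∇ℓ_t(X, Ŷ)`:
`lam = 0` is XY-only, `lam = 1` is PPI, and PPI++ uses the best `lam`. -/
def avarScaled {d m : ℕ} (μ : Measure (Obs d m)) (Y Yhat : Obs d m → ℝ) (t : Vec d) (r : ℝ)
    (lam : ℝ) : Matrix (Fin d) (Fin d) ℝ :=
  avarPPI μ Y t r fun z => lam • gradLoss t z.1 (Yhat z)

/-- `E[∇ℓ_t(X, Y) | X, Ŷ]`. -/
def condGrad {d m : ℕ} (μ : Measure (Obs d m)) (Y Yhat : Obs d m → ℝ) (t : Vec d) :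
    Obs d m → Vec d :=
  condExp (MeasurableSpace.comap (fun z : Obs d m => (z.1, Yhat z)) inferInstance) μ
    (fun z => gradLoss t z.1 (Y z))

/-- `s` is a version of the regression function `s⋆(x, ŷ) = E[∇ℓ_t(X, Y) | X = x, Ŷ = ŷ]`. -/
def IsOptimalScore {d m : ℕ} (μ : Measure (Obs d m)) (Y Yhat : Obs d m → ℝ) (t : Vec d)
    (s : Vec d × ℝ → Vec d) : Prop :=
  Measurable s ∧ (fun z : Obs d m => s (z.1, Yhat z)) =ᵐ[μ] condGrad μ Y Yhat t

/-- `H_t⁻¹ (Cov(∇ℓ_t(X, Y)) - (1 + r)⁻¹ Cov(E[∇ℓ_t(X, Y) | X, Ŷ])) H_t⁻¹`. -/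
def avarRePPI {d m : ℕ} (μ : Measure (Obs d m)) (Y Yhat : Obs d m → ℝ) (t : Vec d) (r : ℝ) :
    Matrix (Fin d) (Fin d) ℝ :=
  (hessMat μ Y t)⁻¹ *
    (covMat μ (fun z => gradLoss t z.1 (Y z)) (fun z => gradLoss t z.1 (Y z)) -
      (1 + r)⁻¹ • covMat μ (condGrad μ Y Yhat t) (condGrad μ Y Yhat t)) *
    (hessMat μ Y t)⁻¹

/-! ### Estimators -/

/-- The estimators `est n` have asymptotic covariance `S`:
`√n (est n - t)` converges in distribution to `N(0, S)`. -/
def HasAsymptoticCovariance {Ω : Type*} [MeasurableSpace Ω] (P : Measure Ω)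
    [IsProbabilityMeasure P] {d : ℕ} (est : ℕ → Ω → Vec d) (t : Vec d)
    (S : Matrix (Fin d) (Fin d) ℝ) : Prop :=
  S.PosSemidef ∧
    TendstoInDistribution (fun (n : ℕ) ω => √(n : ℝ) • (est n ω - t)) atTop
      (id : Vec d → Vec d) (fun _ => P) (multivariateGaussian 0 S)

/-- `t` minimizes `f`, unless `f` has no minimizer at all. -/
def IsArgmin {d : ℕ} (f : Vec d → ℝ) (t : Vec d) : Prop :=
  (∃ u, ∀ v, f u ≤ f v) → ∀ v, f t ≤ f v

/-- The average of `f` over a finite set of units. -/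
def avg {V : Type*} [AddCommGroup V] [Module ℝ V] (I : Finset ℕ) (f : ℕ → V) : V :=
  (I.card : ℝ)⁻¹ • ∑ i ∈ I, f i

/-- The PPI objective with labelled units `L`, unlabelled units `U` and imputed loss `g`:
`avg_L ℓ_t(X, Y) - (avg_L g_t(X, Ŷ) - avg_U g_t(X, Ŷ))`. -/
def ppiObjective {d m : ℕ} (Y Yhat : Obs d m → ℝ) (z : ℕ → Obs d m) (L U : Finset ℕ)
    (g : Vec d → Vec d → ℝ → ℝ) (t : Vec d) : ℝ :=
  avg L (fun i => sqLoss t (z i).1 (Y (z i))) -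
    (avg L (fun i => g t (z i).1 (Yhat (z i))) - avg U (fun i => g t (z i).1 (Yhat (z i))))

/-- The unlabelled units `n, …, n + N - 1`; the labelled ones are `0, …, n - 1`. -/
def unlabelled (N : ℕ → ℕ) (n : ℕ) : Finset ℕ := Finset.Ico n (n + N n)

/-- `est n` is a PPI estimator from `n` labelled and `N n` unlabelled units, with the (possibly
data-dependent) imputed loss `g n`. -/
def IsPPIEstimator {Ω : Type*} [MeasurableSpace Ω] (P : Measure Ω) {d m : ℕ}
    (Y Yhat : Obs d m → ℝ) (Z : ℕ → Ω → Obs d m) (N : ℕ → ℕ)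
    (g : ℕ → Ω → Vec d → Vec d → ℝ → ℝ) (est : ℕ → Ω → Vec d) : Prop :=
  ∀ n, AEMeasurable (est n) P ∧ ∀ᵐ ω ∂P,
    IsArgmin (ppiObjective Y Yhat (fun i => Z i ω) (Finset.range n) (unlabelled N n) (g n ω))
      (est n ω)

/-- The sample cross-covariance matrix over a finite set of units. -/
def sampleCov {d : ℕ} (I : Finset ℕ) (f g : ℕ → Vec d) : Matrix (Fin d) (Fin d) ℝ :=
  avg I fun i => Matrix.vecMulVec (f i - avg I f).ofLp (g i - avg I g).ofLp

/-- A run of recalibrated PPI, for all sample sizes `n`.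

The labelled units are split evenly into three folds. For each `k : Fin 3` the roles of the folds
are: `-k` for the initial estimate, `1 - k` for learning the regression function, and `2 - k` for
the weight matrix and the final fit, i.e. the three rotations `(0, 1, 2)`, `(2, 0, 1)`,
`(1, 2, 0)`. -/
structure RePPIRun {Ω : Type*} [mΩ : MeasurableSpace Ω] (P : Measure Ω) {d m : ℕ}
    (Y Yhat : Obs d m → ℝ) (Z : ℕ → Ω → Obs d m) (N : ℕ → ℕ) where
  /-- `fold n j` is the set of labelled units in fold `j`. -/
  fold : ℕ → Fin 3 → Finset ℕ
  fold_disjoint : ∀ n, Pairwise fun j k => Disjoint (fold n j) (fold n k)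
  fold_union : ∀ n, (Finset.univ.biUnion fun j => fold n j) = Finset.range n
  fold_even : ∀ n j, n / 3 ≤ (fold n j).card ∧ (fold n j).card ≤ n / 3 + 1
  /-- The initial estimate: the empirical risk minimizer on fold `-k`. -/
  initial : ℕ → Fin 3 → Ω → Vec d
  initial_measurable : ∀ n k, AEMeasurable (initial n k) P
  initial_argmin : ∀ n k, ∀ᵐ ω ∂P,
    IsArgmin (fun t => avg (fold n (-k)) fun i => sqLoss t (Z i ω).1 (Y (Z i ω)))
      (initial n k ω)
  /-- The learned regression function. -/
  score : ℕ → Fin 3 → Ω → Vec d × ℝ → Vec d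
  /-- The information used for learning: the other two folds, and possibly randomness of the
  learning algorithm. It is independent of the units on which the learned function is used. -/
  training : ℕ → Fin 3 → MeasurableSpace Ω
  training_le : ∀ n k, training n k ≤ mΩ
  training_indep : ∀ n k, Indep (training n k)
    (⨆ i ∈ fold n (2 - k) ∪ unlabelled N n, MeasurableSpace.comap (Z i) inferInstance) P
  score_measurable : ∀ n k,
    @Measurable (Ω × (Vec d × ℝ)) (Vec d) (@Prod.instMeasurableSpace _ _ (training n k) _) _
      (fun p => score n k p.1 p.2)
  /-- The estimate `θ̂ᵏ` of the final fit. -/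
  foldEst : ℕ → Fin 3 → Ω → Vec d
  foldEst_measurable : ∀ n k, AEMeasurable (foldEst n k) P
  /-- `θ̂ᵏ` is the PPI estimator on fold `2 - k` and the unlabelled units with imputed loss
  `(1 + n / N)⁻¹ tᵀ M̂ ŝ(x, ŷ)`, where `M̂ = Ĉov(∇ℓ(X, Y), ŝ) Ĉov(ŝ)⁻¹` is computed on fold
  `2 - k`, with the gradient taken at the initial estimate. -/
  foldEst_argmin : ∀ n k, ∀ᵐ ω ∂P,
    let s : ℕ → Vec d := fun i => score n k ω ((Z i ω).1, Yhat (Z i ω))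
    let M : Matrix (Fin d) (Fin d) ℝ :=
      sampleCov (fold n (2 - k))
        (fun i => gradLoss (initial n k ω) (Z i ω).1 (Y (Z i ω))) s *
      (sampleCov (fold n (2 - k)) s s)⁻¹
    IsArgmin
      (ppiObjective Y Yhat (fun i => Z i ω) (fold n (2 - k)) (unlabelled N n)
        (fun t x y => (1 + (n : ℝ) / N n)⁻¹ *
          (t.ofLp ⬝ᵥ (M *ᵥ (score n k ω (x, y)).ofLp))))
      (foldEst n k ω)

/-- The cross-fitted RePPI estimate `∑ₖ (|Dₖ| / n) θ̂ᵏ`. -/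
def RePPIRun.estimate {Ω : Type*} [MeasurableSpace Ω] {P : Measure Ω} {d m : ℕ}
    {Y Yhat : Obs d m → ℝ} {Z : ℕ → Ω → Obs d m} {N : ℕ → ℕ} (R : RePPIRun P Y Yhat Z N)
    (n : ℕ) (ω : Ω) : Vec d :=
  ∑ k : Fin 3, (((R.fold n k).card : ℝ) / n) • R.foldEst n k ω

/-- The learned regression functions converge to `s` in mean square at an independent unit. -/
def RePPIRun.ScoreConsistent {Ω : Type*} [MeasurableSpace Ω] {P : Measure Ω} {d m : ℕ}
    {Y Yhat : Obs d m → ℝ} {Z : ℕ → Ω → Obs d m} {N : ℕ → ℕ} (R : RePPIRun P Y Yhat Z N)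
    (μ : Measure (Obs d m)) (s : Vec d × ℝ → Vec d) : Prop :=
  ∀ k, Tendsto
    (fun n => ∫⁻ ω, ∫⁻ z, ‖R.score n k ω (z.1, Yhat z) - s (z.1, Yhat z)‖ₑ ^ 2 ∂μ ∂P)
    atTop (𝓝 0)

end PPI

end

open PPI

/-! Every loss here is quadratic or linear in the parameter, so a PPI estimator solves a linear
system exactly. Write `u = ∇ℓ_θ(X, Y)` and let `v` be the imputed gradient with scale `c`. The
estimator then satisfies `A (est - θ) = -(avg_L u - c (avg_L v - avg_U v))`, where `A` is the
empirical Hessian. `A` converges in probability to `H = 2 Σ_X`, so with probability tending to one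
it is positive definite and the minimizer exists and is unique
(`HasQuadExpansion.mulVec_sub_eq_neg`, `tendsto_solution_sub`). Since `E u = 0`, `√n` times the
right-hand side is a centred two-sample statistic with independent labelled and unlabelled blocks.
It is asymptotically Gaussian with covariance `Cov(u - c v) + r Cov(c v)`
(`tendstoInDistribution_two_sample`), and Slutsky's lemma gives the sandwich. A random scale
consistent for `c` changes nothing, because the difference of averages it multiplies is already of
order `1/√n`.

For cross-fitting, the error of the learned score enters through a labelled average minus an
unlabelled average of one function, learned from independent data. Given the training data this
contrast has mean zero, and its second moment is at most a constant times the mean square error of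
the learned score. Mean square consistency without a rate therefore suffices
(`tendsto_sqrt_learned_contrast`). The weight matrix tends to `Cov(u, s⋆) Cov(s⋆)⁻¹ = 1`
(`tendsto_weight`). Each fold estimate is then linear in the contrast of its own fold with the true
`s⋆`, and the weighted sum over folds rebuilds the contrast of the whole labelled sample.

For the closed forms, every score in sight is `-2 L x` with `L` a linear form of the Gaussian unit.
Isserlis' formula gives its covariance as `4 (q Σ_X + (Σ_X δ)(Σ_X δ)ᵀ)`, where `q = E L²` and `δ` is
the `X`-coefficient of `L`. After the sandwich the trace is `q Tr(Σ_X⁻¹) + ‖δ‖²` (`covMat_linScore`,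
`trace_sandwich`). With `ρ = γᵀΣ_Wγ̃ / γ̃ᵀΣ_Wγ̃`, the residual `Wᵀ(γ - ργ̃) + ε` is independent of
`(X, Ŷ)`, so `s⋆ = -2 ρ (Wᵀγ̃) X` (`condGrad_ae_eq`); it carries no `δ`. The trace of `Σ_λ` is a
quadratic polynomial in `λ`, and completing the square gives PPI++ and the ordering. -/

section InProb

/-! ### Convergence and boundedness in probability, as filter calculus. -/

variable {Ω : Type*} [MeasurableSpace Ω] {P : Measure Ω}

/-- The filter on `ℕ × Ω` of the sets whose `n`-th section has probability tending to one:
convergence in probability to a constant is convergence along this filter. -/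
def inProb (P : Measure Ω) : Filter (ℕ × Ω) where
  sets := {S | Tendsto (fun n => P {ω | (n, ω) ∉ S}) atTop (𝓝 0)}
  univ_sets := by simp
  sets_of_superset {S T} hS hST := by
    refine tendsto_of_tendsto_of_tendsto_of_le_of_le tendsto_const_nhds hS
      (fun _ => zero_le) fun n => measure_mono fun ω hω hS' => hω (hST hS')
  inter_sets {S T} hS hT := by
    have h := Tendsto.add hS hT
    rw [add_zero] at h
    refine tendsto_of_tendsto_of_tendsto_of_le_of_le tendsto_const_nhds h
      (fun _ => zero_le) fun n => le_trans (measure_mono ?_) (measure_union_le _ _)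
    intro ω hω
    by_contra hc
    simp only [Set.mem_union, Set.mem_ofPred_eq, not_or, not_not] at hc
    exact hω hc

lemma eventually_inProb {p : ℕ × Ω → Prop} :
    (∀ᶠ q in inProb P, p q) ↔ Tendsto (fun n => P {ω | ¬ p (n, ω)}) atTop (𝓝 0) := Iff.rfl

lemma eventually_inProb_of_ae {p : ℕ × Ω → Prop} (h : ∀ n, ∀ᵐ ω ∂P, p (n, ω)) :
    ∀ᶠ q in inProb P, p q := by
  rw [eventually_inProb]
  have : ∀ n, P {ω | ¬ p (n, ω)} = 0 := fun n => ae_iff.1 (h n)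
  simp [this]

lemma tendsto_fst_inProb : Tendsto Prod.fst (inProb P) atTop := by
  intro S hS
  change Tendsto _ _ _
  refine tendsto_const_nhds.congr' ?_
  filter_upwards [mem_atTop_sets.1 hS |>.choose_spec |> fun h => eventually_atTop.2 ⟨_, h⟩]
    with n hn
  simp [hn]

/-- This is what the filter is for: continuous mapping, products and "with probability tending to
one" become ordinary `Tendsto` and `Eventually` arguments. -/
lemma tendstoInMeasure_iff_tendsto_inProb {E : Type*} [PseudoEMetricSpace E]
    {X : ℕ × Ω → E} {c : E} :
    TendstoInMeasure P (fun n ω => X (n, ω)) atTop (fun _ => c) ↔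
      Tendsto X (inProb P) (𝓝 c) := by
  rw [EMetric.tendsto_nhds]
  simp only [eventually_inProb, not_lt]
  rfl

/-- Boundedness in probability of a sequence of real random variables. -/
def BddInProb (P : Measure Ω) (X : ℕ × Ω → ℝ) : Prop :=
  ∀ η : ℝ≥0∞, 0 < η → ∃ M : ℝ, ∀ᶠ n in atTop, P {ω | M < |X (n, ω)|} ≤ η

lemma BddInProb.add {X Y : ℕ × Ω → ℝ} (hX : BddInProb P X) (hY : BddInProb P Y) :
    BddInProb P (fun q => X q + Y q) := by
  intro η hη
  obtain ⟨M, hM⟩ := hX (η / 2) (ENNReal.half_pos hη.ne')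
  obtain ⟨M', hM'⟩ := hY (η / 2) (ENNReal.half_pos hη.ne')
  refine ⟨M + M', ?_⟩
  filter_upwards [hM, hM'] with n h1 h2
  calc P {ω | M + M' < |X (n, ω) + Y (n, ω)|}
      ≤ P ({ω | M < |X (n, ω)|} ∪ {ω | M' < |Y (n, ω)|}) := by
        refine measure_mono fun ω hω => ?_
        by_contra hc
        simp only [Set.mem_union, Set.mem_ofPred_eq, not_or, not_lt] at hc hω
        have := abs_add_le (X (n, ω)) (Y (n, ω))
        linarith
    _ ≤ η / 2 + η / 2 := (measure_union_le _ _).trans (add_le_add h1 h2)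
    _ = η := ENNReal.add_halves η

lemma BddInProb.const_mul {X : ℕ × Ω → ℝ} (hX : BddInProb P X) (c : ℝ) :
    BddInProb P (fun q => c * X q) := by
  intro η hη
  obtain ⟨M, hM⟩ := hX η hη
  refine ⟨|c| * |M|, ?_⟩
  filter_upwards [hM] with n h
  refine le_trans (measure_mono fun ω hω => ?_) h
  simp only [Set.mem_ofPred_eq, abs_mul] at hω ⊢
  by_contra hc
  push Not at hc
  exact absurd hω (not_lt.2 (mul_le_mul_of_nonneg_left (hc.trans (le_abs_self M)) (abs_nonneg c)))

lemma BddInProb.sub {X Y : ℕ × Ω → ℝ} (hX : BddInProb P X) (hY : BddInProb P Y) :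
    BddInProb P (fun q => X q - Y q) := by
  simpa [sub_eq_add_neg] using hX.add (hY.const_mul (-1))

/-- The product of a sequence converging to zero in probability and a sequence bounded in
probability converges to zero in probability. -/
lemma BddInProb.tendsto_mul {X Y : ℕ × Ω → ℝ} (hY : BddInProb P Y)
    (hX : Tendsto X (inProb P) (𝓝 0)) : Tendsto (fun q => X q * Y q) (inProb P) (𝓝 0) := by
  rw [Metric.tendsto_nhds]
  intro ε hε
  rw [eventually_inProb, ENNReal.tendsto_atTop_zero]
  intro η hη
  obtain ⟨M, hM⟩ := hY (η / 2) (ENNReal.half_pos hη.ne')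
  have hpos : 0 < ε / (|M| + 1) := by positivity
  have h1 := (Metric.tendsto_nhds.1 hX) _ hpos
  rw [eventually_inProb, ENNReal.tendsto_atTop_zero] at h1
  obtain ⟨n1, hn1⟩ := h1 (η / 2) (ENNReal.half_pos hη.ne')
  obtain ⟨n2, hn2⟩ := eventually_atTop.1 hM
  refine ⟨max n1 n2, fun n hn => ?_⟩
  refine le_trans (measure_mono ?_) ((measure_union_le _ _).trans
    ((add_le_add (hn1 n (le_trans (le_max_left _ _) hn))
      (hn2 n (le_trans (le_max_right _ _) hn))).trans (ENNReal.add_halves η).le))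
  intro ω hω
  by_contra hc
  simp only [Set.mem_union, Set.mem_ofPred_eq, not_or, not_lt, dist_zero_right,
    Real.norm_eq_abs, abs_mul] at hc hω
  have h3 : |X (n, ω)| * |Y (n, ω)| ≤ |X (n, ω)| * (|M| + 1) :=
    mul_le_mul_of_nonneg_left (by linarith [hc.2, le_abs_self M]) (abs_nonneg _)
  have h4 : |X (n, ω)| * (|M| + 1) < ε := by
    have := hc.1
    rwa [not_le, lt_div_iff₀ (by positivity)] at this
  linarith

/-- Chebyshev's inequality. -/
lemma bddInProb_of_lintegral_sq_le {X : ℕ × Ω → ℝ} (hm : ∀ n, AEMeasurable (fun ω => X (n, ω)) P)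
    {K : ℝ≥0∞} (hK : K ≠ ∞) (h : ∀ᶠ n in atTop, ∫⁻ ω, ‖X (n, ω)‖ₑ ^ 2 ∂P ≤ K) :
    BddInProb P X := by
  intro η hη
  rcases eq_or_ne η ∞ with rfl | hη'
  · exact ⟨0, by simp⟩
  -- Chebyshev requires `K / M² ≤ η`; the `+ 1` keeps `M` positive when `K = 0`.
  set M : ℝ := √((K / η).toReal) + 1
  have hKη : K / η ≠ ∞ := ENNReal.div_ne_top hK hη.ne'
  refine ⟨M, ?_⟩
  filter_upwards [h] with n hn
  have hM0 : 0 < M := by positivity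
  have hM : K / η ≤ ENNReal.ofReal (M ^ 2) := by
    rw [← ENNReal.ofReal_toReal hKη]
    refine ENNReal.ofReal_le_ofReal ?_
    calc (K / η).toReal = √((K / η).toReal) ^ 2 := (Real.sq_sqrt ENNReal.toReal_nonneg).symm
      _ ≤ M ^ 2 := by gcongr; simp [M]
  have h2 : ENNReal.ofReal (M ^ 2) * P {ω | M < |X (n, ω)|} ≤ K := by
    refine le_trans ?_ ((mul_meas_ge_le_lintegral₀ ((hm n).enorm.pow_const 2)
      (ENNReal.ofReal (M ^ 2))).trans hn)
    gcongr
    intro hω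
    rw [← ofReal_norm, ← ENNReal.ofReal_pow (norm_nonneg _)]
    exact ENNReal.ofReal_le_ofReal (pow_le_pow_left₀ hM0.le (le_of_lt hω) 2)
  have h3 : P {ω | M < |X (n, ω)|} ≤ K / ENNReal.ofReal (M ^ 2) := by
    rw [ENNReal.le_div_iff_mul_le (Or.inl (by simp; positivity)) (Or.inl ENNReal.ofReal_ne_top),
      mul_comm]
    exact h2
  refine h3.trans (ENNReal.div_le_of_le_mul ?_)
  rw [mul_comm]
  exact (ENNReal.div_le_iff hη.ne' hη').1 hM

/-- Markov's inequality for the `k`-th moment. It is needed with `k = 1` for averages of squares and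
with `k = 2` for contrasts. -/
lemma tendsto_inProb_of_lintegral {E : Type*} [SeminormedAddCommGroup E] [MeasurableSpace E]
    [OpensMeasurableSpace E] {X : ℕ × Ω → E} (hm : ∀ n, AEMeasurable (fun ω => X (n, ω)) P)
    {k : ℕ}
    (h : Tendsto (fun n => ∫⁻ ω, ‖X (n, ω)‖ₑ ^ k ∂P) atTop (𝓝 0)) :
    Tendsto X (inProb P) (𝓝 0) := by
  rw [Metric.tendsto_nhds]
  intro ε hε
  rw [eventually_inProb]
  have hε' : ENNReal.ofReal (ε ^ k) ≠ 0 := by simp; positivity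
  have h2 := ENNReal.Tendsto.div_const h (b := ENNReal.ofReal (ε ^ k)) (Or.inr hε')
  rw [ENNReal.zero_div] at h2
  refine tendsto_of_tendsto_of_tendsto_of_le_of_le tendsto_const_nhds h2
    (fun _ => zero_le) fun n => ?_
  refine le_trans (measure_mono fun ω hω => ?_)
    (meas_ge_le_lintegral_div ((hm n).enorm.pow_const k) hε' ENNReal.ofReal_ne_top)
  simp only [Set.mem_ofPred_eq, dist_zero_right, not_lt] at hω ⊢
  rw [← ofReal_norm, ← ENNReal.ofReal_pow (norm_nonneg _)]
  exact ENNReal.ofReal_le_ofReal (pow_le_pow_left₀ hε.le hω k)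

lemma tendsto_inv_sqrt_inProb :
    Tendsto (fun q : ℕ × Ω => (√(q.1 : ℝ))⁻¹) (inProb P) (𝓝 0) :=
  (tendsto_inv_atTop_zero.comp (Real.tendsto_sqrt_atTop.comp
    tendsto_natCast_atTop_atTop)).comp tendsto_fst_inProb

end InProb

/-! ### Averages of i.i.d. units: second moments and the weak law of large numbers. -/

section Averages

variable {Ω 𝓩 : Type*} [MeasurableSpace Ω] [MeasurableSpace 𝓩] {P : Measure Ω} {μ : Measure 𝓩}
  [IsProbabilityMeasure P] {Z : ℕ → Ω → 𝓩}

lemma lintegral_enorm_sq_eq {g : 𝓩 → ℝ} (hg : MemLp g 2 μ) :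
    ∫⁻ x, ‖g x‖ₑ ^ 2 ∂μ = ENNReal.ofReal (∫ x, g x ^ 2 ∂μ) := by
  rw [ofReal_integral_eq_lintegral_ofReal hg.integrable_sq (ae_of_all _ fun x => sq_nonneg _)]
  refine lintegral_congr fun x => ?_
  rw [← ofReal_norm, ← ENNReal.ofReal_pow (norm_nonneg _), Real.norm_eq_abs, sq_abs]

/-- Weighted sums of centred i.i.d. variables: second moment bound. -/
lemma lintegral_enorm_sq_sum_le (hZ : ∀ i, Measurable (Z i)) (hind : iIndepFun Z P)
    (hlaw : ∀ i, P.map (Z i) = μ) {f : 𝓩 → ℝ} (hf : Measurable f) (J : Finset ℕ) (a : ℕ → ℝ) :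
    ∫⁻ ω, ‖∑ i ∈ J, a i * (f (Z i ω) - ∫ z, f z ∂μ)‖ₑ ^ 2 ∂P ≤
      ENNReal.ofReal (∑ i ∈ J, a i ^ 2) * ∫⁻ z, ‖f z‖ₑ ^ 2 ∂μ := by
  have hμ : IsProbabilityMeasure μ := (hlaw 0) ▸ Measure.isProbabilityMeasure_map (hZ 0).aemeasurable
  -- If `f` is not square integrable, the bound is infinite or all weights vanish. Doing without an
  -- integrability hypothesis matters later, when `f` is a learned function frozen at an arbitrary
  -- outcome of the training data.
  by_cases hL : MemLp f 2 μ
  · have hL' : ∀ i, MemLp (fun ω => a i * (f (Z i ω) - ∫ z, f z ∂μ)) 2 P := fun i =>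
      ((hL.sub (memLp_const _)).comp_measurePreserving
        (⟨hZ i, hlaw i⟩)).const_mul _
    have hint : ∀ i, ∫ ω, a i * (f (Z i ω) - ∫ z, f z ∂μ) ∂P = 0 := by
      intro i
      have h1 : ∫ ω, (f (Z i ω) - ∫ z, f z ∂μ) ∂P = ∫ z, (f z - ∫ z, f z ∂μ) ∂μ := by
        rw [← hlaw i]
        exact (integral_map (hZ i).aemeasurable
          (hf.sub_const _).aestronglyMeasurable).symm
      rw [integral_const_mul, h1, integral_sub (hL.integrable (by simp)) (by simp)]
      simp
    have hvar : ∀ i, Var[fun ω => a i * (f (Z i ω) - ∫ z, f z ∂μ); P] = a i ^ 2 * Var[f; μ] := by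
      intro i
      rw [variance_const_mul]
      congr 1
      have : Var[fun ω => f (Z i ω) - ∫ z, f z ∂μ; P] = Var[fun ω => f (Z i ω); P] :=
        variance_sub_const ((hf.comp (hZ i)).aestronglyMeasurable) _
      rw [this, ← hlaw i]
      exact (variance_map hf.aemeasurable (hZ i).aemeasurable).symm
    have hS : MemLp (fun ω => ∑ i ∈ J, a i * (f (Z i ω) - ∫ z, f z ∂μ)) 2 P :=
      memLp_finsetSum J fun i _ => hL' i
    have e2 : ∫ ω, (∑ i ∈ J, a i * (f (Z i ω) - ∫ z, f z ∂μ)) ^ 2 ∂P =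
        (∑ i ∈ J, a i ^ 2) * Var[f; μ] := by
      have h0 : ∫ ω, (∑ i ∈ J, a i * (f (Z i ω) - ∫ z, f z ∂μ)) ∂P = 0 := by
        rw [integral_finsetSum _ fun i _ => (hL' i).integrable (by simp)]
        simp [hint]
      have h1 := variance_eq_sub hS
      simp only [Pi.pow_apply, h0] at h1
      have h2 : Var[fun ω => ∑ i ∈ J, a i * (f (Z i ω) - ∫ z, f z ∂μ); P] =
          ∑ i ∈ J, Var[fun ω => a i * (f (Z i ω) - ∫ z, f z ∂μ); P] := by
        have := IndepFun.variance_sum (μ := P) (s := J)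
          (X := fun i ω => a i * (f (Z i ω) - ∫ z, f z ∂μ)) (fun i _ => hL' i) ?_
        · rw [← this]
          congr 1
          ext ω
          simp
        · intro i _ j _ hij
          exact (hind.indepFun hij).comp (φ := fun z => a i * (f z - ∫ z, f z ∂μ))
            (ψ := fun z => a j * (f z - ∫ z, f z ∂μ)) (by fun_prop) (by fun_prop)
      rw [h2] at h1
      rw [Finset.sum_mul]
      simp only [hvar] at h1
      linarith
    rw [lintegral_enorm_sq_eq hS, e2, lintegral_enorm_sq_eq hL,
      ENNReal.ofReal_mul (Finset.sum_nonneg fun i _ => sq_nonneg _)]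
    gcongr
    exact variance_le_expectation_sq hf.aestronglyMeasurable
  · have htop : ∫⁻ z, ‖f z‖ₑ ^ 2 ∂μ = ∞ := by
      by_contra hne
      refine hL ⟨hf.aestronglyMeasurable, ?_⟩
      rw [eLpNorm_lt_top_iff_lintegral_rpow_enorm_lt_top (by simp) (by simp)]
      simpa using lt_top_iff_ne_top.2 hne
    rw [htop]
    rcases eq_or_ne (∑ i ∈ J, a i ^ 2) 0 with h0 | h0
    · rw [Finset.sum_eq_zero_iff_of_nonneg fun i _ => sq_nonneg _] at h0
      have : ∀ ω, ∑ i ∈ J, a i * (f (Z i ω) - ∫ z, f z ∂μ) = 0 := fun ω =>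
        Finset.sum_eq_zero fun i hi => by simp [pow_eq_zero_iff (two_ne_zero) |>.1 (h0 i hi)]
      simp [this]
    · rw [ENNReal.mul_top]
      · exact le_top
      · have : 0 < ∑ i ∈ J, a i ^ 2 :=
          lt_of_le_of_ne (Finset.sum_nonneg fun i _ => sq_nonneg _) h0.symm
        simpa using this

lemma avg_real (I : Finset ℕ) (f : ℕ → ℝ) : avg I f = ∑ i ∈ I, (I.card : ℝ)⁻¹ * f i := by
  rw [avg, smul_eq_mul, Finset.mul_sum]

lemma avg_const {V : Type*} [AddCommGroup V] [Module ℝ V] {I : Finset ℕ} (hI : I.card ≠ 0)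
    (v : V) : avg I (fun _ => v) = v := by
  rw [avg, Finset.sum_const, ← Nat.cast_smul_eq_nsmul ℝ, smul_smul,
    inv_mul_cancel₀ (by exact_mod_cast hI), one_smul]

lemma avg_add {V : Type*} [AddCommGroup V] [Module ℝ V] (I : Finset ℕ) (f g : ℕ → V) :
    avg I (fun i => f i + g i) = avg I f + avg I g := by
  simp [avg, Finset.sum_add_distrib]

lemma avg_sub {V : Type*} [AddCommGroup V] [Module ℝ V] (I : Finset ℕ) (f g : ℕ → V) :
    avg I (fun i => f i - g i) = avg I f - avg I g := by
  simp [avg, smul_sub]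

lemma avg_map {V W : Type*} [AddCommGroup V] [Module ℝ V] [AddCommGroup W] [Module ℝ W]
    (I : Finset ℕ) (L : V →ₗ[ℝ] W) (f : ℕ → V) : avg I (fun i => L (f i)) = L (avg I f) := by
  simp [avg]

lemma avg_mul_left (I : Finset ℕ) (c : ℝ) (f : ℕ → ℝ) :
    avg I (fun i => c * f i) = c * avg I f := avg_map I (LinearMap.mulLeft ℝ c) f

/-- The variance factor of `√n` times an average: the weights `√n / |I|` have total square `n /
|I|`. -/
lemma sum_sq_sqrt_mul_inv_card_le {n : ℕ} {I : Finset ℕ} {K : ℝ} (hK : 0 ≤ K)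
    (hI : (n : ℝ) ≤ K * I.card) : ∑ _i ∈ I, (√n * (I.card : ℝ)⁻¹) ^ 2 ≤ K := by
  rw [Finset.sum_const, nsmul_eq_mul, mul_pow, Real.sq_sqrt (by positivity)]
  rcases Nat.eq_zero_or_pos I.card with h0 | h0
  · simpa [h0] using hK
  · have : (0 : ℝ) < I.card := by exact_mod_cast h0
    field_simp
    linarith

lemma card_ne_zero_of_le_mul {n : ℕ} {I : Finset ℕ} {K : ℝ} (hn : 0 < n)
    (hI : (n : ℝ) ≤ K * I.card) : I.card ≠ 0 := by
  intro h0
  rw [h0] at hI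
  have : (0 : ℝ) < n := by exact_mod_cast hn
  simp at hI
  omega

lemma measurable_avg {I : Finset ℕ} {g : ℕ → Ω → ℝ} (hg : ∀ i, Measurable (g i)) :
    Measurable fun ω => avg I fun i => g i ω := by
  simp only [avg_real]
  fun_prop

/-- `√n` times the centred average over a set of units of size at least proportional to `n` is
bounded in probability. -/
lemma bddInProb_sqrt_mul_avg (hZ : ∀ i, Measurable (Z i)) (hind : iIndepFun Z P)
    (hlaw : ∀ i, P.map (Z i) = μ) {f : 𝓩 → ℝ} (hf : Measurable f) (hf2 : MemLp f 2 μ)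
    {I : ℕ → Finset ℕ} {K : ℝ} (hK : 0 ≤ K) (hI : ∀ᶠ n : ℕ in atTop, (n : ℝ) ≤ K * (I n).card) :
    BddInProb P fun q => √(q.1 : ℝ) * (avg (I q.1) (fun i => f (Z i q.2)) - ∫ z, f z ∂μ) := by
  refine bddInProb_of_lintegral_sq_le (K := ENNReal.ofReal K * ∫⁻ z, ‖f z‖ₑ ^ 2 ∂μ) ?_ ?_ ?_
  · intro n
    have hm := measurable_avg (I := I n) (g := fun i ω => f (Z i ω)) fun i => hf.comp (hZ i)
    exact ((hm.sub_const (∫ z, f z ∂μ)).const_mul √(n : ℝ)).aemeasurable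
  · rw [lintegral_enorm_sq_eq hf2]
    exact ENNReal.mul_ne_top ENNReal.ofReal_ne_top ENNReal.ofReal_ne_top
  · filter_upwards [hI, eventually_gt_atTop 0] with n hn hpos
    have hc := card_ne_zero_of_le_mul hpos hn
    have h := lintegral_enorm_sq_sum_le hZ hind hlaw hf (I n) fun _ => √n * ((I n).card : ℝ)⁻¹
    refine le_trans (le_of_eq ?_) (h.trans ?_)
    · refine lintegral_congr fun ω => ?_
      congr 2
      rw [← Finset.mul_sum, Finset.sum_sub_distrib, Finset.sum_const, nsmul_eq_mul, avg,
        smul_eq_mul]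
      have : ((I n).card : ℝ) ≠ 0 := by exact_mod_cast hc
      field_simp
    · gcongr
      exact sum_sq_sqrt_mul_inv_card_le hK hn

/-- The weak law of large numbers over sets of units of size at least proportional to `n`. -/
lemma tendsto_avg_inProb (hZ : ∀ i, Measurable (Z i)) (hind : iIndepFun Z P)
    (hlaw : ∀ i, P.map (Z i) = μ) {f : 𝓩 → ℝ} (hf : Measurable f) (hf2 : MemLp f 2 μ)
    {I : ℕ → Finset ℕ} {K : ℝ} (hK : 0 ≤ K) (hI : ∀ᶠ n : ℕ in atTop, (n : ℝ) ≤ K * (I n).card) :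
    Tendsto (fun q : ℕ × Ω => avg (I q.1) fun i => f (Z i q.2)) (inProb P)
      (𝓝 (∫ z, f z ∂μ)) := by
  have h := (bddInProb_sqrt_mul_avg hZ hind hlaw hf hf2 hK hI).tendsto_mul tendsto_inv_sqrt_inProb
  rw [← tendsto_sub_nhds_zero_iff]
  refine h.congr' ?_
  filter_upwards [tendsto_fst_inProb.eventually (eventually_gt_atTop 0)] with q hq
  have : √(q.1 : ℝ) ≠ 0 := by positivity
  field_simp

/-- Independent random elements can be integrated one after the other. -/
lemma lintegral_comp_indepFun {𝓣 𝓥 : Type*} [MeasurableSpace 𝓣] [MeasurableSpace 𝓥] {T : Ω → 𝓣}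
    {V : Ω → 𝓥} (hT : Measurable T) (hV : Measurable V) (hTV : IndepFun T V P)
    {G : 𝓣 × 𝓥 → ℝ≥0∞} (hG : Measurable G) :
    ∫⁻ ω, G (T ω, V ω) ∂P = ∫⁻ ω, ∫⁻ ω', G (T ω, V ω') ∂P ∂P := by
  have h1 := (indepFun_iff_map_prod_eq_prod_map_map hT.aemeasurable hV.aemeasurable).1 hTV
  have : IsProbabilityMeasure (P.map V) := Measure.isProbabilityMeasure_map hV.aemeasurable
  rw [← lintegral_map hG (hT.prodMk hV), h1, lintegral_prod _ hG.aemeasurable,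
    lintegral_map (Measurable.lintegral_prod_right' hG) hT]
  refine lintegral_congr fun ω => ?_
  rw [lintegral_map (by fun_prop) hV]

/-- Second moment bound for contrasts of a function learned from independent information. -/
lemma lintegral_enorm_sq_contrast_le {𝓣 : Type*} [MeasurableSpace 𝓣] {T : Ω → 𝓣}
    (hT : Measurable T) (hZ : ∀ i, Measurable (Z i)) (hind : iIndepFun Z P)
    (hlaw : ∀ i, P.map (Z i) = μ) {J : Finset ℕ}
    (hTZ : IndepFun T (fun ω (i : J) => Z i ω) P) {h : 𝓣 × 𝓩 → ℝ} (hh : Measurable h)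
    {a : ℕ → ℝ} (ha : ∑ i ∈ J, a i = 0) :
    ∫⁻ ω, ‖∑ i ∈ J, a i * h (T ω, Z i ω)‖ₑ ^ 2 ∂P ≤
      ENNReal.ofReal (∑ i ∈ J, a i ^ 2) * ∫⁻ ω, ∫⁻ z, ‖h (T ω, z)‖ₑ ^ 2 ∂μ ∂P := by
  have hμ : IsProbabilityMeasure μ := (hlaw 0) ▸ Measure.isProbabilityMeasure_map (hZ 0).aemeasurable
  have hG : Measurable fun p : 𝓣 × (J → 𝓩) =>
      ‖∑ i : J, a i * h (p.1, p.2 i)‖ₑ ^ 2 := by fun_prop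
  have h1 := lintegral_comp_indepFun hT (by fun_prop) hTZ hG
  simp only [← Finset.attach_eq_univ] at h1
  have h2 : ∀ ω ω', ∑ i ∈ J.attach, a i * h (T ω, Z i ω') = ∑ i ∈ J, a i * h (T ω, Z i ω') :=
    fun ω ω' => Finset.sum_attach J fun i => a i * h (T ω, Z i ω')
  simp only [h2] at h1
  have hm : Measurable fun ω => ∫⁻ z, ‖h (T ω, z)‖ₑ ^ 2 ∂μ :=
    (Measurable.lintegral_prod_right' (f := fun p : 𝓣 × 𝓩 => ‖h p‖ₑ ^ 2) (by fun_prop)).comp hT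
  rw [h1, ← lintegral_const_mul _ hm]
  refine lintegral_mono fun ω => ?_
  refine le_trans (le_of_eq (lintegral_congr fun ω' => ?_))
    (lintegral_enorm_sq_sum_le hZ hind hlaw (f := fun z => h (T ω, z)) (by fun_prop) J a)
  -- The weights sum to zero, so centring the frozen function at its unknown mean does not change
  -- the contrast.
  simp [mul_sub, Finset.sum_sub_distrib, ← Finset.sum_mul, ha]

end Averages

/-! ### The two-sample central limit theorem and asymptotic linearity. -/

section CentralLimit

variable {Ω 𝓩 : Type*} [MeasurableSpace Ω] [MeasurableSpace 𝓩] {P : Measure Ω} {μ : Measure 𝓩}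
  [IsProbabilityMeasure P] {Z : ℕ → Ω → 𝓩}

/-- The characteristic function depends on `I` only through its size, so the shifted block of
unlabelled units is treated like an initial segment. -/
lemma charFun_map_const_mul_sum {P : Measure Ω} (hZ : ∀ i, Measurable (Z i)) (hind : iIndepFun Z P)
    (hlaw : ∀ i, P.map (Z i) = μ) {f : 𝓩 → ℝ} (hf : Measurable f) (I : Finset ℕ) (c t : ℝ) :
    charFun (P.map fun ω => c * ∑ i ∈ I, f (Z i ω)) t = charFun (μ.map f) (c * t) ^ I.card := by
  have hm : ∀ i, Measurable fun ω => f (Z i ω) := fun i => hf.comp (hZ i)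
  have hi : iIndepFun (fun i ω => f (Z i ω)) P := hind.comp (fun _ => f) fun _ => hf
  have hl : ∀ i, P.map (fun ω => f (Z i ω)) = μ.map f := fun i => by
    rw [← hlaw i, Measure.map_map hf (hZ i)]; rfl
  rw [charFun_map_mul_comp (Finset.measurable_sum I fun i _ => hm i).aemeasurable,
    (hi.restrict _).charFun_map_fun_finsetSum_eq_prod (fun i _ => (hm i).aemeasurable)]
  simp [hl]

lemma tendsto_charFun_of_tendstoInDistribution {E : Type*} [NormedAddCommGroup E]
    [InnerProductSpace ℝ E] [FiniteDimensional ℝ E] [MeasurableSpace E] [BorelSpace E]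
    {Ω' : Type*} [MeasurableSpace Ω']
    {P' : Measure Ω'} [IsProbabilityMeasure P'] {X : ℕ → Ω → E} {Y : Ω' → E}
    (h : TendstoInDistribution X atTop Y (fun _ => P) P') (t : E) :
    Tendsto (fun n => charFun (P.map (X n)) t) atTop (𝓝 (charFun (P'.map Y) t)) :=
  ProbabilityMeasure.tendsto_iff_tendsto_charFun.1 h.tendsto t

/-- The central limit theorem for characteristic functions of rescaled sums with `N n` terms. -/
lemma tendsto_charFun_pow (hZ : ∀ i, Measurable (Z i)) (hind : iIndepFun Z P)
    (hlaw : ∀ i, P.map (Z i) = μ) {f : 𝓩 → ℝ} (hf : Measurable f) (hf2 : MemLp f 2 μ)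
    {N : ℕ → ℕ} (hN : Tendsto N atTop atTop) {c : ℕ → ℝ} {ρ : ℝ}
    (hc : Tendsto (fun n => c n * √(N n : ℝ)) atTop (𝓝 ρ)) :
    Tendsto (fun n => charFun (μ.map fun z => f z - ∫ z, f z ∂μ) (c n) ^ N n) atTop
      (𝓝 (Complex.exp (-(ρ ^ 2 * Var[f; μ] : ℝ) / 2))) := by
  have hμ : IsProbabilityMeasure μ := (hlaw 0) ▸ Measure.isProbabilityMeasure_map (hZ 0).aemeasurable
  set m := ∫ z, f z ∂μ
  have hm : ∀ i, Measurable fun ω => f (Z i ω) := fun i => hf.comp (hZ i)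
  have hid : ∀ i, IdentDistrib (fun ω => f (Z i ω)) (fun ω => f (Z 0 ω)) P P := fun i =>
    ⟨(hm i).aemeasurable, (hm 0).aemeasurable, by
      change P.map (f ∘ Z i) = P.map (f ∘ Z 0)
      rw [← Measure.map_map hf (hZ i), ← Measure.map_map hf (hZ 0), hlaw, hlaw]⟩
  have hmean : ∫ ω, f (Z 0 ω) ∂P = m := by
    rw [← integral_map (hZ 0).aemeasurable hf.aestronglyMeasurable, hlaw]
  have hvar : Var[fun ω => f (Z 0 ω); P] = Var[f; μ] := by
    rw [← hlaw 0]
    exact (variance_map hf.aemeasurable (hZ 0).aemeasurable).symm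
  have h1 := tendstoInDistribution_inv_sqrt_mul_sum_sub (P := P)
    (X := fun i ω => f (Z i ω)) (Y := id)
    (P' := gaussianReal 0 Var[fun ω => f (Z 0 ω); P].toNNReal) ⟨aemeasurable_id, Measure.map_id⟩
    (hf2.comp_measurePreserving ⟨hZ 0, hlaw 0⟩)
    (hind.comp (fun _ => f) fun _ => hf) hid
  have h2 : TendstoInDistribution (fun n ω => (√(N n : ℝ))⁻¹ *
      (∑ k ∈ Finset.range (N n), f (Z k ω) - N n * ∫ ω, f (Z 0 ω) ∂P)) atTop id (fun _ => P)
      (gaussianReal 0 Var[fun ω => f (Z 0 ω); P].toNNReal) :=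
    ⟨fun n => h1.forall_aemeasurable (N n), h1.aemeasurable_limit, h1.tendsto.comp hN⟩
  -- Slutsky's lemma with the deterministic factor `c n * √(N n)` replaces the normalization `(√(N
  -- n))⁻¹` by `c n`.
  have h3 := h2.continuous_comp_prodMk_of_tendstoInMeasure_const (g := fun p : ℝ × ℝ => p.2 * p.1)
    (by fun_prop) (Y := fun n _ => c n * √(N n : ℝ)) (c := ρ)
    ((tendstoInMeasure_iff_tendsto_inProb (X := fun q : ℕ × Ω => c q.1 * √(N q.1 : ℝ))).2
      (hc.comp tendsto_fst_inProb)) (fun n => aemeasurable_const)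
  have h4 := tendsto_charFun_of_tendstoInDistribution h3 1
  have h5 : charFun ((gaussianReal 0 Var[fun ω => f (Z 0 ω); P].toNNReal).map
      fun ω => ρ * id ω) 1 = Complex.exp (-(ρ ^ 2 * Var[f; μ] : ℝ) / 2) := by
    simp only [id]
    rw [gaussianReal_map_const_mul, charFun_gaussianReal, hvar]
    congr 1
    simp [Real.coe_toNNReal _ (variance_nonneg f μ), neg_div]
  rw [h5] at h4
  refine h4.congr' ?_
  filter_upwards [hN.eventually_gt_atTop 0] with n hn
  have h6 := charFun_map_const_mul_sum hZ hind hlaw (hf.sub_const m) (Finset.range (N n)) (c n) 1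
  rw [mul_one, Finset.card_range] at h6
  rw [← h6]
  congr 2
  ext ω
  rw [hmean, Finset.sum_sub_distrib]
  have : √(N n : ℝ) ≠ 0 := by positivity
  simp
  field_simp

lemma indepFun_sum_sum {P : Measure Ω} (hZ : ∀ i, Measurable (Z i)) (hind : iIndepFun Z P) {f g : 𝓩 → ℝ}
    (hf : Measurable f) (hg : Measurable g) {I J : Finset ℕ} (hIJ : Disjoint I J) (a b : ℝ) :
    IndepFun (fun ω => a * ∑ i ∈ I, f (Z i ω)) (fun ω => b * ∑ i ∈ J, g (Z i ω)) P := by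
  have h := hind.indepFun_finset I J hIJ hZ
  have h2 := h.comp (φ := fun x : I → 𝓩 => a * ∑ i : I, f (x i))
    (ψ := fun x : J → 𝓩 => b * ∑ i : J, g (x i)) (by fun_prop) (by fun_prop)
  convert! h2 using 1
  · ext ω; simp [Finset.sum_attach I fun i => f (Z i ω)]
  · ext ω; simp [Finset.sum_attach J fun i => g (Z i ω)]

lemma disjoint_range_unlabelled (N : ℕ → ℕ) (n : ℕ) :
    Disjoint (Finset.range n) (unlabelled N n) := by
  rw [Finset.disjoint_left]
  intro i hi hi'
  simp [unlabelled] at hi hi'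
  omega

lemma card_unlabelled (N : ℕ → ℕ) (n : ℕ) : (unlabelled N n).card = N n := by
  simp [unlabelled]

lemma ratio_limit_nonneg {N : ℕ → ℕ} {r : ℝ}
    (hr : Tendsto (fun n : ℕ => (n : ℝ) / (N n : ℝ)) atTop (𝓝 r)) : 0 ≤ r :=
  ge_of_tendsto' hr fun n => by positivity

/-- Any constant above the limit `r` would serve; `r + 1` is also positive when `r = 0`. -/
lemma eventually_le_mul_card {N : ℕ → ℕ} (hN : ∀ n, 0 < N n) {r : ℝ}
    (hr : Tendsto (fun n : ℕ => (n : ℝ) / (N n : ℝ)) atTop (𝓝 r)) :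
    ∀ᶠ n : ℕ in atTop, (n : ℝ) ≤ (r + 1) * (unlabelled N n).card := by
  filter_upwards [hr.eventually_lt_const (lt_add_one r)] with n hn
  rw [card_unlabelled]
  have : (0 : ℝ) < N n := by exact_mod_cast hN n
  rw [div_lt_iff₀ this] at hn
  exact hn.le

lemma tendsto_card_atTop {N : ℕ → ℕ} (hN : ∀ n, 0 < N n) {r : ℝ}
    (hr : Tendsto (fun n : ℕ => (n : ℝ) / (N n : ℝ)) atTop (𝓝 r)) : Tendsto N atTop atTop := by
  have h0 := ratio_limit_nonneg hr
  rw [← tendsto_natCast_atTop_iff (R := ℝ)]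
  refine tendsto_atTop_mono' atTop (f₁ := fun n : ℕ => (n : ℝ) / (r + 1)) ?_
    (tendsto_natCast_atTop_atTop.atTop_div_const (by positivity))
  filter_upwards [eventually_le_mul_card hN hr] with n hn
  rw [card_unlabelled] at hn
  rw [div_le_iff₀ (by positivity)]
  linarith

/-- The two-sample central limit theorem: `√n` times the sum of the centred averages over `n`
labelled and `N n` unlabelled units is asymptotically Gaussian. -/
theorem tendstoInDistribution_two_sample (hZ : ∀ i, Measurable (Z i)) (hind : iIndepFun Z P)
    (hlaw : ∀ i, P.map (Z i) = μ) {d : ℕ} {f g : 𝓩 → Vec d} (hf : Measurable f)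
    (hg : Measurable g) (hf2 : MemLp f 2 μ) (hg2 : MemLp g 2 μ) {N : ℕ → ℕ} (hN : ∀ n, 0 < N n)
    {r : ℝ} (hr : Tendsto (fun n : ℕ => (n : ℝ) / (N n : ℝ)) atTop (𝓝 r))
    {S : Matrix (Fin d) (Fin d) ℝ} (hS : S.PosSemidef)
    (hSt : ∀ t : Vec d, t.ofLp ⬝ᵥ S *ᵥ t.ofLp =
      Var[fun z => inner ℝ (f z) t; μ] + r * Var[fun z => inner ℝ (g z) t; μ]) :
    TendstoInDistribution (fun (n : ℕ) ω => √(n : ℝ) •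
      ((avg (Finset.range n) (fun i => f (Z i ω)) - ∫ z, f z ∂μ) +
        (avg (unlabelled N n) (fun i => g (Z i ω)) - ∫ z, g z ∂μ))) atTop
      (id : Vec d → Vec d) (fun _ => P) (multivariateGaussian 0 S) := by
  have hμ : IsProbabilityMeasure μ := (hlaw 0) ▸ Measure.isProbabilityMeasure_map (hZ 0).aemeasurable
  have hm : ∀ n : ℕ, Measurable fun ω => √(n : ℝ) •
      ((avg (Finset.range n) (fun i => f (Z i ω)) - ∫ z, f z ∂μ) +
        (avg (unlabelled N n) (fun i => g (Z i ω)) - ∫ z, g z ∂μ)) := fun n => by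
    unfold avg
    fun_prop
  refine ⟨fun n => (hm n).aemeasurable, aemeasurable_id, ?_⟩
  -- By Lévy's continuity theorem it suffices to fix a direction `t`, which makes both samples real
  -- valued.
  refine ProbabilityMeasure.tendsto_iff_tendsto_charFun.2 fun t => ?_
  change Tendsto (fun n => charFun (P.map _) t) _ (𝓝 (charFun (Measure.map id _) t))
  rw [Measure.map_id, charFun_multivariateGaussian hS]
  have hft : Measurable fun z => inner ℝ (f z) t := by fun_prop
  have hgt : Measurable fun z => inner ℝ (g z) t := by fun_prop
  have hft2 : MemLp (fun z => inner ℝ (f z) t) 2 μ := hf2.inner_const t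
  have hgt2 : MemLp (fun z => inner ℝ (g z) t) 2 μ := hg2.inner_const t
  have h1 := tendsto_charFun_pow hZ hind hlaw hft hft2 tendsto_id (c := fun n => (√(n : ℝ))⁻¹)
    (ρ := 1) (tendsto_const_nhds.congr' (by
      filter_upwards [eventually_gt_atTop 0] with n hn
      have : √(n : ℝ) ≠ 0 := by positivity
      simp [this]))
  -- The factor `√n / N` on a sum of `N` terms is `√(n / N)` times the usual normalization, whence
  -- the limit `√r` and the weight `r` on the variance.
  have h2 := tendsto_charFun_pow hZ hind hlaw hgt hgt2 (tendsto_card_atTop hN hr)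
    (c := fun n => √(n : ℝ) * (N n : ℝ)⁻¹)
    (ρ := √r) ((Real.continuous_sqrt.tendsto r |>.comp hr).congr fun n => by
      have : (0 : ℝ) < N n := by exact_mod_cast hN n
      simp only [Function.comp]
      rw [Real.sqrt_div (by positivity), mul_assoc, div_eq_mul_inv]
      congr 1
      have h3 : √(N n : ℝ) ≠ 0 := by positivity
      field_simp
      rw [Real.sq_sqrt (by positivity)])
  have h3 := h1.mul h2
  rw [← Complex.exp_add, Real.sq_sqrt (ratio_limit_nonneg hr)] at h3
  have hexp : -(((1 : ℝ) ^ 2 * Var[fun z => inner ℝ (f z) t; μ] : ℝ) : ℂ) / 2 +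
      -((r * Var[fun z => inner ℝ (g z) t; μ] : ℝ) : ℂ) / 2 =
      (inner ℝ t (0 : Vec d) : ℝ) * Complex.I - ((t.ofLp ⬝ᵥ S *ᵥ t.ofLp : ℝ) : ℂ) / 2 := by
    rw [hSt]
    push_cast
    simp
    ring
  rw [hexp] at h3
  refine h3.congr' ?_
  filter_upwards [eventually_gt_atTop 0] with n hn
  have hc1 := charFun_map_const_mul_sum hZ hind hlaw
    (hft.sub_const (∫ z, inner ℝ (f z) t ∂μ)) (Finset.range n) (√(n : ℝ))⁻¹ 1
  have hc2 := charFun_map_const_mul_sum hZ hind hlaw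
    (hgt.sub_const (∫ z, inner ℝ (g z) t ∂μ)) (unlabelled N n) (√(n : ℝ) * (N n : ℝ)⁻¹) 1
  rw [mul_one, Finset.card_range] at hc1
  rw [mul_one, card_unlabelled] at hc2
  simp only [id]
  rw [← hc1, ← hc2]
  -- The two blocks of units are disjoint, so the characteristic functions multiply.
  have hindep := indepFun_sum_sum hZ hind (hft.sub_const (∫ z, inner ℝ (f z) t ∂μ))
    (hgt.sub_const (∫ z, inner ℝ (g z) t ∂μ)) (disjoint_range_unlabelled N n) (√(n : ℝ))⁻¹
    (√(n : ℝ) * (N n : ℝ)⁻¹)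
  have hmul := congrFun (IndepFun.charFun_map_fun_add_eq_mul (by fun_prop) (by fun_prop) hindep) 1
  rw [Pi.mul_apply] at hmul
  rw [← hmul, charFun_apply, charFun_apply, integral_map (by fun_prop) (by fun_prop),
    integral_map (hm n).aemeasurable (by fun_prop)]
  congr 1
  ext ω
  congr 2
  have hIf : ∫ z, inner ℝ (f z) t ∂μ = inner ℝ (∫ z, f z ∂μ) t := by
    simp_rw [real_inner_comm t]
    exact integral_inner (hf2.integrable (by simp)) t
  have hIg : ∫ z, inner ℝ (g z) t ∂μ = inner ℝ (∫ z, g z ∂μ) t := by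
    simp_rw [real_inner_comm t]
    exact integral_inner (hg2.integrable (by simp)) t
  have hN0 : (N n : ℝ) ≠ 0 := by exact_mod_cast (hN n).ne'
  have hs : √(n : ℝ) ≠ 0 := by positivity
  have hs2 : (n : ℝ) = √(n : ℝ) ^ 2 := (Real.sq_sqrt (by positivity)).symm
  rw [hIf, hIg, Finset.sum_sub_distrib, Finset.sum_sub_distrib]
  simp only [avg, inner_smul_left, inner_add_left, inner_sub_left, sum_inner, Finset.sum_const,
    Finset.card_range, card_unlabelled, nsmul_eq_mul, RCLike.inner_apply, conj_trivial,
    one_mul]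
  norm_cast
  field_simp
  rw [← hs2]

lemma charFun_map_toEuclideanCLM {d : ℕ} (ν : Measure (Vec d)) (M : Matrix (Fin d) (Fin d) ℝ)
    (t : Vec d) :
    charFun (ν.map (Matrix.toEuclideanCLM (𝕜 := ℝ) M)) t =
      charFun ν (WithLp.toLp 2 (Mᵀ *ᵥ t.ofLp)) := by
  rw [charFun_apply, charFun_apply, integral_map (by fun_prop) (by fun_prop)]
  congr 1
  ext x
  congr 3
  simp only [EuclideanSpace.inner_eq_star_dotProduct, star_trivial, Matrix.ofLp_toEuclideanCLM,
    Matrix.mulVec_transpose, Matrix.dotProduct_mulVec]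

lemma multivariateGaussian_map_toEuclideanCLM {d : ℕ} {S : Matrix (Fin d) (Fin d) ℝ}
    (hS : S.PosSemidef) (M : Matrix (Fin d) (Fin d) ℝ) :
    (multivariateGaussian 0 S).map (Matrix.toEuclideanCLM (𝕜 := ℝ) M) =
      multivariateGaussian 0 (M * S * Mᵀ) := by
  have hS' : (M * S * Mᵀ).PosSemidef := by
    simpa using hS.mul_mul_conjTranspose_same M
  have := isGaussian_map (μ := multivariateGaussian 0 S) (Matrix.toEuclideanCLM (𝕜 := ℝ) M)
  refine Measure.ext_of_charFun ?_
  ext t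
  rw [charFun_map_toEuclideanCLM, charFun_multivariateGaussian hS,
    charFun_multivariateGaussian hS']
  simp only [inner_zero_right]
  congr 3
  rw [← Matrix.mulVec_mulVec, ← Matrix.mulVec_mulVec, Matrix.dotProduct_mulVec t.ofLp M,
    ← Matrix.mulVec_transpose]

/-- Asymptotic linearity: if `√n (est n - t)` is equivalent in probability to `-M C n`, where
`C n` is asymptotically Gaussian, then `est` is asymptotically Gaussian. -/
lemma hasAsymptoticCovariance_of_linearization {d : ℕ} {est : ℕ → Ω → Vec d}
    (hest : ∀ n, AEMeasurable (est n) P) {t : Vec d} {S M : Matrix (Fin d) (Fin d) ℝ}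
    (hS : S.PosSemidef) {C : ℕ → Ω → Vec d}
    (hC : TendstoInDistribution C atTop (id : Vec d → Vec d) (fun _ => P)
      (multivariateGaussian 0 S))
    (hlin : Tendsto (fun q : ℕ × Ω => √(q.1 : ℝ) • (est q.1 q.2 - t) -
      Matrix.toEuclideanCLM (𝕜 := ℝ) M (C q.1 q.2)) (inProb P) (𝓝 0)) :
    HasAsymptoticCovariance P est t (M * S * Mᵀ) := by
  refine ⟨by simpa using hS.mul_mul_conjTranspose_same M, ?_⟩
  have h1 := hC.continuous_comp (g := Matrix.toEuclideanCLM (𝕜 := ℝ) M) (by fun_prop)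
  have h2 : TendstoInDistribution (fun n ω => Matrix.toEuclideanCLM (𝕜 := ℝ) M (C n ω)) atTop
      (id : Vec d → Vec d) (fun _ => P) (multivariateGaussian 0 (M * S * Mᵀ)) := by
    refine ⟨h1.forall_aemeasurable, aemeasurable_id, ?_⟩
    convert! h1.tendsto using 2
    refine congrArg 𝓝 (Subtype.ext ?_)
    change Measure.map id _ = Measure.map (Matrix.toEuclideanCLM (𝕜 := ℝ) M ∘ id) _
    rw [Measure.map_id, Function.comp_id, multivariateGaussian_map_toEuclideanCLM hS]
  refine tendstoInDistribution_of_tendstoInMeasure_sub _ _ h2 ?_ fun n => ?_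
  · exact tendstoInMeasure_iff_tendsto_inProb.2 hlin
  · exact ((hest n).sub_const t).const_smul √(n : ℝ)

end CentralLimit

/-! ### Quadratic objectives and their minimizers. -/

section Quadratic

variable {d : ℕ}

lemma tendsto_vec_iff {α : Type*} {l : Filter α} {X : α → Vec d} {c : Vec d} :
    Tendsto X l (𝓝 c) ↔ ∀ i, Tendsto (fun q => X q i) l (𝓝 (c i)) := by
  rw [← tendsto_pi_nhds (f := fun q i => X q i) (g := fun i => c i)]
  constructor
  · intro h
    exact (PiLp.continuous_ofLp 2 fun _ : Fin d => ℝ).continuousAt.tendsto.comp h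
  · intro h
    exact (PiLp.continuous_toLp 2 fun _ : Fin d => ℝ).continuousAt.tendsto.comp h

lemma tendsto_matrix_iff {α : Type*} {l : Filter α} {X : α → Matrix (Fin d) (Fin d) ℝ}
    {c : Matrix (Fin d) (Fin d) ℝ} :
    Tendsto X l (𝓝 c) ↔ ∀ i j, Tendsto (fun q => X q i j) l (𝓝 (c i j)) := by
  exact (tendsto_pi_nhds (f := fun q i => X q i) (g := fun i => c i)).trans
    (forall_congr' fun i => tendsto_pi_nhds)

lemma tendsto_matrix_inv {α : Type*} {l : Filter α} {X : α → Matrix (Fin d) (Fin d) ℝ}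
    {c : Matrix (Fin d) (Fin d) ℝ} (hc : c.det ≠ 0) (h : Tendsto X l (𝓝 c)) :
    Tendsto (fun q => (X q)⁻¹) l (𝓝 c⁻¹) := by
  refine (continuousAt_matrix_inv c ?_).tendsto.comp h
  exact NormedRing.inverse_continuousAt (Units.mk0 _ hc)

/-- Positive definiteness of a symmetric matrix is strict positivity of its form on a compact
sphere, hence stable under small perturbations. The sphere is that of the sup norm; any norm would
do. -/
lemma Matrix.PosDef.eventually_posDef {α : Type*} {l : Filter α}
    {A : α → Matrix (Fin d) (Fin d) ℝ} {H : Matrix (Fin d) (Fin d) ℝ} (hH : H.PosDef)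
    (hA : Tendsto A l (𝓝 H)) (hs : ∀ q, (A q).IsHermitian) : ∀ᶠ q in l, (A q).PosDef := by
  have hK : IsCompact (Metric.sphere (0 : Fin d → ℝ) 1) := isCompact_sphere _ _
  have h1 : ∀ᶠ M in 𝓝 H, ∀ x ∈ Metric.sphere (0 : Fin d → ℝ) 1, 0 < x ⬝ᵥ (M *ᵥ x) := by
    refine hK.eventually_forall_of_forall_eventually fun x hx => ?_
    have hc : Continuous fun p : Matrix (Fin d) (Fin d) ℝ × (Fin d → ℝ) =>
        p.2 ⬝ᵥ (p.1 *ᵥ p.2) := by fun_prop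
    refine hc.continuousAt.eventually (lt_mem_nhds ?_)
    have hx0 : x ≠ 0 := by
      rintro rfl
      simp at hx
    simpa using hH.dotProduct_mulVec_pos hx0
  filter_upwards [hA.eventually h1] with q hq
  refine Matrix.PosDef.of_dotProduct_mulVec_pos (hs q) fun x hx => ?_
  have hx' : 0 < ‖x‖ := norm_pos_iff.2 hx
  have h2 := hq (‖x‖⁻¹ • x) (by simp [norm_smul, hx'.ne'])
  simp only [Matrix.mulVec_smul, smul_dotProduct, dotProduct_smul, smul_eq_mul] at h2
  have h3 : 0 < ‖x‖⁻¹ := by positivity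
  simpa using pos_of_mul_pos_right (pos_of_mul_pos_right h2 h3.le) h3.le

/-- `q` is quadratic with gradient `b` at `θ` and Hessian matrix `A`. -/
def HasQuadExpansion (q : Vec d → ℝ) (θ b : Vec d) (A : Matrix (Fin d) (Fin d) ℝ) : Prop :=
  ∀ h : Vec d, q (θ + h) = q θ + inner ℝ b h + (1 / 2) * (h.ofLp ⬝ᵥ (A *ᵥ h.ofLp))

namespace HasQuadExpansion

variable {q q' : Vec d → ℝ} {θ b b' : Vec d} {A A' : Matrix (Fin d) (Fin d) ℝ}

lemma add (h : HasQuadExpansion q θ b A) (h' : HasQuadExpansion q' θ b' A') :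
    HasQuadExpansion (fun t => q t + q' t) θ (b + b') (A + A') := fun u => by
  simp only [h u, h' u, inner_add_left, Matrix.add_mulVec, dotProduct_add]
  ring

lemma const_mul (h : HasQuadExpansion q θ b A) (c : ℝ) :
    HasQuadExpansion (fun t => c * q t) θ (c • b) (c • A) := fun u => by
  simp only [h u, real_inner_smul_left, Matrix.smul_mulVec, dotProduct_smul, smul_eq_mul]
  ring

lemma sub (h : HasQuadExpansion q θ b A) (h' : HasQuadExpansion q' θ b' A') :
    HasQuadExpansion (fun t => q t - q' t) θ (b - b') (A - A') := fun u => by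
  simp only [h u, h' u, inner_sub_left, Matrix.sub_mulVec, dotProduct_sub]
  ring

lemma zero : HasQuadExpansion (fun _ => 0) θ 0 0 := fun u => by simp

lemma sum {ι : Type*} (s : Finset ι) {q : ι → Vec d → ℝ} {b : ι → Vec d}
    {A : ι → Matrix (Fin d) (Fin d) ℝ} (h : ∀ i ∈ s, HasQuadExpansion (q i) θ (b i) (A i)) :
    HasQuadExpansion (fun t => ∑ i ∈ s, q i t) θ (∑ i ∈ s, b i) (∑ i ∈ s, A i) := by
  classical
  induction s using Finset.induction with
  | empty => simpa using zero
  | insert i s hi ih =>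
    simp only [Finset.sum_insert hi]
    exact (h i (by simp)).add (ih fun j hj => h j (by simp [hj]))

lemma avg (I : Finset ℕ) {q : ℕ → Vec d → ℝ} {b : ℕ → Vec d}
    {A : ℕ → Matrix (Fin d) (Fin d) ℝ} (h : ∀ i, HasQuadExpansion (q i) θ (b i) (A i)) :
    HasQuadExpansion (fun t => avg I fun i => q i t) θ (PPI.avg I b) (PPI.avg I A) :=
  (sum I fun i _ => h i).const_mul _

lemma linear (v : Vec d) : HasQuadExpansion (fun t => inner ℝ v t) θ v 0 := fun u => by
  simp [inner_add_right]

/-- Completing the square: up to a constant, `q` is half the squared `A`-norm of the distance to `θ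
- A⁻¹ b`. So a minimizer exists, which activates the proviso in `IsArgmin`, and it is unique. -/
lemma mulVec_sub_eq_neg (hq : HasQuadExpansion q θ b A) (hA : A.PosDef) {t : Vec d}
    (ht : IsArgmin q t) : A *ᵥ (t - θ).ofLp = -b.ofLp := by
  have hdet : IsUnit A.det := hA.det_pos.ne'.isUnit
  have hsymm : Aᵀ = A := (Matrix.isHermitian_iff_isSymm.1 hA.1).eq
  set u : Vec d := WithLp.toLp 2 (-(A⁻¹ *ᵥ b.ofLp)) with hu
  have hAu : A *ᵥ u.ofLp = -b.ofLp := by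
    simp [hu, Matrix.mulVec_neg, Matrix.mulVec_mulVec, Matrix.mul_nonsing_inv _ hdet]
  have key : ∀ h : Vec d, q (θ + h) = q (θ + u) +
      (1 / 2) * ((h - u).ofLp ⬝ᵥ (A *ᵥ (h - u).ofLp)) := by
    intro h
    have e1 : inner ℝ b h = -(h.ofLp ⬝ᵥ A *ᵥ u.ofLp) := by
      rw [hAu, EuclideanSpace.inner_eq_star_dotProduct]; simp
    have e2 : inner ℝ b u = -(u.ofLp ⬝ᵥ A *ᵥ u.ofLp) := by
      rw [hAu, EuclideanSpace.inner_eq_star_dotProduct]; simp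
    have e3 : u.ofLp ⬝ᵥ A *ᵥ h.ofLp = h.ofLp ⬝ᵥ A *ᵥ u.ofLp := by
      rw [Matrix.dotProduct_mulVec, ← Matrix.mulVec_transpose, hsymm, dotProduct_comm]
    rw [hq h, hq u, e1, e2]
    simp only [WithLp.ofLp_sub, Matrix.mulVec_sub, dotProduct_sub, sub_dotProduct, e3]
    ring
  have hmin := ht ⟨θ + u, fun v => by
    rw [show v = θ + (v - θ) by abel, key (v - θ)]
    have := hA.posSemidef.dotProduct_mulVec_nonneg (v - θ - u).ofLp
    simp only [star_trivial] at this
    linarith⟩ (θ + u)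
  have h4 := key (t - θ)
  rw [add_sub_cancel] at h4
  have h5 : (t - θ - u).ofLp = 0 := by
    by_contra hne
    have := hA.dotProduct_mulVec_pos hne
    simp only [star_trivial] at this
    linarith
  have h6 : (t - θ).ofLp = u.ofLp := by
    rw [WithLp.ofLp_sub, sub_eq_zero] at h5
    exact h5
  rw [h6, hAu]

end HasQuadExpansion

lemma PPI.IsArgmin.congr {f g : Vec d → ℝ} {t : Vec d} (h : IsArgmin f t) (hfg : ∀ u, f u = g u) :
    IsArgmin g t := by
  rwa [← funext hfg]

/-- Twice the rank-one matrix `x xᵀ`, the Hessian of the squared loss. -/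
def gram (x : Vec d) : Matrix (Fin d) (Fin d) ℝ := Matrix.of fun i j => 2 * (x i * x j)

lemma gram_isHermitian (x : Vec d) : (gram x).IsHermitian := by
  ext i j; simp [gram, mul_comm]

lemma hasGradientAt_sqLoss (t x : Vec d) (y : ℝ) :
    HasGradientAt (fun u => sqLoss u x y) ((-2 * (y - inner ℝ x t)) • x) t := by
  rw [hasGradientAt_iff_hasFDerivAt]
  have h1 : HasFDerivAt (fun u : Vec d => y - inner ℝ x u) (-(innerSL ℝ x)) t := by
    simpa using ((innerSL ℝ x).hasFDerivAt (x := t)).const_sub y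
  have h2 := h1.pow 2
  refine h2.congr_fderiv ?_
  ext u
  simp

lemma gradLoss_eq (t x : Vec d) (y : ℝ) : gradLoss t x y = (-2 * (y - inner ℝ x t)) • x :=
  (hasGradientAt_sqLoss t x y).gradient

lemma hessLoss_eq (t x : Vec d) (y : ℝ) : hessLoss t x y = gram x := by
  have h1 : HasFDerivAt (fun u => gradLoss u x y)
      (((2 : ℝ) • innerSL ℝ x).smulRight x) t := by
    have h2 : HasFDerivAt (fun u : Vec d => (-2 * (y - inner ℝ x u))) ((2 : ℝ) • innerSL ℝ x) t := by
      have := ((((innerSL ℝ x).hasFDerivAt (x := t)).const_sub y).const_mul (-2))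
      refine this.congr_fderiv ?_
      ext u
      simp
    simpa [gradLoss_eq] using! h2.smul_const x
  ext i j
  simp [hessLoss, h1.fderiv, gram, EuclideanSpace.inner_single_right]
  ring

lemma hasQuadExpansion_sqLoss (θ x : Vec d) (y : ℝ) :
    HasQuadExpansion (fun t => sqLoss t x y) θ (gradLoss θ x y) (gram x) := fun h => by
  have : h.ofLp ⬝ᵥ (gram x *ᵥ h.ofLp) = 2 * inner ℝ x h ^ 2 := by
    have hx : inner ℝ x h = ∑ i, x i * h i := by
      simp [PiLp.inner_apply, mul_comm]
    rw [hx, sq, Finset.sum_mul_sum, Finset.mul_sum]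
    refine Finset.sum_congr rfl fun i _ => ?_
    rw [Matrix.mulVec, dotProduct, Finset.mul_sum, Finset.mul_sum]
    exact Finset.sum_congr rfl fun j _ => by simp only [gram, Matrix.of_apply]; ring
  simp only [sqLoss, gradLoss_eq, inner_smul_left, inner_add_right, this]
  simp
  ring

end Quadratic

/-! ### Perturbation of linear systems. -/

section Linearization

variable {Ω : Type*} [MeasurableSpace Ω] {P : Measure Ω} {d : ℕ}

/-- Solutions of linear systems with convergent matrices and right-hand sides bounded in
probability are asymptotically linear. -/
lemma tendsto_solution_sub {A : ℕ × Ω → Matrix (Fin d) (Fin d) ℝ}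
    {H : Matrix (Fin d) (Fin d) ℝ} (hH : H.det ≠ 0) (hA : Tendsto A (inProb P) (𝓝 H))
    {T B C : ℕ × Ω → Vec d} (hT : ∀ᶠ q in inProb P, A q *ᵥ (T q).ofLp = (B q).ofLp)
    (hBC : Tendsto (fun q => B q - C q) (inProb P) (𝓝 0))
    (hC : ∀ i, BddInProb P fun q => C q i) :
    Tendsto (fun q => T q - Matrix.toEuclideanCLM (𝕜 := ℝ) H⁻¹ (C q)) (inProb P) (𝓝 0) := by
  have hinv := tendsto_matrix_inv hH hA
  have hdet : ∀ᶠ q in inProb P, (A q).det ≠ 0 :=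
    (continuous_id.matrix_det.continuousAt.tendsto.comp hA).eventually_ne hH
  have h0 : Tendsto (fun q => (A q)⁻¹ - H⁻¹) (inProb P) (𝓝 0) := by
    simpa using hinv.sub_const H⁻¹
  rw [tendsto_vec_iff]
  intro i
  -- With `T = A⁻¹ B`, the difference `T - H⁻¹ C` splits as `A⁻¹ (B - C) + (A⁻¹ - H⁻¹) C`. The first
  -- term is convergent times null, the second null times bounded in probability.
  have h1 : Tendsto (fun q => ∑ j, (A q)⁻¹ i j * (B q - C q) j +
      ∑ j, ((A q)⁻¹ - H⁻¹) i j * C q j) (inProb P) (𝓝 0) := by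
    rw [← add_zero (0 : ℝ)]
    refine Tendsto.add ?_ ?_
    · rw [show (0 : ℝ) = ∑ j : Fin d, H⁻¹ i j * (0 : Vec d) j by simp]
      exact tendsto_finsetSum _ fun j _ =>
        (tendsto_matrix_iff.1 hinv i j).mul (tendsto_vec_iff.1 hBC j)
    · rw [show (0 : ℝ) = ∑ j : Fin d, 0 by simp]
      exact tendsto_finsetSum _ fun j _ => (hC j).tendsto_mul (tendsto_matrix_iff.1 h0 i j)
  refine h1.congr' ?_
  filter_upwards [hT, hdet] with q hq hd
  have h2 : (T q).ofLp = (A q)⁻¹ *ᵥ (B q).ofLp := by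
    rw [← hq, Matrix.mulVec_mulVec, Matrix.nonsing_inv_mul _ hd.isUnit, Matrix.one_mulVec]
  simp only [PiLp.sub_apply, h2, Matrix.ofLp_toEuclideanCLM, Matrix.mulVec, dotProduct,
    ← Finset.sum_add_distrib, ← Finset.sum_sub_distrib, Matrix.sub_apply]
  exact Finset.sum_congr rfl fun j _ => by ring

end Linearization

/-! ### Fourth-order Gaussian moments. -/

section GaussianMoments

/-- The fourth moment of a centred Gaussian. -/
lemma integral_pow_four_gaussianReal (v : ℝ≥0) :
    ∫ x, x ^ 4 ∂gaussianReal 0 v = 3 * (v : ℝ) ^ 2 := by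
  have h1 := iteratedDeriv_mgf_zero (X := id) (μ := gaussianReal 0 v)
    (by rw [integrableExpSet_id_gaussianReal]; simp) 4
  rw [mgf_id_gaussianReal] at h1
  have hE : ∀ t : ℝ, HasDerivAt (fun t : ℝ => Real.exp (0 * t + v * t ^ 2 / 2))
      (v * t * Real.exp (0 * t + v * t ^ 2 / 2)) t := by
    intro t
    have h2 : HasDerivAt (fun t : ℝ => 0 * t + v * t ^ 2 / 2) (v * t) t := by
      have := ((((hasDerivAt_id t).pow 2).const_mul (v : ℝ)).div_const 2)
      simp only [zero_mul, zero_add]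
      refine this.congr_deriv ?_
      simp
      ring
    exact h2.exp.congr_deriv (by ring)
  have d1 : deriv (fun t : ℝ => Real.exp (0 * t + v * t ^ 2 / 2)) =
      fun t => v * t * Real.exp (0 * t + v * t ^ 2 / 2) := funext fun t => (hE t).deriv
  -- Derivatives of the moment generating function stay of the form polynomial times `exp (v t² /
  -- 2)`, and only the polynomial has to be tracked up to order four.
  have hp : ∀ {p : ℝ → ℝ} {p' : ℝ} {t : ℝ}, HasDerivAt p p' t →
      HasDerivAt (fun t : ℝ => p t * Real.exp (0 * t + v * t ^ 2 / 2))
        ((p' + p t * (v * t)) * Real.exp (0 * t + v * t ^ 2 / 2)) t := fun {p p' t} h =>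
    (h.mul (hE t)).congr_deriv (by ring)
  have d2 : deriv (fun t : ℝ => v * t * Real.exp (0 * t + v * t ^ 2 / 2)) =
      fun t => (v + v ^ 2 * t ^ 2) * Real.exp (0 * t + v * t ^ 2 / 2) := funext fun t => by
    have h3 : HasDerivAt (fun t : ℝ => (v : ℝ) * t) v t := by
      simpa using (hasDerivAt_id t).const_mul (v : ℝ)
    rw [(hp h3).deriv]
    ring
  have d3 : deriv (fun t : ℝ => (v + v ^ 2 * t ^ 2) * Real.exp (0 * t + v * t ^ 2 / 2)) =
      fun t => (3 * v ^ 2 * t + v ^ 3 * t ^ 3) * Real.exp (0 * t + v * t ^ 2 / 2) :=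
    funext fun t => by
      have h3 : HasDerivAt (fun t : ℝ => (v : ℝ) + v ^ 2 * t ^ 2) (v ^ 2 * (2 * t)) t := by
        simpa using ((hasDerivAt_pow 2 t).const_mul ((v : ℝ) ^ 2)).const_add (v : ℝ)
      rw [(hp h3).deriv]
      ring
  have d4 : deriv (fun t : ℝ => (3 * v ^ 2 * t + v ^ 3 * t ^ 3) *
      Real.exp (0 * t + v * t ^ 2 / 2)) 0 = 3 * (v : ℝ) ^ 2 := by
    have h3 : HasDerivAt (fun t : ℝ => 3 * (v : ℝ) ^ 2 * t + (v : ℝ) ^ 3 * t ^ 3)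
        (3 * (v : ℝ) ^ 2) 0 := by
      simpa using! ((hasDerivAt_id (0 : ℝ)).const_mul (3 * (v : ℝ) ^ 2)).add
        ((hasDerivAt_pow 3 (0 : ℝ)).const_mul ((v : ℝ) ^ 3))
    rw [(hp h3).deriv]
    simp
  simp only [iteratedDeriv_succ, iteratedDeriv_zero, d1, d2, d3, d4] at h1
  simpa using h1.symm

/-- All the moments of `f` are finite. -/
def HasAllMoments {𝓩 : Type*} [MeasurableSpace 𝓩] (μ : Measure 𝓩) (f : 𝓩 → ℝ) : Prop :=
  ∀ p : ℝ≥0∞, p ≠ ∞ → MemLp f p μ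

namespace HasAllMoments

variable {𝓩 : Type*} [MeasurableSpace 𝓩] {μ : Measure 𝓩} {f g : 𝓩 → ℝ}

/-- Hölder with exponents `2p, 2p, p`. Closure under products is the reason to carry all moments
rather than a fixed exponent. -/
lemma mul (hf : HasAllMoments μ f) (hg : HasAllMoments μ g) :
    HasAllMoments μ fun z => f z * g z := fun p hp => by
  have h2 : (2 : ℝ≥0∞) * p ≠ ∞ := ENNReal.mul_ne_top (by simp) hp
  have : ENNReal.HolderTriple (2 * p) (2 * p) p := ⟨by
    rw [ENNReal.mul_inv (Or.inl (by simp)) (Or.inl (by simp)), ← two_mul, ← mul_assoc,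
      ENNReal.mul_inv_cancel (by simp) (by simp), one_mul]⟩
  exact (hg _ h2).mul' (hf _ h2)

lemma const_mul (hf : HasAllMoments μ f) (c : ℝ) :
    HasAllMoments μ fun z => c * f z := fun p hp => (hf p hp).const_mul c

lemma integrable (hf : HasAllMoments μ f) : Integrable f μ :=
  memLp_one_iff_integrable.1 (hf 1 (by simp))

lemma congr (hf : HasAllMoments μ f) (h : f =ᵐ[μ] g) : HasAllMoments μ g := fun p hp =>
  (memLp_congr_ae h).1 (hf p hp)

end HasAllMoments

/-- Both expansions in the proof of Isserlis' formula below have exactly six terms. -/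
lemma integral_add_six {𝓩 : Type*} [MeasurableSpace 𝓩] {μ : Measure 𝓩}
    {f₁ f₂ f₃ f₄ f₅ f₆ : 𝓩 → ℝ} (h₁ : Integrable f₁ μ) (h₂ : Integrable f₂ μ)
    (h₃ : Integrable f₃ μ) (h₄ : Integrable f₄ μ) (h₅ : Integrable f₅ μ) (h₆ : Integrable f₆ μ) :
    ∫ z, (f₁ z + f₂ z + f₃ z + f₄ z + f₅ z + f₆ z) ∂μ = ∫ z, f₁ z ∂μ + ∫ z, f₂ z ∂μ +
      ∫ z, f₃ z ∂μ + ∫ z, f₄ z ∂μ + ∫ z, f₅ z ∂μ + ∫ z, f₆ z ∂μ := by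
  have h₁₂ : Integrable (fun z => f₁ z + f₂ z) μ := h₁.add h₂
  have h₁₃ : Integrable (fun z => f₁ z + f₂ z + f₃ z) μ := h₁₂.add h₃
  have h₁₄ : Integrable (fun z => f₁ z + f₂ z + f₃ z + f₄ z) μ := h₁₃.add h₄
  have h₁₅ : Integrable (fun z => f₁ z + f₂ z + f₃ z + f₄ z + f₅ z) μ := h₁₄.add h₅
  rw [integral_add h₁₅ h₆, integral_add h₁₄ h₅, integral_add h₁₃ h₄, integral_add h₁₂ h₃,
    integral_add h₁ h₂]

variable {E : Type*} [NormedAddCommGroup E] [NormedSpace ℝ E] [MeasurableSpace E] [BorelSpace E]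
  {μ : Measure E} [IsGaussian μ]

lemma hasAllMoments_dual (L : StrongDual ℝ E) : HasAllMoments μ L := fun p hp =>
  IsGaussian.memLp_dual μ L p hp

lemma integral_dual_pow_four (L : StrongDual ℝ E) (h0 : ∫ z, L z ∂μ = 0) :
    ∫ z, L z ^ 4 ∂μ = 3 * (∫ z, L z ^ 2 ∂μ) ^ 2 := by
  have h1 : Var[L; μ] = ∫ z, L z ^ 2 ∂μ := by
    rw [variance_eq_sub (IsGaussian.memLp_dual μ L 2 (by simp)), h0]
    simp
  have h2 := IsGaussian.map_eq_gaussianReal (μ := μ) L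
  rw [h0] at h2
  have h3 : ∫ z, L z ^ 4 ∂μ = ∫ x, x ^ 4 ∂(μ.map L) := by
    rw [integral_map (by fun_prop) (by fun_prop)]
  rw [h3, h2, integral_pow_four_gaussianReal, Real.coe_toNNReal _ (variance_nonneg _ _), h1]

/-- Isserlis' formula for `E[L₁ L₂ L₃²]`. -/
lemma integral_dual_mul_mul_sq (h0 : ∀ L : StrongDual ℝ E, ∫ z, L z ∂μ = 0)
    (L₁ L₂ L₃ : StrongDual ℝ E) :
    ∫ z, L₁ z * L₂ z * L₃ z ^ 2 ∂μ = (∫ z, L₁ z * L₂ z ∂μ) * (∫ z, L₃ z ^ 2 ∂μ) +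
      2 * (∫ z, L₁ z * L₃ z ∂μ) * (∫ z, L₂ z * L₃ z ∂μ) := by
  have hm : ∀ L M : StrongDual ℝ E, Integrable (fun z => L z * M z) μ := fun L M =>
    ((hasAllMoments_dual L).mul (hasAllMoments_dual M)).integrable
  have hsq : ∀ a b c : ℝ, ∫ z, ((a • L₁ + b • L₂ + c • L₃ : StrongDual ℝ E) z) ^ 2 ∂μ =
      a ^ 2 * (∫ z, L₁ z * L₁ z ∂μ) + b ^ 2 * (∫ z, L₂ z * L₂ z ∂μ) +
      c ^ 2 * (∫ z, L₃ z * L₃ z ∂μ) + 2 * a * b * (∫ z, L₁ z * L₂ z ∂μ) +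
      2 * a * c * (∫ z, L₁ z * L₃ z ∂μ) + 2 * b * c * (∫ z, L₂ z * L₃ z ∂μ) := by
    intro a b c
    have e : ∀ z, ((a • L₁ + b • L₂ + c • L₃ : StrongDual ℝ E) z) ^ 2 =
        a ^ 2 * (L₁ z * L₁ z) + b ^ 2 * (L₂ z * L₂ z) + c ^ 2 * (L₃ z * L₃ z) +
        2 * a * b * (L₁ z * L₂ z) + 2 * a * c * (L₁ z * L₃ z) + 2 * b * c * (L₂ z * L₃ z) := by
      intro z; simp; ring
    simp_rw [e]
    have i1 := (hm L₁ L₁).const_mul (a ^ 2)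
    have i2 := (hm L₂ L₂).const_mul (b ^ 2)
    have i3 := (hm L₃ L₃).const_mul (c ^ 2)
    have i4 := (hm L₁ L₂).const_mul (2 * a * b)
    have i5 := (hm L₁ L₃).const_mul (2 * a * c)
    have i6 := (hm L₂ L₃).const_mul (2 * b * c)
    rw [integral_add_six i1 i2 i3 i4 i5 i6]
    simp only [integral_const_mul]
  have h4 : ∀ L : StrongDual ℝ E, Integrable (fun z => L z ^ 4) μ := fun L => by
    have h := hasAllMoments_dual (μ := μ) L
    refine (((h.mul h).mul h).mul h).integrable.congr (ae_of_all _ fun z => ?_)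
    ring
  -- Polarization into fourth powers. With `a = L₁ + L₂` and `b = L₁ - L₂`, the product `L₁ L₂` is
  -- `(a² - b²) / 4`, and `12 a² L₃² = (a + L₃)⁴ + (a - L₃)⁴ - 2 a⁴ - 2 L₃⁴`. The powers of `L₃`
  -- alone cancel between `a` and `b`, and `4 * 12 = 48`.
  have key : ∀ z, L₁ z * L₂ z * L₃ z ^ 2 = (1 / 48 : ℝ) * (
      ((1 : ℝ) • L₁ + (1 : ℝ) • L₂ + (1 : ℝ) • L₃ : StrongDual ℝ E) z ^ 4 +
      ((1 : ℝ) • L₁ + (1 : ℝ) • L₂ + (-1 : ℝ) • L₃ : StrongDual ℝ E) z ^ 4 +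
      (-2) * ((1 : ℝ) • L₁ + (1 : ℝ) • L₂ + (0 : ℝ) • L₃ : StrongDual ℝ E) z ^ 4 +
      (-1) * ((1 : ℝ) • L₁ + (-1 : ℝ) • L₂ + (1 : ℝ) • L₃ : StrongDual ℝ E) z ^ 4 +
      (-1) * ((1 : ℝ) • L₁ + (-1 : ℝ) • L₂ + (-1 : ℝ) • L₃ : StrongDual ℝ E) z ^ 4 +
      2 * ((1 : ℝ) • L₁ + (-1 : ℝ) • L₂ + (0 : ℝ) • L₃ : StrongDual ℝ E) z ^ 4) := by
    intro z; simp; ring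
  simp_rw [key]
  set M1 : StrongDual ℝ E := (1 : ℝ) • L₁ + (1 : ℝ) • L₂ + (1 : ℝ) • L₃ with hM1
  set M2 : StrongDual ℝ E := (1 : ℝ) • L₁ + (1 : ℝ) • L₂ + (-1 : ℝ) • L₃ with hM2
  set M3 : StrongDual ℝ E := (1 : ℝ) • L₁ + (1 : ℝ) • L₂ + (0 : ℝ) • L₃ with hM3
  set M4 : StrongDual ℝ E := (1 : ℝ) • L₁ + (-1 : ℝ) • L₂ + (1 : ℝ) • L₃ with hM4
  set M5 : StrongDual ℝ E := (1 : ℝ) • L₁ + (-1 : ℝ) • L₂ + (-1 : ℝ) • L₃ with hM5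
  set M6 : StrongDual ℝ E := (1 : ℝ) • L₁ + (-1 : ℝ) • L₂ + (0 : ℝ) • L₃ with hM6
  have i3 := (h4 M3).const_mul (-2)
  have i4 := (h4 M4).const_mul (-1)
  have i5 := (h4 M5).const_mul (-1)
  have i6 := (h4 M6).const_mul 2
  rw [integral_const_mul, integral_add_six (h4 M1) (h4 M2) i3 i4 i5 i6]
  simp only [integral_const_mul, integral_dual_pow_four _ (h0 _)]
  rw [hM1, hM2, hM3, hM4, hM5, hM6]
  simp only [hsq, pow_two (L₃ _)]
  ring

end GaussianMoments

/-! ### The Gaussian unit: linear forms, scores and their covariances. -/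

section GaussianModel

variable {d m : ℕ}

/-- The linear form `xᵀδ + wᵀg + c e` of a unit. -/
noncomputable def linForm (δ : Vec d) (g : Vec m) (c : ℝ) : StrongDual ℝ (Obs d m) :=
  (innerSL ℝ δ).coprod ((innerSL ℝ g).coprod (c • ContinuousLinearMap.id ℝ ℝ))

lemma linForm_apply (δ : Vec d) (g : Vec m) (c : ℝ) (z : Obs d m) :
    linForm δ g c z = inner ℝ z.1 δ + inner ℝ z.2.1 g + c * z.2.2 := by
  simp [linForm, real_inner_comm, add_assoc]

/-- The quadratic form of the second moments of the linear forms of a unit. -/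
noncomputable def modelForm (SX : Matrix (Fin d) (Fin d) ℝ) (SW : Matrix (Fin m) (Fin m) ℝ) (σ : ℝ≥0)
    (δ : Vec d) (g : Vec m) (c : ℝ) : ℝ :=
  bform SX δ δ + bform SW g g + c ^ 2 * (σ : ℝ) ^ 2

variable {SX : Matrix (Fin d) (Fin d) ℝ} {SW : Matrix (Fin m) (Fin m) ℝ} {σ : ℝ≥0}

instance isGaussian_gaussianLaw : IsGaussian (gaussianLaw SX SW σ) := by
  unfold gaussianLaw; infer_instance

lemma integral_dual_gaussianLaw (L : StrongDual ℝ (Obs d m)) :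
    ∫ z, L z ∂gaussianLaw SX SW σ = 0 := by
  rw [ContinuousLinearMap.integral_comp_id_comm IsGaussian.integrable_id]
  have h1 : ∫ z, z ∂gaussianLaw SX SW σ = 0 := by
    have hi := IsGaussian.integrable_fun_id (μ := gaussianLaw SX SW σ)
    refine Prod.ext ?_ (Prod.ext ?_ ?_)
    · rw [fst_integral hi, gaussianLaw]
      have := integral_fun_fst (μ := multivariateGaussian 0 SX)
        (ν := (multivariateGaussian 0 SW).prod (gaussianReal 0 (σ ^ 2))) (fun x : Vec d => x)
      simpa using this
    · rw [snd_integral hi, fst_integral hi.snd, gaussianLaw]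
      have := integral_fun_snd (μ := multivariateGaussian 0 SX)
        (ν := (multivariateGaussian 0 SW).prod (gaussianReal 0 (σ ^ 2)))
        (fun x : Vec m × ℝ => x.1)
      rw [this]
      have := integral_fun_fst (μ := multivariateGaussian 0 SW)
        (ν := gaussianReal 0 (σ ^ 2)) (fun x : Vec m => x)
      simp [this]
    · rw [snd_integral hi, snd_integral hi.snd, gaussianLaw]
      have := integral_fun_snd (μ := multivariateGaussian 0 SX)
        (ν := (multivariateGaussian 0 SW).prod (gaussianReal 0 (σ ^ 2)))
        (fun x : Vec m × ℝ => x.2)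
      rw [this]
      have := integral_fun_snd (μ := multivariateGaussian 0 SW)
        (ν := gaussianReal 0 (σ ^ 2)) (fun x : ℝ => x)
      simp [this]
  rw [h1, map_zero]

lemma variance_inner_multivariateGaussian {k : ℕ} {S : Matrix (Fin k) (Fin k) ℝ}
    (hS : S.PosSemidef) (v : Vec k) :
    Var[fun x => inner ℝ x v; multivariateGaussian 0 S] = bform S v v := by
  have h := covarianceBilin_self (μ := multivariateGaussian 0 S) IsGaussian.memLp_two_id v
  rw [covarianceBilin_multivariateGaussian hS] at h
  simp_rw [real_inner_comm v]
  exact h.symm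

lemma integral_linForm_sq (hSX : SX.PosSemidef) (hSW : SW.PosSemidef) (δ : Vec d) (g : Vec m)
    (c : ℝ) :
    ∫ z, linForm δ g c z ^ 2 ∂gaussianLaw SX SW σ = modelForm SX SW σ δ g c := by
  have h1 : Var[linForm δ g c; gaussianLaw SX SW σ] =
      ∫ z, linForm δ g c z ^ 2 ∂gaussianLaw SX SW σ := by
    rw [variance_eq_sub (IsGaussian.memLp_dual _ _ 2 (by simp)), integral_dual_gaussianLaw]
    simp
  rw [← h1]
  have hx : MemLp (fun x : Vec d => inner ℝ x δ) 2 (multivariateGaussian 0 SX) := by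
    simp_rw [real_inner_comm δ]
    exact IsGaussian.memLp_dual _ (innerSL ℝ δ) 2 (by simp)
  have hw : MemLp (fun x : Vec m => inner ℝ x g) 2 (multivariateGaussian 0 SW) := by
    simp_rw [real_inner_comm g]
    exact IsGaussian.memLp_dual _ (innerSL ℝ g) 2 (by simp)
  have he : MemLp (fun x : ℝ => c * x) 2 (gaussianReal 0 (σ ^ 2)) :=
    (memLp_id_gaussianReal 2).const_mul c
  have hfun : (linForm δ g c : Obs d m → ℝ) = fun z =>
      (fun x : Vec d => inner ℝ x δ) z.1 +
        (fun p : Vec m × ℝ => (fun x : Vec m => inner ℝ x g) p.1 + (fun x => c * x) p.2) z.2 := by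
    ext z
    rw [linForm_apply, add_assoc]
  have hwe : MemLp (fun p : Vec m × ℝ => (fun x : Vec m => inner ℝ x g) p.1 + (fun x => c * x) p.2)
      2 ((multivariateGaussian 0 SW).prod (gaussianReal 0 (σ ^ 2))) :=
    (hw.comp_fst _).add (he.comp_snd _)
  rw [hfun, gaussianLaw, variance_add_prod hx hwe, variance_add_prod hw he,
    variance_inner_multivariateGaussian hSX, variance_inner_multivariateGaussian hSW,
    variance_const_mul, variance_fun_id_gaussianReal, modelForm]
  simp
  ring

lemma bform_comm {k : ℕ} {S : Matrix (Fin k) (Fin k) ℝ} (hS : S.IsHermitian) (u v : Vec k) :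
    bform S u v = bform S v u := by
  rw [bform, bform, Matrix.dotProduct_mulVec, ← Matrix.mulVec_transpose,
    (Matrix.isHermitian_iff_isSymm.1 hS).eq, dotProduct_comm]

lemma bform_add_left {k : ℕ} (S : Matrix (Fin k) (Fin k) ℝ) (u v w : Vec k) :
    bform S (u + v) w = bform S u w + bform S v w := by
  simp [bform, add_dotProduct]

lemma bform_add_right {k : ℕ} (S : Matrix (Fin k) (Fin k) ℝ) (u v w : Vec k) :
    bform S u (v + w) = bform S u v + bform S u w := by
  simp [bform, Matrix.mulVec_add, dotProduct_add]

lemma bform_smul_left {k : ℕ} (S : Matrix (Fin k) (Fin k) ℝ) (c : ℝ) (u v : Vec k) :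
    bform S (c • u) v = c * bform S u v := by
  simp [bform, smul_dotProduct]

lemma bform_smul_right {k : ℕ} (S : Matrix (Fin k) (Fin k) ℝ) (c : ℝ) (u v : Vec k) :
    bform S u (c • v) = c * bform S u v := by
  simp [bform, Matrix.mulVec_smul, dotProduct_smul]

lemma bform_zero_left {k : ℕ} (S : Matrix (Fin k) (Fin k) ℝ) (v : Vec k) :
    bform S 0 v = 0 := by simp [bform]

lemma bform_zero_right {k : ℕ} (S : Matrix (Fin k) (Fin k) ℝ) (v : Vec k) :
    bform S v 0 = 0 := by simp [bform]

lemma bform_sub_left {k : ℕ} (S : Matrix (Fin k) (Fin k) ℝ) (u v w : Vec k) :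
    bform S (u - v) w = bform S u w - bform S v w := by
  simp [bform, sub_dotProduct]

lemma bform_sub_right {k : ℕ} (S : Matrix (Fin k) (Fin k) ℝ) (u v w : Vec k) :
    bform S u (v - w) = bform S u v - bform S u w := by
  simp [bform, Matrix.mulVec_sub, dotProduct_sub]

/-- Polarization of `integral_linForm_sq`. -/
lemma integral_linForm_mul (hSX : SX.PosSemidef) (hSW : SW.PosSemidef) (δ δ' : Vec d)
    (g g' : Vec m) (c c' : ℝ) :
    ∫ z, linForm δ g c z * linForm δ' g' c' z ∂gaussianLaw SX SW σ =
      bform SX δ δ' + bform SW g g' + c * c' * (σ : ℝ) ^ 2 := by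
  have e : ∀ z : Obs d m, linForm δ g c z * linForm δ' g' c' z =
      (1 / 4 : ℝ) * (linForm (δ + δ') (g + g') (c + c') z ^ 2 -
        linForm (δ - δ') (g - g') (c - c') z ^ 2) := by
    intro z
    simp only [linForm_apply, inner_add_right, inner_sub_right]
    ring
  have hi : ∀ (δ : Vec d) (g : Vec m) (c : ℝ),
      Integrable (fun z => linForm δ g c z ^ 2) (gaussianLaw SX SW σ) := fun δ g c =>
    (IsGaussian.memLp_dual _ (linForm δ g c) 2 (by simp)).integrable_sq
  simp_rw [e]
  rw [integral_const_mul, integral_sub (hi _ _ _) (hi _ _ _), integral_linForm_sq hSX hSW,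
    integral_linForm_sq hSX hSW, modelForm, modelForm]
  simp only [bform_add_left, bform_add_right, bform_sub_left, bform_sub_right,
    bform_comm hSX.1 δ' δ, bform_comm hSW.1 g' g]
  ring

/-- Seeing the coordinates of `x` as linear forms makes every score moment an instance of Isserlis'
formula. -/
lemma coord_eq_linForm (i : Fin d) (z : Obs d m) :
    z.1 i = linForm (EuclideanSpace.single i 1) (0 : Vec m) 0 z := by
  simp [linForm_apply, EuclideanSpace.inner_single_right]

lemma bform_single_left {k : ℕ} (S : Matrix (Fin k) (Fin k) ℝ) (i : Fin k) (v : Vec k) :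
    bform S (EuclideanSpace.single i 1) v = (S *ᵥ v.ofLp) i := by
  simp [bform]

lemma bform_single_single {k : ℕ} (S : Matrix (Fin k) (Fin k) ℝ) (i j : Fin k) :
    bform S (EuclideanSpace.single i 1) (EuclideanSpace.single j 1) = S i j := by
  simp [bform_single_left]

/-- The score functions of the Gaussian model: a linear form of the unit times `-2 x`. -/
noncomputable def linScore (δ : Vec d) (g : Vec m) (c : ℝ) (z : Obs d m) : Vec d :=
  (-2 * linForm δ g c z) • z.1

lemma measurable_linScore (δ : Vec d) (g : Vec m) (c : ℝ) :
    Measurable (linScore δ g c) := by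
  unfold linScore; fun_prop

lemma linScore_apply (δ : Vec d) (g : Vec m) (c : ℝ) (z : Obs d m) (i : Fin d) :
    linScore δ g c z i = -2 * (linForm δ g c z * z.1 i) := by
  simp [linScore, mul_assoc]

lemma hasAllMoments_coord (i : Fin d) :
    HasAllMoments (gaussianLaw SX SW σ) fun z => z.1 i := by
  simp_rw [coord_eq_linForm]
  exact hasAllMoments_dual _

lemma hasAllMoments_linScore (δ : Vec d) (g : Vec m) (c : ℝ) (i : Fin d) :
    HasAllMoments (gaussianLaw SX SW σ) fun z => linScore δ g c z i := by
  simp_rw [linScore_apply]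
  exact ((hasAllMoments_dual _).mul (hasAllMoments_coord i)).const_mul _

lemma memLp_linScore (δ : Vec d) (g : Vec m) (c : ℝ) :
    MemLp (linScore δ g c) 2 (gaussianLaw SX SW σ) :=
  MemLp.of_eval_piLp fun i => hasAllMoments_linScore δ g c i 2 (by simp)

lemma integral_linScore (hSX : SX.PosSemidef) (hSW : SW.PosSemidef) (δ : Vec d) (g : Vec m)
    (c : ℝ) (i : Fin d) :
    ∫ z, linScore δ g c z i ∂gaussianLaw SX SW σ = -2 * (SX *ᵥ δ.ofLp) i := by
  simp_rw [linScore_apply, coord_eq_linForm]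
  rw [integral_const_mul, integral_linForm_mul hSX hSW, bform_comm hSX.1, bform_single_left]
  simp [bform_zero_right]

lemma integral_linScore_mul (hSX : SX.PosSemidef) (hSW : SW.PosSemidef) (δ : Vec d) (g : Vec m)
    (c : ℝ) (i j : Fin d) :
    ∫ z, linScore δ g c z i * linScore δ g c z j ∂gaussianLaw SX SW σ =
      4 * (SX i j * modelForm SX SW σ δ g c + 2 * (SX *ᵥ δ.ofLp) i * (SX *ᵥ δ.ofLp) j) := by
  have e : ∀ z : Obs d m, linScore δ g c z i * linScore δ g c z j =
      4 * (linForm (EuclideanSpace.single i 1) (0 : Vec m) 0 z *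
        linForm (EuclideanSpace.single j 1) (0 : Vec m) 0 z * linForm δ g c z ^ 2) := by
    intro z
    rw [linScore_apply, linScore_apply, ← coord_eq_linForm, ← coord_eq_linForm]
    ring
  simp_rw [e]
  rw [integral_const_mul, integral_dual_mul_mul_sq integral_dual_gaussianLaw,
    integral_linForm_sq hSX hSW, integral_linForm_mul hSX hSW, integral_linForm_mul hSX hSW,
    integral_linForm_mul hSX hSW]
  simp [bform_single_left, bform_zero_left]

/-- By Isserlis the second moment matrix contains the rank-one term `8 (Σ_X δ)(Σ_X δ)ᵀ`. The mean is
`-2 Σ_X δ`, and subtracting its outer product leaves half of that term. -/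
lemma covMat_linScore (hSX : SX.PosSemidef) (hSW : SW.PosSemidef) (δ : Vec d) (g : Vec m)
    (c : ℝ) :
    covMat (gaussianLaw SX SW σ) (linScore δ g c) (linScore δ g c) =
      (4 : ℝ) • (modelForm SX SW σ δ g c • SX +
        Matrix.vecMulVec (SX *ᵥ δ.ofLp) (SX *ᵥ δ.ofLp)) := by
  ext i j
  rw [covMat, Matrix.of_apply, covariance_eq_sub (hasAllMoments_linScore δ g c i 2 (by simp))
    (hasAllMoments_linScore δ g c j 2 (by simp)), integral_linScore hSX hSW,
    integral_linScore hSX hSW]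
  have := integral_linScore_mul (σ := σ) hSX hSW δ g c i j
  simp only [Pi.mul_def, this]
  simp [Matrix.vecMulVec_apply]
  ring

lemma integral_gram (hSX : SX.PosSemidef) (hSW : SW.PosSemidef) (i j : Fin d) :
    ∫ z, gram z.1 i j ∂gaussianLaw SX SW σ = 2 * SX i j := by
  simp only [gram, Matrix.of_apply, coord_eq_linForm (m := m)]
  rw [integral_const_mul, integral_linForm_mul hSX hSW]
  simp [bform_single_single, bform_zero_left]

lemma hessMat_gaussianLaw (hSX : SX.PosSemidef) (hSW : SW.PosSemidef) (Y : Obs d m → ℝ)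
    (t : Vec d) : hessMat (gaussianLaw SX SW σ) Y t = (2 : ℝ) • SX := by
  ext i j
  simp [hessMat, hessLoss_eq, integral_gram hSX hSW]

/-- Scores depend linearly on `(δ, g, c)`. Hence the gradients at `Y` and `Ŷ`, their multiples and
differences, and the optimal score all belong to one family with one covariance formula. -/
lemma linScore_sub (δ δ' : Vec d) (g g' : Vec m) (c c' : ℝ) (z : Obs d m) :
    linScore δ g c z - linScore δ' g' c' z = linScore (δ - δ') (g - g') (c - c') z := by
  simp only [linScore, ← sub_smul, linForm_apply, inner_sub_right]
  congr 1
  ring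

lemma smul_linScore (a : ℝ) (δ : Vec d) (g : Vec m) (c : ℝ) (z : Obs d m) :
    a • linScore δ g c z = linScore (a • δ) (a • g) (a * c) z := by
  simp only [linScore, smul_smul, linForm_apply, inner_smul_right]
  congr 1
  ring

/-- Up to the scalars, which cancel, `S⁻¹ (q S + (S δ)(S δ)ᵀ) S⁻¹ = q S⁻¹ + δ δᵀ`. This is the
origin of the terms `‖θ - θ̃‖²` without `Σ_X`. -/
lemma trace_sandwich (hSX : SX.PosDef) (q : ℝ) (δ : Vec d) :
    (((2 : ℝ) • SX)⁻¹ * ((4 : ℝ) • (q • SX + Matrix.vecMulVec (SX *ᵥ δ.ofLp) (SX *ᵥ δ.ofLp))) *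
      ((2 : ℝ) • SX)⁻¹).trace = q * SX⁻¹.trace + ‖δ‖ ^ 2 := by
  have hdet : IsUnit SX.det := hSX.det_pos.ne'.isUnit
  have hsymm : SXᵀ = SX := (Matrix.isHermitian_iff_isSymm.1 hSX.1).eq
  have h2 : ((2 : ℝ) • SX)⁻¹ = (2⁻¹ : ℝ) • SX⁻¹ := by
    refine Matrix.inv_eq_right_inv ?_
    rw [Matrix.smul_mul, Matrix.mul_smul, smul_smul, Matrix.mul_nonsing_inv _ hdet]
    norm_num
  have h3 : SX⁻¹ * Matrix.vecMulVec (SX *ᵥ δ.ofLp) (SX *ᵥ δ.ofLp) * SX⁻¹ =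
      Matrix.vecMulVec δ.ofLp δ.ofLp := by
    rw [Matrix.mul_vecMulVec, Matrix.vecMulVec_mul, Matrix.mulVec_mulVec,
      Matrix.nonsing_inv_mul _ hdet, Matrix.one_mulVec]
    congr 1
    rw [← Matrix.vecMul_transpose, hsymm, Matrix.vecMul_vecMul, Matrix.mul_nonsing_inv _ hdet,
      Matrix.vecMul_one]
  rw [h2]
  simp only [Matrix.smul_mul, Matrix.mul_smul, Matrix.mul_add, Matrix.add_mul, smul_add, h3,
    Matrix.nonsing_inv_mul _ hdet, Matrix.one_mul, Matrix.trace_add, Matrix.trace_smul, smul_smul,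
    smul_eq_mul, Matrix.trace_vecMulVec]
  have h4 : δ.ofLp ⬝ᵥ δ.ofLp = ‖δ‖ ^ 2 := by
    rw [EuclideanSpace.real_norm_sq_eq]
    simp [dotProduct, sq]
  rw [h4]
  ring

end GaussianModel

/-! ### Covariance matrices and variances of projections. -/

section CovMat

variable {d m : ℕ} {μ : Measure (Obs d m)}

lemma covMat_congr {f f' g g' : Obs d m → Vec d} (h : f =ᵐ[μ] g) (h' : f' =ᵐ[μ] g') :
    covMat μ f f' = covMat μ g g' := by
  ext i j
  have hi : (fun z => f z i) =ᵐ[μ] fun z => g z i := h.mono fun z hz => by simp only [hz]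
  have hj : (fun z => f' z j) =ᵐ[μ] fun z => g' z j := h'.mono fun z hz => by simp only [hz]
  simp only [covMat, Matrix.of_apply, covariance]
  rw [integral_congr_ae hi, integral_congr_ae hj]
  refine integral_congr_ae ?_
  filter_upwards [h, h'] with z hz hz'
  rw [hz, hz']

/-- Translates covariance matrices into the directional variances used by the central limit theorem;
it also yields positive semidefiniteness. -/
lemma dotProduct_covMat_mulVec [IsProbabilityMeasure μ] {f : Obs d m → Vec d} (hf : MemLp f 2 μ)
    (t : Vec d) :
    t.ofLp ⬝ᵥ (covMat μ f f *ᵥ t.ofLp) = Var[fun z => inner ℝ (f z) t; μ] := by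
  have hi : ∀ i, MemLp (fun z => f z i) 2 μ := fun i => hf.eval_piLp i
  have h1 : (fun z => inner ℝ (f z) t) = fun z => ∑ i, t i * f z i := by
    ext z; simp [PiLp.inner_apply]
  have hm : AEMeasurable (fun z => ∑ i, t i * f z i) μ :=
    Finset.aemeasurable_fun_sum _ fun i _ => (hi i).aemeasurable.const_mul _
  rw [h1, ← covariance_self hm, covariance_fun_sum_fun_sum (fun i => (hi i).const_mul (t i))
    (fun i => (hi i).const_mul (t i))]
  simp only [dotProduct, Matrix.mulVec, covMat, Matrix.of_apply, Finset.mul_sum]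
  refine Finset.sum_congr rfl fun i _ => Finset.sum_congr rfl fun j _ => ?_
  rw [covariance_const_mul_left, covariance_const_mul_right]
  ring

lemma posSemidef_covMat [IsProbabilityMeasure μ] {f : Obs d m → Vec d} (hf : MemLp f 2 μ) :
    (covMat μ f f).PosSemidef := by
  refine Matrix.PosSemidef.of_dotProduct_mulVec_nonneg ?_ fun x => ?_
  · ext i j
    simp [covMat, covariance_comm]
  · have := dotProduct_covMat_mulVec hf (WithLp.toLp 2 x)
    simp only at this
    rw [star_trivial, this]
    exact variance_nonneg _ _

end CovMat

/-! ### Population quantities: the target, the optimal score and the traces. -/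

section Population

variable {d m : ℕ} {SX : Matrix (Fin d) (Fin d) ℝ} {SW : Matrix (Fin m) (Fin m) ℝ} {σ : ℝ≥0}
  {θ θt : Vec d} {γ γt : Vec m} {Y Yhat : Obs d m → ℝ}

/-- At the target the residual `Y - Xᵀθ = Wᵀγ + ε` has no `X` component, so this score has `δ = 0`:
its mean vanishes and its covariance has no rank-one term. -/
lemma gradLoss_outcome (hY : ∀ z, Y z = inner ℝ z.2.1 γ + inner ℝ z.1 θ + z.2.2) (z : Obs d m) :
    gradLoss θ z.1 (Y z) = linScore 0 γ 1 z := by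
  rw [gradLoss_eq, linScore, linForm_apply, hY]
  congr 1
  simp
  ring

lemma gradLoss_prediction (hYhat : ∀ z, Yhat z = inner ℝ z.1 θt + inner ℝ z.2.1 γt)
    (z : Obs d m) : gradLoss θ z.1 (Yhat z) = linScore (θt - θ) γt 0 z := by
  rw [gradLoss_eq, linScore, linForm_apply, hYhat, inner_sub_right]
  congr 1
  ring

lemma risk_eq (hSX : SX.PosSemidef) (hSW : SW.PosSemidef)
    (hY : ∀ z, Y z = inner ℝ z.2.1 γ + inner ℝ z.1 θ + z.2.2) (t : Vec d) :
    risk (gaussianLaw SX SW σ) Y t = modelForm SX SW σ (θ - t) γ 1 := by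
  rw [risk, ← integral_linForm_sq hSX hSW]
  congr 1
  ext z
  rw [sqLoss, linForm_apply, hY, inner_sub_right]
  ring

lemma bform_neg_left {k : ℕ} (S : Matrix (Fin k) (Fin k) ℝ) (u v : Vec k) :
    bform S (-u) v = -bform S u v := by simp [bform]

lemma bform_neg_right {k : ℕ} (S : Matrix (Fin k) (Fin k) ℝ) (u v : Vec k) :
    bform S u (-v) = -bform S u v := by simp [bform, Matrix.mulVec_neg]

lemma bform_self_pos {k : ℕ} {S : Matrix (Fin k) (Fin k) ℝ} (hS : S.PosDef) {v : Vec k}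
    (hv : v ≠ 0) : 0 < bform S v v := by
  have : v.ofLp ≠ 0 := fun h => hv (by ext i; simp [h])
  simpa [bform] using hS.dotProduct_mulVec_pos this

lemma bform_self_nonneg {k : ℕ} {S : Matrix (Fin k) (Fin k) ℝ} (hS : S.PosSemidef) (v : Vec k) :
    0 ≤ bform S v v := by
  simpa [bform] using hS.dotProduct_mulVec_nonneg v.ofLp

lemma risk_lt (hSX : SX.PosDef) (hSW : SW.PosSemidef)
    (hY : ∀ z, Y z = inner ℝ z.2.1 γ + inner ℝ z.1 θ + z.2.2) {t : Vec d} (ht : t ≠ θ) :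
    risk (gaussianLaw SX SW σ) Y θ < risk (gaussianLaw SX SW σ) Y t := by
  rw [risk_eq hSX.posSemidef hSW hY, risk_eq hSX.posSemidef hSW hY, modelForm, modelForm, sub_self,
    bform_zero_left]
  have := bform_self_pos hSX (sub_ne_zero.2 ht.symm)
  linarith

/-- The regression coefficient of the outcome residual on the prediction residual. -/
noncomputable def recalibration (SW : Matrix (Fin m) (Fin m) ℝ) (γ γt : Vec m) : ℝ :=
  bform SW γ γt / bform SW γt γt

/-- The coefficient `recalibration SW γ γt` makes the residual uncorrelated with `Wᵀγ̃`, and it is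
uncorrelated with `X` in any case. All variables are jointly Gaussian, so uncorrelated means
independent. -/
lemma indepFun_residual (hSX : SX.PosSemidef) (hSW : SW.PosSemidef)
    (hγt : bform SW γt γt ≠ 0) :
    IndepFun (linForm (0 : Vec d) (γ - recalibration SW γ γt • γt) 1)
      (fun z : Obs d m => (z.1, inner ℝ z.2.1 γt)) (gaussianLaw SX SW σ) := by
  set μ := gaussianLaw SX SW σ
  set η : StrongDual ℝ (Obs d m) := linForm (0 : Vec d) (γ - recalibration SW γ γt • γt) 1
  set V : Obs d m →L[ℝ] Vec d × ℝ :=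
    (ContinuousLinearMap.fst ℝ (Vec d) (Vec m × ℝ)).prod (linForm (0 : Vec d) γt 0) with hV
  have hVf : ∀ z, V z = (z.1, inner ℝ z.2.1 γt) := fun z => by
    simp [hV, linForm_apply]
  simp_rw [← hVf]
  refine HasGaussianLaw.indepFun_of_covariance_strongDual ⟨?_⟩ fun L₁ L₂ => ?_
  · exact isGaussian_map (μ := μ) (η.prod V)
  · have h1 : (L₁ ∘ η : Obs d m → ℝ) = fun z => L₁ 1 * η z := by
      ext z
      have := L₁.map_smul (η z) 1
      simp only [smul_eq_mul, mul_one] at this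
      rw [Function.comp_apply, this, mul_comm]
    -- By Riesz on the first factor, a functional of `(x, wᵀγ̃)` is again a linear form of the unit,
    -- so its covariance with the residual is given by `integral_linForm_mul`.
    obtain ⟨a, ha⟩ : ∃ a : Vec d, ∀ x : Vec d, L₂ (x, 0) = inner ℝ x a := by
      refine ⟨(InnerProductSpace.toDual ℝ (Vec d)).symm
        (L₂.comp (ContinuousLinearMap.inl ℝ (Vec d) ℝ)), fun x => ?_⟩
      rw [real_inner_comm, InnerProductSpace.toDual_symm_apply]
      simp
    have h2 : (L₂ ∘ V : Obs d m → ℝ) = fun z => linForm a (L₂ (0, 1) • γt) 0 z := by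
      ext z
      have e : ((z.1, inner ℝ z.2.1 γt) : Vec d × ℝ) =
          (z.1, 0) + (inner ℝ z.2.1 γt : ℝ) • ((0, 1) : Vec d × ℝ) := by simp
      rw [Function.comp_apply, hVf, e, map_add, map_smul, ha, linForm_apply, inner_smul_right]
      simp [mul_comm]
    rw [h1, h2, covariance_const_mul_left, covariance_eq_sub (IsGaussian.memLp_dual _ _ 2 (by simp))
      (IsGaussian.memLp_dual _ _ 2 (by simp)), integral_dual_gaussianLaw,
      integral_dual_gaussianLaw]
    have := integral_linForm_mul (σ := σ) hSX hSW (0 : Vec d) a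
      (γ - recalibration SW γ γt • γt) (L₂ (0, 1) • γt) 1 0
    simp only [Pi.mul_def]
    rw [this, bform_zero_left, bform_smul_right, bform_sub_left, bform_smul_left, recalibration,
      div_mul_cancel₀ _ hγt]
    simp

/-- Conditioning on `T` removes an independent centred factor. -/
lemma condExp_add_smul_of_indepFun {𝓩 𝓣 : Type*} [MeasurableSpace 𝓣] {m m₀ : MeasurableSpace 𝓩}
    {μ : Measure 𝓩} [IsProbabilityMeasure μ] {T : 𝓩 → 𝓣} (hT : Measurable T)
    (hm : m = MeasurableSpace.comap T inferInstance) {φ ψ : 𝓣 → Vec d} (hφ : Measurable φ)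
    (hψ : Measurable ψ) {η : 𝓩 → ℝ} (hη : Measurable η) (hηi : Integrable η μ)
    (hη0 : ∫ z, η z ∂μ = 0) (hind : IndepFun η T μ) (hφi : Integrable (φ ∘ T) μ)
    (hψi : Integrable (η • (ψ ∘ T)) μ) : μ[φ ∘ T + η • (ψ ∘ T) | m] =ᵐ[μ] φ ∘ T := by
  subst hm
  have hle : MeasurableSpace.comap T inferInstance ≤ m₀ := hT.comap_le
  have hη : μ[η | MeasurableSpace.comap T inferInstance] =ᵐ[μ] fun _ => ∫ z, η z ∂μ :=
    condExp_indep_eq hη.comap_le hle (comap_measurable η).stronglyMeasurable hind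
  have hF : StronglyMeasurable[MeasurableSpace.comap T inferInstance] (φ ∘ T) :=
    (hφ.comp (comap_measurable T)).stronglyMeasurable
  have hG : StronglyMeasurable[MeasurableSpace.comap T inferInstance] (ψ ∘ T) :=
    (hψ.comp (comap_measurable T)).stronglyMeasurable
  refine (condExp_add hφi hψi _).trans ?_
  rw [condExp_of_stronglyMeasurable hle hF hφi]
  filter_upwards [condExp_smul_of_aestronglyMeasurable_right hηi hψi hG.aestronglyMeasurable, hη]
    with z h1 h2
  rw [Pi.add_apply, h1, Pi.smul_apply', h2, hη0, zero_smul, add_zero]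

/-- Split `Wᵀγ + ε` into `ρ Wᵀγ̃` and the residual. The first part is a function of `(X, Ŷ)` because
`Wᵀγ̃ = Ŷ - Xᵀθ̃`; the second is centred and independent of `(X, Ŷ)`, so its product with `X` has
conditional mean zero. -/
lemma condGrad_ae_eq (hSX : SX.PosSemidef) (hSW : SW.PosSemidef) (hγt : bform SW γt γt ≠ 0)
    (hY : ∀ z, Y z = inner ℝ z.2.1 γ + inner ℝ z.1 θ + z.2.2)
    (hYhat : ∀ z, Yhat z = inner ℝ z.1 θt + inner ℝ z.2.1 γt) :
    condGrad (gaussianLaw SX SW σ) Y Yhat θ =ᵐ[gaussianLaw SX SW σ]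
      linScore 0 (recalibration SW γ γt • γt) 0 := by
  set ρ := recalibration SW γ γt with hρ
  have hYm : Measurable Yhat := by
    rw [funext hYhat]
    exact (measurable_fst.inner measurable_const).add
      ((measurable_fst.comp measurable_snd).inner measurable_const)
  set T : Obs d m → Vec d × ℝ := fun z => (z.1, Yhat z) with hT
  have hTm : Measurable T := measurable_fst.prodMk hYm
  set η : Obs d m → ℝ := fun z => -2 * linForm (0 : Vec d) (γ - ρ • γt) 1 z with hη
  set φ : Vec d × ℝ → Vec d := fun p => (-2 * (ρ * (p.2 - inner ℝ p.1 θt))) • p.1 with hφ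
  have hF : linScore (0 : Vec d) (ρ • γt) 0 = φ ∘ T := by
    ext1 z
    simp [linScore, linForm_apply, T, hYhat, inner_smul_right, φ]
  have hsmul : linScore (0 : Vec d) (γ - ρ • γt) 1 = η • (Prod.fst ∘ T) := rfl
  have hdecomp : (fun z => gradLoss θ z.1 (Y z)) = φ ∘ T + η • (Prod.fst ∘ T) := by
    ext1 z
    have : linScore (0 : Vec d) γ 1 z - linScore 0 (ρ • γt) 0 z = linScore 0 (γ - ρ • γt) 1 z := by
      rw [linScore_sub]; simp
    rw [gradLoss_outcome hY, ← hF, ← hsmul, Pi.add_apply, ← this]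
    abel
  have hindep : IndepFun η T (gaussianLaw SX SW σ) := by
    have h1 := (indepFun_residual (σ := σ) hSX hSW hγt (γ := γ)).comp
      (φ := fun x : ℝ => -2 * x) (ψ := fun p : Vec d × ℝ => (p.1, inner ℝ p.1 θt + p.2))
      (by fun_prop) (by fun_prop)
    have h2 : ((fun p : Vec d × ℝ => (p.1, inner ℝ p.1 θt + p.2)) ∘
        fun z : Obs d m => (z.1, inner ℝ z.2.1 γt)) = T := by
      ext1 z
      simp [T, hYhat]
    rwa [h2] at h1
  rw [condGrad, hdecomp, hF]
  refine condExp_add_smul_of_indepFun hTm rfl (by fun_prop) measurable_fst (by fun_prop)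
    ((hasAllMoments_dual _).integrable.const_mul (-2)) ?_ hindep ?_ ?_
  · rw [integral_const_mul, integral_dual_gaussianLaw, mul_zero]
  · rw [← hF]
    exact (memLp_linScore _ _ _).integrable (by simp)
  · rw [← hsmul]
    exact (memLp_linScore _ _ _).integrable (by simp)

lemma PPI.IsOptimalScore.ae_eq (hSX : SX.PosSemidef) (hSW : SW.PosSemidef)
    (hγt : bform SW γt γt ≠ 0)
    (hY : ∀ z, Y z = inner ℝ z.2.1 γ + inner ℝ z.1 θ + z.2.2)
    (hYhat : ∀ z, Yhat z = inner ℝ z.1 θt + inner ℝ z.2.1 γt) {s : Vec d × ℝ → Vec d}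
    (hs : IsOptimalScore (gaussianLaw SX SW σ) Y Yhat θ s) :
    (fun z : Obs d m => s (z.1, Yhat z)) =ᵐ[gaussianLaw SX SW σ]
      linScore 0 (recalibration SW γ γt • γt) 0 :=
  hs.2.trans (condGrad_ae_eq hSX hSW hγt hY hYhat)

lemma avarPPI_congr {μ : Measure (Obs d m)} {t : Vec d} {r : ℝ} {G G' : Obs d m → Vec d}
    (h : G =ᵐ[μ] G') : avarPPI μ Y t r G = avarPPI μ Y t r G' := by
  have h' : (fun z => gradLoss t z.1 (Y z) - G z) =ᵐ[μ] fun z => gradLoss t z.1 (Y z) - G' z :=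
    h.mono fun z hz => by simp only [hz]
  rw [avarPPI, avarPPI, covMat_congr h h, covMat_congr h' h']

lemma avarPPI_linScore (hSX : SX.PosSemidef) (hSW : SW.PosSemidef)
    (hY : ∀ z, Y z = inner ℝ z.2.1 γ + inner ℝ z.1 θ + z.2.2) (r : ℝ) (δ : Vec d) (g : Vec m)
    (c : ℝ) :
    avarPPI (gaussianLaw SX SW σ) Y θ r (linScore δ g c) =
      ((2 : ℝ) • SX)⁻¹ * (r • ((4 : ℝ) • (modelForm SX SW σ δ g c • SX +
        Matrix.vecMulVec (SX *ᵥ δ.ofLp) (SX *ᵥ δ.ofLp))) +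
        (4 : ℝ) • (modelForm SX SW σ (-δ) (γ - g) (1 - c) • SX +
        Matrix.vecMulVec (SX *ᵥ (-δ).ofLp) (SX *ᵥ (-δ).ofLp))) * ((2 : ℝ) • SX)⁻¹ := by
  rw [avarPPI, hessMat_gaussianLaw hSX hSW, covMat_linScore hSX hSW]
  have : (fun z => gradLoss θ z.1 (Y z) - linScore δ g c z) = linScore (-δ) (γ - g) (1 - c) := by
    ext1 z
    rw [gradLoss_outcome hY, linScore_sub, zero_sub]
  rw [this, covMat_linScore hSX hSW]

lemma trace_avarPPI_linScore (hSX : SX.PosDef) (hSW : SW.PosSemidef)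
    (hY : ∀ z, Y z = inner ℝ z.2.1 γ + inner ℝ z.1 θ + z.2.2) (r : ℝ) (δ : Vec d) (g : Vec m)
    (c : ℝ) :
    (avarPPI (gaussianLaw SX SW σ) Y θ r (linScore δ g c)).trace =
      (r * modelForm SX SW σ δ g c + modelForm SX SW σ (-δ) (γ - g) (1 - c)) * SX⁻¹.trace +
        (1 + r) * ‖δ‖ ^ 2 := by
  rw [avarPPI_linScore hSX.posSemidef hSW hY, Matrix.mul_add, Matrix.add_mul, Matrix.trace_add,
    Matrix.mul_smul, Matrix.smul_mul, Matrix.trace_smul, trace_sandwich hSX, trace_sandwich hSX,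
    norm_neg, smul_eq_mul]
  ring

lemma scaled_gradLoss (hYhat : ∀ z, Yhat z = inner ℝ z.1 θt + inner ℝ z.2.1 γt) (l : ℝ) :
    (fun z : Obs d m => l • gradLoss θ z.1 (Yhat z)) = linScore (l • (θt - θ)) (l • γt) 0 := by
  ext1 z
  rw [gradLoss_prediction hYhat, smul_linScore, mul_zero]

/-- Expanded as a polynomial in `l`, so that optimal tuning amounts to completing the square. -/
lemma trace_avarScaled (hSX : SX.PosDef) (hSW : SW.PosSemidef)
    (hY : ∀ z, Y z = inner ℝ z.2.1 γ + inner ℝ z.1 θ + z.2.2)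
    (hYhat : ∀ z, Yhat z = inner ℝ z.1 θt + inner ℝ z.2.1 γt) (r l : ℝ) :
    (avarScaled (gaussianLaw SX SW σ) Y Yhat θ r l).trace =
      ((σ : ℝ) ^ 2 + bform SW γ γ) * SX⁻¹.trace - 2 * l * bform SW γ γt * SX⁻¹.trace +
        (1 + r) * l ^ 2 * ((bform SX (θ - θt) (θ - θt) + bform SW γt γt) * SX⁻¹.trace +
          ‖θ - θt‖ ^ 2) := by
  rw [avarScaled, scaled_gradLoss hYhat, trace_avarPPI_linScore hSX hSW hY, norm_smul,
    ← neg_sub θ θt, norm_neg, mul_pow, Real.norm_eq_abs, sq_abs]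
  simp only [modelForm, bform_smul_left, bform_smul_right, bform_sub_left, bform_sub_right,
    bform_comm hSW.1 γt γ, bform_neg_left, bform_neg_right]
  ring

/-- The optimal linear imputed gradient. -/
lemma avarRePPI_eq_avarPPI (hSX : SX.PosSemidef) (hSW : SW.PosSemidef)
    (hγt : bform SW γt γt ≠ 0)
    (hY : ∀ z, Y z = inner ℝ z.2.1 γ + inner ℝ z.1 θ + z.2.2)
    (hYhat : ∀ z, Yhat z = inner ℝ z.1 θt + inner ℝ z.2.1 γt) {r : ℝ} (hr : 0 ≤ r) :
    avarRePPI (gaussianLaw SX SW σ) Y Yhat θ r =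
      avarPPI (gaussianLaw SX SW σ) Y θ r
        (linScore 0 (((1 + r)⁻¹ * recalibration SW γ γt) • γt) 0) := by
  have h1 : (fun z => gradLoss θ z.1 (Y z)) = linScore 0 γ 1 := funext (gradLoss_outcome hY)
  rw [avarPPI_linScore hSX hSW hY, avarRePPI, covMat_congr (condGrad_ae_eq hSX hSW hγt hY hYhat)
      (condGrad_ae_eq hSX hSW hγt hY hYhat),
    h1, covMat_linScore hSX hSW, covMat_linScore hSX hSW, hessMat_gaussianLaw hSX hSW]
  congr 2
  have hr' : (1 + r) ≠ 0 := by positivity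
  -- Since `δ = 0` throughout, both sides are multiples of `Σ_X`. The optimal score has the same
  -- second moment as its cross moment with the gradient, so the scale `c = (1 + r)⁻¹` contributes
  -- `(1 + r) c² - 2 c = -(1 + r)⁻¹`.
  simp only [WithLp.ofLp_zero, neg_zero, Matrix.mulVec_zero, Matrix.zero_vecMulVec, add_zero,
    smul_smul, ← add_smul, ← sub_smul]
  congr 1
  simp only [modelForm, bform_smul_left, bform_smul_right, bform_sub_left, bform_sub_right,
    bform_comm hSW.1 γt γ, bform_zero_left, recalibration]
  field_simp
  ring

lemma trace_avarRePPI (hSX : SX.PosDef) (hSW : SW.PosSemidef)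
    (hγt : bform SW γt γt ≠ 0)
    (hY : ∀ z, Y z = inner ℝ z.2.1 γ + inner ℝ z.1 θ + z.2.2)
    (hYhat : ∀ z, Yhat z = inner ℝ z.1 θt + inner ℝ z.2.1 γt) {r : ℝ} (hr : 0 ≤ r) :
    (avarRePPI (gaussianLaw SX SW σ) Y Yhat θ r).trace =
      ((σ : ℝ) ^ 2 + bform SW γ γ -
        1 / (1 + r) * (bform SW γ γt ^ 2 / bform SW γt γt)) * SX⁻¹.trace := by
  have hr' : (1 + r) ≠ 0 := by positivity
  rw [avarRePPI_eq_avarPPI hSX.posSemidef hSW hγt hY hYhat hr, trace_avarPPI_linScore hSX hSW hY]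
  simp only [modelForm, bform_smul_left, bform_smul_right, bform_sub_left, bform_sub_right,
    bform_comm hSW.1 γt γ, bform_zero_left, recalibration, norm_zero, neg_zero]
  field_simp
  ring

/-- The dimension must be positive, as the trace of an empty matrix is zero. -/
lemma trace_inv_pos (hd : 0 < d) (hSX : SX.PosDef) : 0 < SX⁻¹.trace := by
  have : Nonempty (Fin d) := ⟨⟨0, hd⟩⟩
  exact hSX.inv.trace_pos

end Population

/-! ### Score contrasts and empirical Hessians. -/

section Contrast

variable {Ω 𝓩 : Type*} [MeasurableSpace Ω] [MeasurableSpace 𝓩] {P : Measure Ω} {μ : Measure 𝓩}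
  [IsProbabilityMeasure P] {Z : ℕ → Ω → 𝓩} {d : ℕ}

lemma avg_apply (I : Finset ℕ) (f : ℕ → Vec d) (i : Fin d) :
    avg I f i = avg I fun k => f k i := by
  simp [avg]

lemma avg_matrix_apply (I : Finset ℕ) (f : ℕ → Matrix (Fin d) (Fin d) ℝ) (i j : Fin d) :
    avg I f i j = avg I fun k => f k i j := by
  simp [avg, Matrix.sum_apply]

lemma avg_smul {V : Type*} [AddCommGroup V] [Module ℝ V] (I : Finset ℕ) (c : ℝ) (f : ℕ → V) :
    avg I (fun i => c • f i) = c • avg I f := by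
  rw [avg, avg, ← Finset.smul_sum, smul_comm]

/-- The score contrast of a PPI estimator: `√n` times the difference of the labelled average of
`u` and the imputed rectifier of `v`. -/
noncomputable def contrast (Z : ℕ → Ω → 𝓩) (u v : 𝓩 → Vec d) (c : ℝ) (L U : ℕ → Finset ℕ)
    (q : ℕ × Ω) : Vec d :=
  √(q.1 : ℝ) • (avg (L q.1) (fun i => u (Z i q.2)) -
    c • (avg (L q.1) (fun i => v (Z i q.2)) - avg (U q.1) (fun i => v (Z i q.2))))

/-- Both averages are centred at the same mean, which cancels; so `v` need not have mean zero. -/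
lemma bddInProb_sqrt_avg_sub_avg (hZ : ∀ i, Measurable (Z i)) (hind : iIndepFun Z P)
    (hlaw : ∀ i, P.map (Z i) = μ) {v : 𝓩 → ℝ} (hv : Measurable v) (hv2 : MemLp v 2 μ)
    {L U : ℕ → Finset ℕ} {K K' : ℝ} (hK : 0 ≤ K) (hK' : 0 ≤ K')
    (hL : ∀ᶠ n : ℕ in atTop, (n : ℝ) ≤ K * (L n).card)
    (hU : ∀ᶠ n : ℕ in atTop, (n : ℝ) ≤ K' * (U n).card) :
    BddInProb P fun q => √(q.1 : ℝ) *
      (avg (L q.1) (fun i => v (Z i q.2)) - avg (U q.1) (fun i => v (Z i q.2))) := by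
  have h := (bddInProb_sqrt_mul_avg hZ hind hlaw hv hv2 hK hL).sub
    (bddInProb_sqrt_mul_avg hZ hind hlaw hv hv2 hK' hU)
  convert! h using 2
  ring

lemma bddInProb_contrast (hZ : ∀ i, Measurable (Z i)) (hind : iIndepFun Z P)
    (hlaw : ∀ i, P.map (Z i) = μ) {u v : 𝓩 → Vec d} (hu : Measurable u) (hu2 : MemLp u 2 μ)
    (hu0 : ∀ i, ∫ z, u z i ∂μ = 0) (hv : Measurable v) (hv2 : MemLp v 2 μ) (c : ℝ)
    {L U : ℕ → Finset ℕ} {K K' : ℝ} (hK : 0 ≤ K) (hK' : 0 ≤ K')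
    (hL : ∀ᶠ n : ℕ in atTop, (n : ℝ) ≤ K * (L n).card)
    (hU : ∀ᶠ n : ℕ in atTop, (n : ℝ) ≤ K' * (U n).card) (i : Fin d) :
    BddInProb P fun q => contrast Z u v c L U q i := by
  have h1 := bddInProb_sqrt_mul_avg hZ hind hlaw (f := fun z => u z i) (by fun_prop)
    (hu2.eval_piLp i) hK hL
  have h2 := bddInProb_sqrt_avg_sub_avg hZ hind hlaw (v := fun z => v z i) (by fun_prop)
    (hv2.eval_piLp i) hK hK' hL hU
  rw [hu0 i] at h1
  convert! h1.sub (h2.const_mul c) using 2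
  simp only [contrast, PiLp.smul_apply, PiLp.sub_apply, avg_apply, smul_eq_mul]
  ring

lemma tendsto_avg_gram {m : ℕ} {ν : Measure (Obs d m)} {Z : ℕ → Ω → Obs d m}
    (hZ : ∀ i, Measurable (Z i)) (hind : iIndepFun Z P)
    (hlaw : ∀ i, P.map (Z i) = ν) {H : Matrix (Fin d) (Fin d) ℝ}
    (hm : ∀ i j, HasAllMoments ν fun z => gram z.1 i j)
    (hH : ∀ i j, ∫ z, gram z.1 i j ∂ν = H i j) {I : ℕ → Finset ℕ} {K : ℝ} (hK : 0 ≤ K)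
    (hI : ∀ᶠ n : ℕ in atTop, (n : ℝ) ≤ K * (I n).card) :
    Tendsto (fun q : ℕ × Ω => avg (I q.1) fun i => gram (Z i q.2).1) (inProb P) (𝓝 H) := by
  rw [tendsto_matrix_iff]
  intro i j
  rw [← hH i j]
  simp_rw [avg_matrix_apply]
  refine tendsto_avg_inProb hZ hind hlaw (f := fun z => gram z.1 i j) ?_ (hm i j 2 (by simp)) hK hI
  simp only [gram, Matrix.of_apply]
  fun_prop

end Contrast

/-! ### Asymptotics of PPI estimators without cross-fitting. -/

section Estimators

variable {Ω : Type*} [MeasurableSpace Ω] {P : Measure Ω} [IsProbabilityMeasure P] {d m : ℕ}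
  {SX : Matrix (Fin d) (Fin d) ℝ} {SW : Matrix (Fin m) (Fin m) ℝ} {σ : ℝ≥0}
  {θ θt : Vec d} {γ γt : Vec m} {Y Yhat : Obs d m → ℝ} {Z : ℕ → Ω → Obs d m} {N : ℕ → ℕ} {r : ℝ}

lemma hasAllMoments_gram (i j : Fin d) :
    HasAllMoments (gaussianLaw SX SW σ) fun z => gram z.1 i j := by
  simp only [gram, Matrix.of_apply]
  exact ((hasAllMoments_coord i).mul (hasAllMoments_coord j)).const_mul 2

/-- An estimator which is asymptotically linear in the score contrast has the asymptotic covariance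
of PPI. -/
lemma hasAsymptoticCovariance_of_contrast (hSX : SX.PosDef) (hSW : SW.PosSemidef)
    (hY : ∀ z, Y z = inner ℝ z.2.1 γ + inner ℝ z.1 θ + z.2.2)
    (hZ : ∀ i, Measurable (Z i)) (hind : iIndepFun Z P)
    (hlaw : ∀ i, P.map (Z i) = gaussianLaw SX SW σ) (hN : ∀ n, 0 < N n)
    (hr : Tendsto (fun n : ℕ => (n : ℝ) / (N n : ℝ)) atTop (𝓝 r)) {v : Obs d m → Vec d}
    (hv : Measurable v) (hv2 : MemLp v 2 (gaussianLaw SX SW σ)) (c : ℝ)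
    {est : ℕ → Ω → Vec d} (hest : ∀ n, AEMeasurable (est n) P)
    (hlin : Tendsto (fun q : ℕ × Ω => √(q.1 : ℝ) • (est q.1 q.2 - θ) +
      Matrix.toEuclideanCLM (𝕜 := ℝ) ((2 : ℝ) • SX)⁻¹
        (contrast Z (linScore 0 γ 1) v c Finset.range (unlabelled N) q)) (inProb P) (𝓝 0)) :
    HasAsymptoticCovariance P est θ (avarPPI (gaussianLaw SX SW σ) Y θ r fun z => c • v z) := by
  set μ := gaussianLaw SX SW σ
  have hu2 : MemLp (linScore 0 γ 1) 2 μ := memLp_linScore 0 γ 1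
  have hf2 : MemLp (fun z => linScore 0 γ 1 z - c • v z) 2 μ := hu2.sub (hv2.const_smul c)
  have hg2 : MemLp (fun z => c • v z) 2 μ := hv2.const_smul c
  have hS1 := posSemidef_covMat hf2
  have hS2 := posSemidef_covMat hg2
  have hr0 := ratio_limit_nonneg hr
  have hS : (r • covMat μ (fun z => c • v z) (fun z => c • v z) +
      covMat μ (fun z => linScore 0 γ 1 z - c • v z) fun z => linScore 0 γ 1 z - c • v z).PosSemidef :=
    (hS2.smul hr0).add hS1
  have hclt := tendstoInDistribution_two_sample (f := fun z => linScore 0 γ 1 z - c • v z)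
    (g := fun z => c • v z) hZ hind hlaw ((measurable_linScore 0 γ 1).sub (hv.const_smul c))
    (hv.const_smul c) hf2 hg2 hN hr hS
    fun t => by
      rw [Matrix.add_mulVec, dotProduct_add, Matrix.smul_mulVec, dotProduct_smul,
        dotProduct_covMat_mulVec hf2, dotProduct_covMat_mulVec hg2, smul_eq_mul, add_comm]
  -- Because the outcome score has mean zero, the centring constants of the two samples cancel and
  -- the centred statistic is the contrast itself.
  have hmean : ∫ z, (linScore 0 γ 1 z - c • v z) ∂μ = - ∫ z, c • v z ∂μ := by
    rw [integral_sub (hu2.integrable (by simp)) (hg2.integrable (by simp)), sub_eq_neg_self]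
    ext i
    rw [eval_integral_piLp fun i => (hu2.eval_piLp i).integrable (by simp),
      integral_linScore hSX.posSemidef hSW]
    simp
  have hC : ∀ (n : ℕ) ω, √(n : ℝ) •
      ((avg (Finset.range n) (fun i => linScore 0 γ 1 (Z i ω) - c • v (Z i ω)) -
        ∫ z, (linScore 0 γ 1 z - c • v z) ∂μ) +
        (avg (unlabelled N n) (fun i => c • v (Z i ω)) - ∫ z, c • v z ∂μ)) =
      contrast Z (linScore 0 γ 1) v c Finset.range (unlabelled N) (n, ω) := by
    intro n ω
    rw [hmean, avg_sub, avg_smul, avg_smul, contrast, smul_sub c]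
    congr 1
    abel
  have hsymm : (((2 : ℝ) • SX)⁻¹)ᵀ = ((2 : ℝ) • SX)⁻¹ := by
    rw [Matrix.transpose_nonsing_inv, Matrix.transpose_smul,
      (Matrix.isHermitian_iff_isSymm.1 hSX.1).eq]
  -- The sign of `M = -H⁻¹` disappears in `M S Mᵀ`.
  have h := hasAsymptoticCovariance_of_linearization hest (t := θ) (M := -((2 : ℝ) • SX)⁻¹) hS hclt
    (by
      simp only [hC]
      refine hlin.congr fun q => ?_
      simp [map_neg])
  convert! h using 1
  rw [avarPPI, hessMat_gaussianLaw hSX.posSemidef hSW]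
  simp only [gradLoss_outcome hY, Matrix.transpose_neg, hsymm, Matrix.neg_mul, Matrix.mul_neg,
    neg_neg]

lemma det_two_smul_ne_zero (hSX : SX.PosDef) : ((2 : ℝ) • SX).det ≠ 0 := by
  rw [Matrix.det_smul]
  exact mul_ne_zero (by positivity) hSX.det_pos.ne'

/-- Estimators solving a linear score equation with consistently tuned imputed score. -/
lemma hasAsymptoticCovariance_of_scoreEquation (hSX : SX.PosDef) (hSW : SW.PosSemidef)
    (hY : ∀ z, Y z = inner ℝ z.2.1 γ + inner ℝ z.1 θ + z.2.2)
    (hZ : ∀ i, Measurable (Z i)) (hind : iIndepFun Z P)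
    (hlaw : ∀ i, P.map (Z i) = gaussianLaw SX SW σ) (hN : ∀ n, 0 < N n)
    (hr : Tendsto (fun n : ℕ => (n : ℝ) / (N n : ℝ)) atTop (𝓝 r)) {v : Obs d m → Vec d}
    (hv : Measurable v) (hv2 : MemLp v 2 (gaussianLaw SX SW σ)) {c : ℝ} {cHat : ℕ × Ω → ℝ}
    (hc : Tendsto cHat (inProb P) (𝓝 c)) {est : ℕ → Ω → Vec d}
    (hest : ∀ n, AEMeasurable (est n) P) {A : ℕ × Ω → Matrix (Fin d) (Fin d) ℝ}
    (hA : Tendsto A (inProb P) (𝓝 ((2 : ℝ) • SX)))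
    (heq : ∀ᶠ q in inProb P, A q *ᵥ (est q.1 q.2 - θ).ofLp =
      -(avg (Finset.range q.1) (fun i => linScore 0 γ 1 (Z i q.2)) -
        cHat q • (avg (Finset.range q.1) (fun i => v (Z i q.2)) -
          avg (unlabelled N q.1) (fun i => v (Z i q.2)))).ofLp) :
    HasAsymptoticCovariance P est θ (avarPPI (gaussianLaw SX SW σ) Y θ r fun z => c • v z) := by
  refine hasAsymptoticCovariance_of_contrast hSX hSW hY hZ hind hlaw hN hr hv hv2 c hest ?_
  have hr0 := ratio_limit_nonneg hr
  have hL : ∀ᶠ n : ℕ in atTop, (n : ℝ) ≤ 1 * (Finset.range n).card := by simp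
  have hU := eventually_le_mul_card hN hr
  have hu0 : ∀ i, ∫ z, linScore (0 : Vec d) γ 1 z i ∂gaussianLaw SX SW σ = 0 := fun i => by
    rw [integral_linScore hSX.posSemidef hSW]; simp
  have hC := bddInProb_contrast hZ hind hlaw (measurable_linScore 0 γ 1) (memLp_linScore 0 γ 1) hu0
    hv hv2 c zero_le_one (by positivity) hL hU
  have h := tendsto_solution_sub (det_two_smul_ne_zero hSX) hA
    (T := fun q => √(q.1 : ℝ) • (est q.1 q.2 - θ))
    (B := fun q => -(√(q.1 : ℝ) • (avg (Finset.range q.1) (fun i => linScore 0 γ 1 (Z i q.2)) -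
        cHat q • (avg (Finset.range q.1) (fun i => v (Z i q.2)) -
          avg (unlabelled N q.1) (fun i => v (Z i q.2))))))
    (C := fun q => -contrast Z (linScore 0 γ 1) v c Finset.range (unlabelled N) q) ?_ ?_ ?_
  · refine h.congr fun q => ?_
    rw [map_neg, sub_neg_eq_add]
  · filter_upwards [heq] with q hq
    rw [WithLp.ofLp_smul, Matrix.mulVec_smul, hq]
    simp only [WithLp.ofLp_neg, WithLp.ofLp_smul, smul_neg]
  · rw [tendsto_vec_iff]
    intro i
    -- Replacing `cHat` by its limit costs `cHat - c` times a contrast bounded in probability.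
    have hb := bddInProb_sqrt_avg_sub_avg hZ hind hlaw (v := fun z => v z i) (by fun_prop)
      (hv2.eval_piLp i) zero_le_one (by positivity) hL hU
    have hc0 : Tendsto (fun q => cHat q - c) (inProb P) (𝓝 0) := by
      simpa using hc.sub_const c
    refine (hb.tendsto_mul hc0).congr fun q => ?_
    simp only [contrast, PiLp.sub_apply, PiLp.neg_apply, PiLp.smul_apply, smul_eq_mul, avg_apply]
    ring
  · intro i
    convert! (hC i).const_mul (-1) using 2
    simp

lemma isHermitian_avg_gram (I : Finset ℕ) (z : ℕ → Obs d m) :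
    (avg I fun i => gram (z i).1).IsHermitian := by
  rw [avg]
  refine Matrix.IsHermitian.smul ?_ (IsSelfAdjoint.all _)
  exact isSelfAdjoint_sum _ fun i _ => gram_isHermitian _

/-- The PPI estimator with a consistently scaled imputed squared loss. -/
theorem hasAsymptoticCovariance_scaled (hSX : SX.PosDef) (hSW : SW.PosSemidef)
    (hY : ∀ z, Y z = inner ℝ z.2.1 γ + inner ℝ z.1 θ + z.2.2)
    (hYhat : ∀ z, Yhat z = inner ℝ z.1 θt + inner ℝ z.2.1 γt)
    (hZ : ∀ i, Measurable (Z i)) (hind : iIndepFun Z P)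
    (hlaw : ∀ i, P.map (Z i) = gaussianLaw SX SW σ) (hN : ∀ n, 0 < N n)
    (hr : Tendsto (fun n : ℕ => (n : ℝ) / (N n : ℝ)) atTop (𝓝 r))
    {lam : ℝ} {lamHat : ℕ → Ω → ℝ} (hlam : TendstoInMeasure P lamHat atTop fun _ => lam)
    {est : ℕ → Ω → Vec d}
    (hest : IsPPIEstimator P Y Yhat Z N (fun n ω t x y => lamHat n ω * sqLoss t x y) est) :
    HasAsymptoticCovariance P est θ (avarScaled (gaussianLaw SX SW σ) Y Yhat θ r lam) := by
  have hlam' : Tendsto (fun q : ℕ × Ω => lamHat q.1 q.2) (inProb P) (𝓝 lam) :=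
    tendstoInMeasure_iff_tendsto_inProb.1 hlam
  have hr0 := ratio_limit_nonneg hr
  have hgL := tendsto_avg_gram hZ hind hlaw hasAllMoments_gram (H := (2 : ℝ) • SX)
    (integral_gram hSX.posSemidef hSW) zero_le_one (I := Finset.range) (by simp)
  have hgU := tendsto_avg_gram hZ hind hlaw hasAllMoments_gram (H := (2 : ℝ) • SX)
    (integral_gram hSX.posSemidef hSW) (by positivity) (eventually_le_mul_card hN hr)
  -- The Hessian of the objective. It can be indefinite at a given sample size, but the two Gram
  -- averages have the same limit, so it converges to `2 Σ_X` whatever the limit of the scale.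
  set A : ℕ × Ω → Matrix (Fin d) (Fin d) ℝ := fun q =>
    (avg (Finset.range q.1) fun i => gram (Z i q.2).1) -
      lamHat q.1 q.2 • ((avg (Finset.range q.1) fun i => gram (Z i q.2).1) -
        avg (unlabelled N q.1) fun i => gram (Z i q.2).1) with hAdef
  have hA : Tendsto A (inProb P) (𝓝 ((2 : ℝ) • SX)) := by
    have h := hgL.sub (hlam'.smul (hgL.sub hgU))
    simpa using h
  have hherm : ∀ q, (A q).IsHermitian := fun q =>
    (isHermitian_avg_gram _ _).sub
      (((isHermitian_avg_gram _ _).sub (isHermitian_avg_gram _ _)).smul (IsSelfAdjoint.all _))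
  have hPD : ((2 : ℝ) • SX).PosDef := hSX.smul two_pos
  have hpos := hPD.eventually_posDef hA hherm
  rw [avarScaled]
  simp only [gradLoss_prediction hYhat]
  refine hasAsymptoticCovariance_of_scoreEquation hSX hSW hY hZ hind hlaw hN hr
    (measurable_linScore _ _ _) (memLp_linScore _ _ _) hlam' (fun n => (hest n).1) hA ?_
  filter_upwards [hpos, eventually_inProb_of_ae
    (p := fun q => IsArgmin (ppiObjective Y Yhat (fun i => Z i q.2) (Finset.range q.1)
      (unlabelled N q.1) fun t x y => lamHat q.1 q.2 * sqLoss t x y) (est q.1 q.2))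
    fun n => (hest n).2] with q hq hmin
  have hquad := (HasQuadExpansion.avg (θ := θ) (Finset.range q.1) fun i =>
      hasQuadExpansion_sqLoss θ (Z i q.2).1 (Y (Z i q.2))).sub
    (((HasQuadExpansion.avg (θ := θ) (Finset.range q.1) fun i =>
      hasQuadExpansion_sqLoss θ (Z i q.2).1 (Yhat (Z i q.2))).sub
    (HasQuadExpansion.avg (θ := θ) (unlabelled N q.1) fun i =>
      hasQuadExpansion_sqLoss θ (Z i q.2).1 (Yhat (Z i q.2)))).const_mul (lamHat q.1 q.2))
  have := hquad.mulVec_sub_eq_neg hq (IsArgmin.congr hmin fun t => by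
    simp only [ppiObjective, avg_mul_left]
    ring)
  simpa only [gradLoss_outcome hY, gradLoss_prediction hYhat, WithLp.ofLp_neg] using this

/-- The PPI estimator with a linear imputed loss. -/
theorem hasAsymptoticCovariance_linear (hSX : SX.PosDef) (hSW : SW.PosSemidef)
    (hY : ∀ z, Y z = inner ℝ z.2.1 γ + inner ℝ z.1 θ + z.2.2)
    (hYhat : Measurable Yhat)
    (hZ : ∀ i, Measurable (Z i)) (hind : iIndepFun Z P)
    (hlaw : ∀ i, P.map (Z i) = gaussianLaw SX SW σ) (hN : ∀ n, 0 < N n)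
    (hr : Tendsto (fun n : ℕ => (n : ℝ) / (N n : ℝ)) atTop (𝓝 r)) {s : Vec d × ℝ → Vec d}
    (hs : Measurable s) (hs2 : MemLp (fun z : Obs d m => s (z.1, Yhat z)) 2 (gaussianLaw SX SW σ))
    (c : ℝ) {est : ℕ → Ω → Vec d}
    (hest : IsPPIEstimator P Y Yhat Z N (fun _ _ t x y => c * inner ℝ t (s (x, y))) est) :
    HasAsymptoticCovariance P est θ
      (avarPPI (gaussianLaw SX SW σ) Y θ r fun z => c • s (z.1, Yhat z)) := by
  have hA := tendsto_avg_gram hZ hind hlaw hasAllMoments_gram (H := (2 : ℝ) • SX)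
    (integral_gram hSX.posSemidef hSW) zero_le_one (I := Finset.range) (by simp)
  have hPD : ((2 : ℝ) • SX).PosDef := hSX.smul two_pos
  have hpos := hPD.eventually_posDef hA fun q => isHermitian_avg_gram _ _
  refine hasAsymptoticCovariance_of_scoreEquation hSX hSW hY hZ hind hlaw hN hr
    (hs.comp (measurable_fst.prodMk hYhat)) hs2 tendsto_const_nhds (fun n => (hest n).1) hA ?_
  filter_upwards [hpos, eventually_inProb_of_ae
    (p := fun q => IsArgmin (ppiObjective Y Yhat (fun i => Z i q.2) (Finset.range q.1)
      (unlabelled N q.1) fun t x y => c * inner ℝ t (s (x, y))) (est q.1 q.2))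
    fun n => (hest n).2] with q hq hmin
  have hquad := (HasQuadExpansion.avg (θ := θ) (Finset.range q.1) fun i =>
      hasQuadExpansion_sqLoss θ (Z i q.2).1 (Y (Z i q.2))).sub
    (((HasQuadExpansion.avg (θ := θ) (Finset.range q.1) fun i =>
      HasQuadExpansion.linear (s ((Z i q.2).1, Yhat (Z i q.2)))).sub
    (HasQuadExpansion.avg (θ := θ) (unlabelled N q.1) fun i =>
      HasQuadExpansion.linear (s ((Z i q.2).1, Yhat (Z i q.2))))).const_mul c)
  -- A linear imputed loss leaves the Hessian untouched.
  have h0 : ∀ I : Finset ℕ, avg I (fun _ => (0 : Matrix (Fin d) (Fin d) ℝ)) = 0 := fun I => by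
    simp [avg]
  simp only [h0, sub_zero, smul_zero] at hquad
  have := hquad.mulVec_sub_eq_neg hq (IsArgmin.congr hmin fun t => by
    simp only [ppiObjective, avg_mul_left, real_inner_comm t]
    ring)
  simpa only [gradLoss_outcome hY, WithLp.ofLp_neg, Function.comp_apply] using this

end Estimators

/-! ### Stability of sample covariances under mean square perturbations. -/

section SampleCovariance

lemma sq_avg_mul_le (I : Finset ℕ) (u v : ℕ → ℝ) :
    avg I (fun i => u i * v i) ^ 2 ≤ avg I (fun i => u i ^ 2) * avg I fun i => v i ^ 2 := by
  simp only [avg, smul_eq_mul, mul_pow]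
  calc ((I.card : ℝ)⁻¹) ^ 2 * (∑ i ∈ I, u i * v i) ^ 2
      ≤ ((I.card : ℝ)⁻¹) ^ 2 * ((∑ i ∈ I, u i ^ 2) * ∑ i ∈ I, v i ^ 2) := by
        gcongr
        exact Finset.sum_mul_sq_le_sq_mul_sq I u v
    _ = _ := by ring

variable {α : Type*} {l : Filter α} {I : α → Finset ℕ}

lemma tendsto_avg_mul_zero {u v : α → ℕ → ℝ} {b : ℝ}
    (hu : Tendsto (fun q => avg (I q) fun i => u q i ^ 2) l (𝓝 0))
    (hv : Tendsto (fun q => avg (I q) fun i => v q i ^ 2) l (𝓝 b)) :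
    Tendsto (fun q => avg (I q) fun i => u q i * v q i) l (𝓝 0) := by
  have h := (hu.mul hv).sqrt
  rw [zero_mul, Real.sqrt_zero] at h
  exact squeeze_zero_norm (fun q => Real.abs_le_sqrt (sq_avg_mul_le _ _ _)) h

/-- Averages of products are stable under perturbations which vanish in mean square. -/
lemma tendsto_avg_mul_of_sq {f f₀ g g₀ : α → ℕ → ℝ} {a b c : ℝ}
    (hf : Tendsto (fun q => avg (I q) fun i => (f q i - f₀ q i) ^ 2) l (𝓝 0))
    (hg : Tendsto (fun q => avg (I q) fun i => (g q i - g₀ q i) ^ 2) l (𝓝 0))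
    (hf₀ : Tendsto (fun q => avg (I q) fun i => f₀ q i ^ 2) l (𝓝 a))
    (hg₀ : Tendsto (fun q => avg (I q) fun i => g₀ q i ^ 2) l (𝓝 b))
    (h : Tendsto (fun q => avg (I q) fun i => f₀ q i * g₀ q i) l (𝓝 c)) :
    Tendsto (fun q => avg (I q) fun i => f q i * g q i) l (𝓝 c) := by
  -- `f g - f₀ g₀ = (f - f₀) g₀ + (g - g₀) f₀ + (f - f₀)(g - g₀)`, each term being small by
  -- Cauchy–Schwarz.
  have h1 := tendsto_avg_mul_zero hf hg₀
  have h2 := tendsto_avg_mul_zero hg hf₀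
  have h3 := tendsto_avg_mul_zero hf hg
  have h4 := ((h1.add h2).add h3).add h
  simp only [add_zero, zero_add, ← avg_add] at h4
  refine h4.congr fun q => ?_
  congr 1
  ext i
  ring

/-- Cauchy–Schwarz against the constant one, whose average is one only over a nonempty set of units.
-/
lemma tendsto_avg_of_sq {f f₀ : α → ℕ → ℝ} {c : ℝ} (hI : ∀ᶠ q in l, (I q).card ≠ 0)
    (hf : Tendsto (fun q => avg (I q) fun i => (f q i - f₀ q i) ^ 2) l (𝓝 0))
    (h : Tendsto (fun q => avg (I q) (f₀ q)) l (𝓝 c)) :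
    Tendsto (fun q => avg (I q) (f q)) l (𝓝 c) := by
  have h1 : Tendsto (fun q => avg (I q) fun _ => (1 : ℝ) ^ 2) l (𝓝 1) := by
    refine tendsto_const_nhds.congr' ?_
    filter_upwards [hI] with q hq
    rw [avg_const hq, one_pow]
  have h2 := (tendsto_avg_mul_zero hf h1).add h
  simp only [mul_one, zero_add, ← avg_add, sub_add_cancel] at h2
  exact h2

lemma sampleCov_apply {d : ℕ} {I : Finset ℕ} (hI : I.card ≠ 0) (f g : ℕ → Vec d) (i j : Fin d) :
    sampleCov I f g i j =
      avg I (fun k => f k i * g k j) - avg I (fun k => f k i) * avg I fun k => g k j := by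
  have e : ∀ k, (f k - avg I f) i * (g k - avg I g) j = f k i * g k j - (avg I f i * g k j +
      (avg I g j * f k i - avg I f i * avg I g j)) := fun k => by
    simp only [PiLp.sub_apply]
    ring
  rw [sampleCov, avg_matrix_apply]
  simp only [Matrix.vecMulVec_apply, e, avg_sub, avg_add, avg_mul_left, avg_const hI]
  simp only [avg_apply]
  ring

end SampleCovariance

/-! ### Functions learned from independent information. -/

section LearnedScore

variable {Ω 𝓩 : Type*} {m₀ : MeasurableSpace Ω} [mΩ : MeasurableSpace Ω] [MeasurableSpace 𝓩]
  {P : Measure Ω}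
  {μ : Measure 𝓩} [IsProbabilityMeasure P] {Z : ℕ → Ω → 𝓩}

/-- Entries are averages of products minus products of averages. The law of large numbers is applied
to products of coordinates, whose square integrability is a fourth moment condition. -/
lemma tendsto_sampleCov {d m : ℕ} {μ : Measure (Obs d m)} {Z : ℕ → Ω → Obs d m}
    (hZ : ∀ i, Measurable (Z i)) (hind : iIndepFun Z P)
    (hlaw : ∀ i, P.map (Z i) = μ) {I : ℕ → Finset ℕ} {K : ℝ} (hK : 0 ≤ K)
    (hI : ∀ᶠ n : ℕ in atTop, (n : ℝ) ≤ K * (I n).card) {u v : Obs d m → Vec d}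
    (hu : Measurable u) (hv : Measurable v) (hum : ∀ i, HasAllMoments μ fun z => u z i)
    (hvm : ∀ i, HasAllMoments μ fun z => v z i) {f g : ℕ × Ω → ℕ → Vec d}
    (hf : ∀ i, Tendsto (fun q => avg (I q.1) fun k => (f q k i - u (Z k q.2) i) ^ 2)
      (inProb P) (𝓝 0))
    (hg : ∀ i, Tendsto (fun q => avg (I q.1) fun k => (g q k i - v (Z k q.2) i) ^ 2)
      (inProb P) (𝓝 0)) :
    Tendsto (fun q => sampleCov (I q.1) (f q) (g q)) (inProb P) (𝓝 (covMat μ u v)) := by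
  have hμ : IsProbabilityMeasure μ := (hlaw 0) ▸ Measure.isProbabilityMeasure_map (hZ 0).aemeasurable
  have hcard : ∀ᶠ q : ℕ × Ω in inProb P, (I q.1).card ≠ 0 := by
    filter_upwards [tendsto_fst_inProb.eventually hI,
      tendsto_fst_inProb.eventually (eventually_gt_atTop 0)] with q hq hq0
    exact card_ne_zero_of_le_mul hq0 hq
  have lln : ∀ w : Obs d m → ℝ, Measurable w → HasAllMoments μ w →
      Tendsto (fun q : ℕ × Ω => avg (I q.1) fun k => w (Z k q.2)) (inProb P)
        (𝓝 (∫ z, w z ∂μ)) := fun w hw hwm =>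
    tendsto_avg_inProb hZ hind hlaw hw (hwm 2 (by simp)) hK hI
  rw [tendsto_matrix_iff]
  intro i j
  have hui : Measurable fun z => u z i := by fun_prop
  have hvj : Measurable fun z => v z j := by fun_prop
  have h1 := tendsto_avg_mul_of_sq (hf i) (hg j)
    (by simpa only [sq] using lln (fun z => u z i * u z i) (hui.mul hui) ((hum i).mul (hum i)))
    (by simpa only [sq] using lln (fun z => v z j * v z j) (hvj.mul hvj) ((hvm j).mul (hvm j)))
    (lln (fun z => u z i * v z j) (hui.mul hvj) ((hum i).mul (hvm j)))
  have h2 := tendsto_avg_of_sq hcard (hf i) (lln (fun z => u z i) hui (hum i))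
  have h3 := tendsto_avg_of_sq hcard (hg j) (lln (fun z => v z j) hvj (hvm j))
  rw [covMat, Matrix.of_apply, covariance_eq_sub (hum i 2 (by simp)) (hvm j 2 (by simp))]
  refine (h1.sub (h2.mul h3)).congr' ?_
  filter_upwards [hcard] with q hq
  rw [sampleCov_apply hq]

/-- Averages of the squares of functions learned from independent information. -/
lemma lintegral_enorm_avg_sq_le {𝓣 : Type*} [MeasurableSpace 𝓣] {T : Ω → 𝓣} (hT : Measurable T)
    (hZ : ∀ i, Measurable (Z i)) (hlaw : ∀ i, P.map (Z i) = μ) {J : Finset ℕ}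
    (hTZ : ∀ i ∈ J, IndepFun T (Z i) P) {h : 𝓣 × 𝓩 → ℝ} (hh : Measurable h) :
    ∫⁻ ω, ‖avg J (fun i => h (T ω, Z i ω) ^ 2)‖ₑ ∂P ≤
      ∫⁻ ω, ∫⁻ z, ‖h (T ω, z)‖ₑ ^ 2 ∂μ ∂P := by
  have hunit : ∀ i ∈ J, ∫⁻ ω, ‖h (T ω, Z i ω)‖ₑ ^ 2 ∂P =
      ∫⁻ ω, ∫⁻ z, ‖h (T ω, z)‖ₑ ^ 2 ∂μ ∂P := by
    intro i hi
    rw [lintegral_comp_indepFun hT (hZ i) (hTZ i hi) (G := fun p => ‖h p‖ₑ ^ 2) (by fun_prop)]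
    refine lintegral_congr fun ω => ?_
    rw [← hlaw i, lintegral_map (by fun_prop) (hZ i)]
  calc ∫⁻ ω, ‖avg J (fun i => h (T ω, Z i ω) ^ 2)‖ₑ ∂P
      ≤ ∫⁻ ω, ‖((J.card : ℝ))⁻¹‖ₑ * ∑ i ∈ J, ‖h (T ω, Z i ω)‖ₑ ^ 2 ∂P := by
        refine lintegral_mono fun ω => ?_
        rw [avg, enorm_smul]
        gcongr
        refine (enorm_sum_le _ _).trans (le_of_eq ?_)
        simp only [enorm_pow]
    _ = ‖((J.card : ℝ))⁻¹‖ₑ * ∑ _i ∈ J, ∫⁻ ω, ∫⁻ z, ‖h (T ω, z)‖ₑ ^ 2 ∂μ ∂P := by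
        rw [lintegral_const_mul _ (by fun_prop), lintegral_finsetSum _ (by fun_prop),
          Finset.sum_congr rfl hunit]
    _ ≤ 1 * ∫⁻ ω, ∫⁻ z, ‖h (T ω, z)‖ₑ ^ 2 ∂μ ∂P := by
        rw [Finset.sum_const, nsmul_eq_mul, ← mul_assoc]
        gcongr
        rw [← ofReal_norm, ← ENNReal.ofReal_natCast, ← ENNReal.ofReal_mul (norm_nonneg _)]
        refine ENNReal.ofReal_le_one.2 ?_
        rcases eq_or_ne (J.card : ℝ) 0 with h0 | h0
        · simp [h0]
        · simp [inv_mul_cancel₀ h0]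
    _ = _ := one_mul _

/-- The training information is a σ-algebra `m₀`. It becomes a random element as the identity map
into `Ω` equipped with `m₀`, so that Fubini can freeze the learned function. -/
lemma indepFun_id_of_indep {P : Measure Ω} {β : Type*} [mβ : MeasurableSpace β] {V : Ω → β}
    (h : Indep m₀ (MeasurableSpace.comap V inferInstance) P) : @IndepFun Ω Ω β mΩ m₀ _ id V P := by
  refine (@IndepFun_iff_Indep Ω Ω β mΩ m₀ mβ id V P).2 ?_
  rwa [MeasurableSpace.comap_id]

/-- The squared error, averaged over independent units, of a learned function. -/
lemma tendsto_avg_sq_learned {𝓕 : ℕ → MeasurableSpace Ω} (h𝓕 : ∀ n, 𝓕 n ≤ mΩ)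
    (hZ : ∀ i, Measurable (Z i)) (hlaw : ∀ i, P.map (Z i) = μ) {L : ℕ → Finset ℕ}
    (hindep : ∀ n, Indep (𝓕 n) (⨆ i ∈ L n, MeasurableSpace.comap (Z i) inferInstance) P)
    {h : ℕ → Ω → 𝓩 → ℝ}
    (hh : ∀ n, @Measurable (Ω × 𝓩) ℝ (@Prod.instMeasurableSpace _ _ (𝓕 n) _) _
      fun p => h n p.1 p.2)
    (hcons : Tendsto (fun n => ∫⁻ ω, ∫⁻ z, ‖h n ω z‖ₑ ^ 2 ∂μ ∂P) atTop (𝓝 0)) :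
    Tendsto (fun q : ℕ × Ω => avg (L q.1) fun i => h q.1 q.2 (Z i q.2) ^ 2)
      (inProb P) (𝓝 0) := by
  have hmeas : ∀ n i, Measurable fun ω => h n ω (Z i ω) ^ 2 := fun n i =>
    ((hh n).comp (@Measurable.prodMk Ω mΩ Ω 𝓩 (𝓕 n) _ id (Z i) (measurable_id'' (h𝓕 n))
      (hZ i))).pow_const 2
  refine tendsto_inProb_of_lintegral (k := 1) (fun n => ?_) ?_
  · exact (measurable_avg (I := L n) (hmeas n)).aemeasurable
  refine tendsto_of_tendsto_of_tendsto_of_le_of_le tendsto_const_nhds hcons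
    (fun _ => zero_le) fun n => ?_
  simp only [pow_one]
  exact @lintegral_enorm_avg_sq_le Ω 𝓩 mΩ _ P μ _ Z Ω (𝓕 n) id (measurable_id'' (h𝓕 n)) hZ hlaw
    (L n) (fun i hi => indepFun_id_of_indep (indep_of_indep_of_le_right (hindep n)
      (le_iSup₂_of_le i hi le_rfl))) (fun p => h n p.1 p.2) (hh n)

/-- Two-sample contrasts of learned functions whose error vanishes in mean square. -/
lemma tendsto_sqrt_learned_contrast {𝓕 : ℕ → MeasurableSpace Ω} (h𝓕 : ∀ n, 𝓕 n ≤ mΩ)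
    (hZ : ∀ i, Measurable (Z i)) (hind : iIndepFun Z P) (hlaw : ∀ i, P.map (Z i) = μ)
    {L U : ℕ → Finset ℕ} (hdisj : ∀ n, Disjoint (L n) (U n))
    (hindep : ∀ n, Indep (𝓕 n)
      (⨆ i ∈ L n ∪ U n, MeasurableSpace.comap (Z i) inferInstance) P)
    {h : ℕ → Ω → 𝓩 → ℝ}
    (hh : ∀ n, @Measurable (Ω × 𝓩) ℝ (@Prod.instMeasurableSpace _ _ (𝓕 n) _) _
      fun p => h n p.1 p.2)
    {K K' : ℝ} (hK : 0 ≤ K) (hK' : 0 ≤ K') (hL : ∀ᶠ n : ℕ in atTop, (n : ℝ) ≤ K * (L n).card)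
    (hU : ∀ᶠ n : ℕ in atTop, (n : ℝ) ≤ K' * (U n).card)
    (hcons : Tendsto (fun n => ∫⁻ ω, ∫⁻ z, ‖h n ω z‖ₑ ^ 2 ∂μ ∂P) atTop (𝓝 0)) :
    Tendsto (fun q : ℕ × Ω => √(q.1 : ℝ) * (avg (L q.1) (fun i => h q.1 q.2 (Z i q.2)) -
      avg (U q.1) fun i => h q.1 q.2 (Z i q.2))) (inProb P) (𝓝 0) := by
  classical
  have hmeas : ∀ n i, Measurable fun ω => h n ω (Z i ω) := fun n i =>
    (hh n).comp (@Measurable.prodMk Ω mΩ Ω 𝓩 (𝓕 n) _ id (Z i) (measurable_id'' (h𝓕 n)) (hZ i))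
  refine tendsto_inProb_of_lintegral (k := 2) (fun n => ?_) ?_
  · exact (((measurable_avg (I := L n) (hmeas n)).sub
      (measurable_avg (I := U n) (hmeas n))).const_mul √(n : ℝ)).aemeasurable
  have hlim : Tendsto (fun n => ENNReal.ofReal (K + K') *
      ∫⁻ ω, ∫⁻ z, ‖h n ω z‖ₑ ^ 2 ∂μ ∂P) atTop (𝓝 0) := by
    simpa using ENNReal.Tendsto.const_mul hcons (Or.inr ENNReal.ofReal_ne_top)
  refine tendsto_of_tendsto_of_tendsto_of_le_of_le' tendsto_const_nhds hlim
    (Eventually.of_forall fun _ => zero_le) ?_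
  filter_upwards [hL, hU, eventually_gt_atTop 0] with n hLn hUn hn
  -- The contrast as one weighted sum over the disjoint union: the weights sum to zero, and their
  -- squares to at most `K + K'`.
  set a : ℕ → ℝ := fun i => if i ∈ L n then √n * ((L n).card : ℝ)⁻¹
    else -(√n * ((U n).card : ℝ)⁻¹) with ha
  have hsplit : ∀ F : ℕ → ℝ → ℝ, ∑ i ∈ L n ∪ U n, F i (a i) =
      ∑ i ∈ L n, F i (√n * ((L n).card : ℝ)⁻¹) + ∑ i ∈ U n, F i (-(√n * ((U n).card : ℝ)⁻¹)) := by
    intro F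
    rw [Finset.sum_union (hdisj n)]
    congr 1
    · exact Finset.sum_congr rfl fun i hi => by simp [ha, hi]
    · exact Finset.sum_congr rfl fun i hi => by
        simp [ha, Finset.disjoint_right.1 (hdisj n) hi]
  have hLc : ((L n).card : ℝ) ≠ 0 := by exact_mod_cast card_ne_zero_of_le_mul hn hLn
  have hUc : ((U n).card : ℝ) ≠ 0 := by exact_mod_cast card_ne_zero_of_le_mul hn hUn
  have ha0 : ∑ i ∈ L n ∪ U n, a i = 0 := by
    rw [hsplit fun _ x => x, Finset.sum_const, Finset.sum_const]
    simp only [nsmul_eq_mul]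
    field_simp
    ring
  have hTZ : @IndepFun Ω Ω _ mΩ (𝓕 n) _ id
      (fun ω (i : (L n ∪ U n : Finset ℕ)) => Z i ω) P := by
    refine indepFun_id_of_indep (indep_of_indep_of_le_right (hindep n) ?_)
    rw [MeasurableSpace.pi, MeasurableSpace.comap_iSup]
    refine iSup_le fun i => ?_
    rw [MeasurableSpace.comap_comp]
    exact le_iSup₂_of_le i.1 i.2 le_rfl
  have h1 := @lintegral_enorm_sq_contrast_le Ω 𝓩 mΩ _ P μ _ Z Ω (𝓕 n) id (measurable_id'' (h𝓕 n))
    hZ hind hlaw _ hTZ (fun p => h n p.1 p.2) (hh n) a ha0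
  simp only [id] at h1
  refine le_trans (le_of_eq (lintegral_congr fun ω => ?_)) (h1.trans ?_)
  · rw [hsplit fun i x => x * h n ω (Z i ω)]
    congr 2
    simp only [neg_mul, Finset.sum_neg_distrib, mul_assoc, ← Finset.mul_sum, avg, smul_eq_mul]
    ring
  · gcongr
    rw [hsplit fun _ x => x ^ 2]
    simp only [neg_sq]
    exact add_le_add (sum_sq_sqrt_mul_inv_card_le hK hLn) (sum_sq_sqrt_mul_inv_card_le hK' hUn)

end LearnedScore

/-! ### RePPI: folds, initial estimates and the limiting weight matrix. -/

lemma card_smul_avg {V : Type*} [AddCommGroup V] [Module ℝ V] (I : Finset ℕ) (f : ℕ → V) :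
    (I.card : ℝ) • avg I f = ∑ i ∈ I, f i := by
  rcases eq_or_ne (I.card : ℝ) 0 with h | h
  · have : I = ∅ := by simpa using h
    simp [this]
  · rw [avg, smul_smul, mul_inv_cancel₀ h, one_smul]

lemma avg_le_avg {I : Finset ℕ} {f g : ℕ → ℝ} (h : ∀ i ∈ I, f i ≤ g i) : avg I f ≤ avg I g := by
  rw [avg_real, avg_real]
  exact Finset.sum_le_sum fun i hi => mul_le_mul_of_nonneg_left (h i hi) (by positivity)

lemma avg_sum {ι : Type*} (s : Finset ι) (I : Finset ℕ) (f : ι → ℕ → ℝ) :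
    avg I (fun i => ∑ j ∈ s, f j i) = ∑ j ∈ s, avg I (f j) := by
  simp only [avg_real, Finset.mul_sum]
  exact Finset.sum_comm

/-- The gradient is affine in the parameter, so replacing the initial estimate by the target costs a
data factor times an error common to all units. -/
lemma gradLoss_sub_apply {d : ℕ} (t θ x : Vec d) (y : ℝ) (i : Fin d) :
    gradLoss t x y i - gradLoss θ x y i = ∑ j, gram x i j * (t - θ) j := by
  have h : inner ℝ x t - inner ℝ x θ = ∑ j, x j * (t - θ) j := by
    rw [← inner_sub_right, PiLp.inner_apply]
    simp [mul_comm]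
  have h2 : ∑ j, gram x i j * (t - θ) j = 2 * x i * ∑ j, x j * (t - θ) j := by
    rw [Finset.mul_sum]
    exact Finset.sum_congr rfl fun j _ => by rw [gram, Matrix.of_apply]; ring
  rw [h2, ← h, gradLoss_eq, gradLoss_eq]
  simp only [PiLp.smul_apply, smul_eq_mul]
  ring

/-- Stated over an abstract `𝓣` in order to be applied to `Ω` with the training σ-algebra instead of
the ambient one. -/
lemma measurable_learned_error {𝓣 𝓩 E : Type*} [MeasurableSpace 𝓣] [MeasurableSpace 𝓩]
    [MeasurableSpace E] {d : ℕ} {F : 𝓣 → E → Vec d} (hF : Measurable fun p : 𝓣 × E => F p.1 p.2)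
    {φ : 𝓩 → E} (hφ : Measurable φ) {s : E → Vec d} (hs : Measurable s) (j : Fin d) :
    Measurable fun p : 𝓣 × 𝓩 => (F p.1 (φ p.2) - s (φ p.2)) j := by
  have h1 : Measurable fun p : 𝓣 × 𝓩 => F p.1 (φ p.2) :=
    hF.comp (measurable_fst.prodMk (hφ.comp measurable_snd))
  fun_prop

section RePPI

variable {Ω : Type*} [mΩ : MeasurableSpace Ω] {P : Measure Ω} {d m : ℕ}
  {SX : Matrix (Fin d) (Fin d) ℝ} {SW : Matrix (Fin m) (Fin m) ℝ} {σ : ℝ≥0}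
  {θ θt : Vec d} {γ γt : Vec m} {Y Yhat : Obs d m → ℝ} {Z : ℕ → Ω → Obs d m} {N : ℕ → ℕ} {r : ℝ}

/-- An instance of `Cov(u, E[u | 𝓖]) = Cov(E[u | 𝓖])`, here obtained from the choice of `ρ`. It
makes the population weight matrix the identity. -/
lemma covMat_linScore_recalibration (hSX : SX.PosSemidef) (hSW : SW.PosSemidef)
    (hγt : bform SW γt γt ≠ 0) :
    covMat (gaussianLaw SX SW σ) (linScore 0 γ 1)
        (linScore 0 (recalibration SW γ γt • γt) 0) =
      covMat (gaussianLaw SX SW σ) (linScore 0 (recalibration SW γ γt • γt) 0)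
        (linScore 0 (recalibration SW γ γt • γt) 0) := by
  set ρ := recalibration SW γ γt with hρ
  have hρ' : ρ * bform SW γt γt = bform SW γ γt := by
    rw [hρ, recalibration, div_mul_cancel₀ _ hγt]
  rw [covMat_linScore hSX hSW]
  ext i j
  rw [covMat, Matrix.of_apply, covariance_eq_sub (hasAllMoments_linScore _ _ _ i 2 (by simp))
    (hasAllMoments_linScore _ _ _ j 2 (by simp)), integral_linScore hSX hSW,
    integral_linScore hSX hSW]
  -- Polarization. The product is symmetric in `i` and `j` because both scores are scalar multiples
  -- of `x`.
  have e : ∀ z : Obs d m, linScore 0 γ 1 z i * linScore 0 (ρ • γt) 0 z j =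
      (1 / 4) * (linScore 0 (γ + ρ • γt) 1 z i * linScore 0 (γ + ρ • γt) 1 z j -
        linScore 0 (γ - ρ • γt) 1 z i * linScore 0 (γ - ρ • γt) 1 z j) := by
    intro z
    simp only [linScore_apply, linForm_apply, inner_add_right, inner_sub_right, inner_zero_right]
    ring
  have hint : ∀ g : Vec m, Integrable (fun z => linScore (0 : Vec d) g 1 z i *
      linScore (0 : Vec d) g 1 z j) (gaussianLaw SX SW σ) := fun g =>
    ((hasAllMoments_linScore _ _ _ i).mul (hasAllMoments_linScore _ _ _ j)).integrable
  simp only [Pi.mul_apply, e]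
  rw [integral_const_mul, integral_sub (hint _) (hint _), integral_linScore_mul hSX hSW,
    integral_linScore_mul hSX hSW]
  simp only [modelForm, bform_add_left, bform_add_right, bform_sub_left, bform_sub_right,
    bform_smul_left, bform_smul_right, bform_comm hSW.1 γt γ, bform_zero_left]
  simp [hρ']
  ring

/-- The matrix is `4 ρ² (γ̃ᵀΣ_Wγ̃) Σ_X`; the condition `γᵀΣ_Wγ̃ ≠ 0` enters here, as `ρ ≠ 0`. -/
lemma det_covMat_linScore_ne_zero (hSX : SX.PosDef) (hSW : SW.PosSemidef)
    (hγt : bform SW γt γt ≠ 0) (hγ : bform SW γ γt ≠ 0) :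
    (covMat (gaussianLaw SX SW σ) (linScore 0 (recalibration SW γ γt • γt) 0)
        (linScore 0 (recalibration SW γ γt • γt) 0)).det ≠ 0 := by
  have hρ : recalibration SW γ γt ≠ 0 := div_ne_zero hγ hγt
  rw [covMat_linScore hSX.posSemidef hSW]
  simp only [modelForm, bform_smul_left, bform_smul_right, bform_zero_left, WithLp.ofLp_zero,
    Matrix.mulVec_zero, Matrix.vecMulVec_zero, add_zero, zero_add, smul_smul]
  rw [Matrix.det_smul]
  refine mul_ne_zero (pow_ne_zero _ ?_) hSX.det_pos.ne'
  simp [hρ, hγt]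

namespace PPI.RePPIRun

variable (R : RePPIRun P Y Yhat Z N)

lemma fold_subset (n : ℕ) (k : Fin 3) : R.fold n k ⊆ Finset.range n := by
  rw [← R.fold_union n]
  exact Finset.subset_biUnion_of_mem (fun j => R.fold n j) (Finset.mem_univ k)

/-- The constant `5` is the worst ratio of `n` to the rounded-down `n / 3` for `n ≥ 3`, attained at
`n = 5`. -/
lemma eventually_le_mul_card_fold (k : Fin 3) :
    ∀ᶠ n : ℕ in atTop, (n : ℝ) ≤ 5 * (R.fold n k).card := by
  filter_upwards [eventually_ge_atTop 3] with n hn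
  have := (R.fold_even n k).1
  exact_mod_cast (by omega : n ≤ 5 * (R.fold n k).card)

lemma tendsto_fold_weight (k : Fin 3) :
    Tendsto (fun n : ℕ => ((R.fold n k).card : ℝ) / n) atTop (𝓝 (1 / 3)) := by
  rw [← tendsto_sub_nhds_zero_iff]
  refine squeeze_zero_norm' ?_ tendsto_inv_atTop_nhds_zero_nat
  filter_upwards [eventually_gt_atTop 0] with n hn
  obtain ⟨h1, h2⟩ := R.fold_even n k
  have h3 : n ≤ 3 * (R.fold n k).card + 2 := by omega
  have h4 : 3 * (R.fold n k).card ≤ n + 3 := by omega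
  have h3' : (n : ℝ) ≤ 3 * (R.fold n k).card + 2 := by exact_mod_cast h3
  have h4' : 3 * ((R.fold n k).card : ℝ) ≤ n + 3 := by exact_mod_cast h4
  have hn' : (0 : ℝ) < n := by exact_mod_cast hn
  have e : ((R.fold n k).card : ℝ) / n - 1 / 3 = (3 * (R.fold n k).card - n) / 3 * (n : ℝ)⁻¹ := by
    field_simp
  rw [e, norm_mul, norm_inv, Real.norm_natCast]
  refine mul_le_of_le_one_left (by positivity) ?_
  rw [Real.norm_eq_abs, abs_le]
  constructor <;> linarith

lemma sum_fold_weight {n : ℕ} (hn : 0 < n) : ∑ k, ((R.fold n k).card : ℝ) / n = 1 := by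
  have h : ∑ k, (R.fold n k).card = n := by
    rw [← Finset.card_biUnion fun j _ k _ hjk => R.fold_disjoint n hjk, R.fold_union,
      Finset.card_range]
  rw [← Finset.sum_div, ← Nat.cast_sum, h]
  exact div_self (by positivity)

lemma sum_fold_weight_smul_avg {V : Type*} [AddCommGroup V] [Module ℝ V] (n : ℕ) (f : ℕ → V) :
    ∑ k, (((R.fold n k).card : ℝ) / n) • avg (R.fold n k) f = avg (Finset.range n) f := by
  simp only [div_eq_inv_mul, mul_smul, card_smul_avg]
  rw [← Finset.smul_sum, ← Finset.sum_biUnion fun j _ k _ hjk => R.fold_disjoint n hjk,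
    R.fold_union, avg, Finset.card_range]

variable [IsProbabilityMeasure P]

/-- The initial estimates are consistent. -/
lemma tendsto_initial (hSX : SX.PosDef) (hSW : SW.PosSemidef)
    (hY : ∀ z, Y z = inner ℝ z.2.1 γ + inner ℝ z.1 θ + z.2.2)
    (hZ : ∀ i, Measurable (Z i)) (hind : iIndepFun Z P)
    (hlaw : ∀ i, P.map (Z i) = gaussianLaw SX SW σ) (k : Fin 3) :
    Tendsto (fun q : ℕ × Ω => R.initial q.1 k q.2) (inProb P) (𝓝 θ) := by
  have hI := R.eventually_le_mul_card_fold (-k)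
  have hA := tendsto_avg_gram hZ hind hlaw hasAllMoments_gram (H := (2 : ℝ) • SX)
    (integral_gram hSX.posSemidef hSW) (by norm_num) hI
  have hPD : ((2 : ℝ) • SX).PosDef := hSX.smul two_pos
  have hpos := hPD.eventually_posDef hA fun q => isHermitian_avg_gram _ _
  have hB : Tendsto (fun q : ℕ × Ω => avg (R.fold q.1 (-k)) fun i => linScore 0 γ 1 (Z i q.2))
      (inProb P) (𝓝 0) := by
    rw [tendsto_vec_iff]
    intro i
    have h := tendsto_avg_inProb hZ hind hlaw (f := fun z => linScore (0 : Vec d) γ 1 z i)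
      (by have := measurable_linScore (0 : Vec d) γ 1; fun_prop)
      (hasAllMoments_linScore _ _ _ i 2 (by simp)) (by norm_num) hI
    rw [integral_linScore hSX.posSemidef hSW] at h
    simpa [avg_apply] using h
  -- The linear system lemma without the factor `√n` and with `C = 0` gives plain consistency.
  have h := tendsto_solution_sub (det_two_smul_ne_zero hSX) hA
    (T := fun q => R.initial q.1 k q.2 - θ)
    (B := fun q => -avg (R.fold q.1 (-k)) fun i => linScore 0 γ 1 (Z i q.2)) (C := fun _ => 0)
    ?_ (by simpa using hB.neg) fun i η _ => ⟨0, by simp⟩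
  · rw [← tendsto_sub_nhds_zero_iff]
    simpa using h
  · filter_upwards [hpos, eventually_inProb_of_ae
      (p := fun q => IsArgmin (fun t => avg (R.fold q.1 (-k)) fun i =>
        sqLoss t (Z i q.2).1 (Y (Z i q.2))) (R.initial q.1 k q.2))
      fun n => R.initial_argmin n k] with q hq hmin
    have hquad := HasQuadExpansion.avg (θ := θ) (R.fold q.1 (-k)) fun i =>
      hasQuadExpansion_sqLoss θ (Z i q.2).1 (Y (Z i q.2))
    have := hquad.mulVec_sub_eq_neg hq hmin
    simpa only [gradLoss_outcome hY, WithLp.ofLp_neg] using this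

/-- The gradients at the initial estimate approximate the gradients at the target. -/
lemma tendsto_avg_sq_gradLoss_initial (hSX : SX.PosDef) (hSW : SW.PosSemidef)
    (hY : ∀ z, Y z = inner ℝ z.2.1 γ + inner ℝ z.1 θ + z.2.2)
    (hZ : ∀ i, Measurable (Z i)) (hind : iIndepFun Z P)
    (hlaw : ∀ i, P.map (Z i) = gaussianLaw SX SW σ) (k : Fin 3) {I : ℕ → Finset ℕ} {K : ℝ}
    (hK : 0 ≤ K) (hI : ∀ᶠ n : ℕ in atTop, (n : ℝ) ≤ K * (I n).card) (i : Fin d) :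
    Tendsto (fun q : ℕ × Ω => avg (I q.1) fun l =>
      (gradLoss (R.initial q.1 k q.2) (Z l q.2).1 (Y (Z l q.2)) i -
        linScore 0 γ 1 (Z l q.2) i) ^ 2) (inProb P) (𝓝 0) := by
  have hθ := R.tendsto_initial hSX hSW hY hZ hind hlaw k
  have h1 : Tendsto (fun q : ℕ × Ω => ∑ j, avg (I q.1) fun l => gram (Z l q.2).1 i j ^ 2)
      (inProb P) (𝓝 (∑ j, ∫ z, gram z.1 i j ^ 2 ∂gaussianLaw SX SW σ)) := by
    refine tendsto_finsetSum _ fun j _ => tendsto_avg_inProb hZ hind hlaw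
      (f := fun z => gram z.1 i j ^ 2) ?_ ?_ hK hI
    · simp only [gram, Matrix.of_apply]
      fun_prop
    · simpa only [sq] using ((hasAllMoments_gram i j).mul (hasAllMoments_gram i j)) 2 (by simp)
  have h2 : Tendsto (fun q : ℕ × Ω => ∑ j, ((R.initial q.1 k q.2 - θ) j) ^ 2) (inProb P)
      (𝓝 0) := by
    have h3 : ∀ j, Tendsto (fun q : ℕ × Ω => ((R.initial q.1 k q.2 - θ) j) ^ 2) (inProb P)
        (𝓝 0) := fun j => by
      simpa using ((tendsto_vec_iff.1 (tendsto_sub_nhds_zero_iff.2 hθ)) j).pow 2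
    simpa using tendsto_finsetSum Finset.univ fun j _ => h3 j
  have h3 := h1.mul h2
  rw [mul_zero] at h3
  -- By Cauchy–Schwarz the error of the initial estimate factors out of the average over units.
  -- Hence no independence between that estimate and the units averaged is needed.
  refine squeeze_zero (fun q => ?_) (fun q => ?_) h3
  · rw [avg_real]
    positivity
  · rw [← avg_sum, mul_comm, ← avg_mul_left]
    refine avg_le_avg fun l _ => ?_
    rw [← gradLoss_outcome hY, gradLoss_sub_apply, mul_comm]
    exact Finset.sum_mul_sq_le_sq_mul_sq _ _ _

end PPI.RePPIRun

end RePPI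

/-! ### Cross-fitting: linearization of the fold estimates and their aggregation. -/

section CrossFitting

variable {Ω : Type*} [mΩ : MeasurableSpace Ω] {P : Measure Ω} {d m : ℕ}
  {SX : Matrix (Fin d) (Fin d) ℝ} {SW : Matrix (Fin m) (Fin m) ℝ} {σ : ℝ≥0}
  {θ θt : Vec d} {γ γt : Vec m} {Y Yhat : Obs d m → ℝ} {Z : ℕ → Ω → Obs d m} {N : ℕ → ℕ} {r : ℝ}

namespace PPI.RePPIRun

/-- The learned function at unit `i`. -/
noncomputable def learned (R : RePPIRun P Y Yhat Z N) (k : Fin 3) (q : ℕ × Ω) (i : ℕ) : Vec d :=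
  R.score q.1 k q.2 ((Z i q.2).1, Yhat (Z i q.2))

/-- The estimated weight matrix. -/
noncomputable def weight (R : RePPIRun P Y Yhat Z N) (k : Fin 3) (q : ℕ × Ω) :
    Matrix (Fin d) (Fin d) ℝ :=
  sampleCov (R.fold q.1 (2 - k))
      (fun i => gradLoss (R.initial q.1 k q.2) (Z i q.2).1 (Y (Z i q.2))) (R.learned k q) *
    (sampleCov (R.fold q.1 (2 - k)) (R.learned k q) (R.learned k q))⁻¹

variable (R : RePPIRun P Y Yhat Z N) {s : Vec d × ℝ → Vec d}

lemma tendsto_lintegral_coord {μ : Measure (Obs d m)} (hcons : R.ScoreConsistent μ s)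
    (k : Fin 3) (j : Fin d) :
    Tendsto (fun n => ∫⁻ ω, ∫⁻ z,
      ‖(R.score n k ω (z.1, Yhat z) - s (z.1, Yhat z)) j‖ₑ ^ 2 ∂μ ∂P) atTop (𝓝 0) :=
  tendsto_of_tendsto_of_tendsto_of_le_of_le tendsto_const_nhds (hcons k) (fun _ => zero_le)
    fun n => lintegral_mono fun ω => lintegral_mono fun z => by
      gcongr
      exact PiLp.enorm_apply_le _ j

lemma measurable_score_error (hYhat : Measurable Yhat) (hs : Measurable s) (n : ℕ) (k : Fin 3)
    (j : Fin d) :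
    @Measurable (Ω × Obs d m) ℝ (@Prod.instMeasurableSpace _ _ (R.training n k) _) _
      fun p => (R.score n k p.1 (p.2.1, Yhat p.2) - s (p.2.1, Yhat p.2)) j :=
  @measurable_learned_error Ω (Obs d m) (Vec d × ℝ) (R.training n k) _ _ d (R.score n k)
    (R.score_measurable n k) (fun z => (z.1, Yhat z)) (measurable_fst.prodMk hYhat) s hs j

lemma disjoint_fold_unlabelled (n : ℕ) (k : Fin 3) :
    Disjoint (R.fold n k) (unlabelled N n) :=
  Finset.disjoint_of_subset_left (R.fold_subset n k) (disjoint_range_unlabelled N n)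

variable [IsProbabilityMeasure P]

lemma tendsto_avg_sq_learned_sub {μ : Measure (Obs d m)} (hYhat : Measurable Yhat)
    (hs : Measurable s) (hcons : R.ScoreConsistent μ s) (hZ : ∀ i, Measurable (Z i))
    (hlaw : ∀ i, P.map (Z i) = μ) (k : Fin 3) (j : Fin d) :
    Tendsto (fun q : ℕ × Ω => avg (R.fold q.1 (2 - k)) fun i =>
      (R.learned k q i j - s ((Z i q.2).1, Yhat (Z i q.2)) j) ^ 2) (inProb P) (𝓝 0) :=
  tendsto_avg_sq_learned (𝓕 := fun n => R.training n k) (L := fun n => R.fold n (2 - k))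
    (h := fun n ω z => (R.score n k ω (z.1, Yhat z) - s (z.1, Yhat z)) j)
    (fun n => R.training_le n k) hZ hlaw
    (fun n => indep_of_indep_of_le_right (R.training_indep n k)
      (biSup_mono fun _ hi => Finset.mem_union_left _ hi))
    (fun n => R.measurable_score_error hYhat hs n k j) (R.tendsto_lintegral_coord hcons k j)

/-- Given the training data, the contrast of the score error has mean zero and variance of order
`1/n` times its mean square, so the factor `√n` is absorbed without any rate of convergence for the
learned score. -/
lemma tendsto_sqrt_learned_contrast_sub {μ : Measure (Obs d m)} (hYhat : Measurable Yhat)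
    (hs : Measurable s) (hcons : R.ScoreConsistent μ s) (hZ : ∀ i, Measurable (Z i))
    (hind : iIndepFun Z P) (hlaw : ∀ i, P.map (Z i) = μ) (hN : ∀ n, 0 < N n)
    (hr : Tendsto (fun n : ℕ => (n : ℝ) / (N n : ℝ)) atTop (𝓝 r)) (k : Fin 3) (j : Fin d) :
    Tendsto (fun q : ℕ × Ω => √(q.1 : ℝ) * (avg (R.fold q.1 (2 - k)) (R.learned k q) -
        avg (unlabelled N q.1) (R.learned k q)) j -
      √(q.1 : ℝ) * (avg (R.fold q.1 (2 - k)) (fun i => s ((Z i q.2).1, Yhat (Z i q.2))) -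
        avg (unlabelled N q.1) fun i => s ((Z i q.2).1, Yhat (Z i q.2))) j)
      (inProb P) (𝓝 0) := by
  have hr0 := ratio_limit_nonneg hr
  have h := tendsto_sqrt_learned_contrast (𝓕 := fun n => R.training n k)
    (L := fun n => R.fold n (2 - k)) (U := unlabelled N)
    (h := fun n ω z => (R.score n k ω (z.1, Yhat z) - s (z.1, Yhat z)) j)
    (fun n => R.training_le n k) hZ hind hlaw (fun n => R.disjoint_fold_unlabelled n _)
    (fun n => R.training_indep n k) (fun n => R.measurable_score_error hYhat hs n k j)
    (by norm_num : (0 : ℝ) ≤ 5) (by positivity) (R.eventually_le_mul_card_fold (2 - k))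
    (eventually_le_mul_card hN hr) (R.tendsto_lintegral_coord hcons k j)
  refine h.congr fun q => ?_
  simp only [PiLp.sub_apply, avg_apply, avg_sub, learned]
  ring

/-- The estimated weight matrices are consistent for the identity matrix. -/
lemma tendsto_weight (hSX : SX.PosDef) (hSW : SW.PosSemidef) (hγt : bform SW γt γt ≠ 0)
    (hγ : bform SW γ γt ≠ 0) (hY : ∀ z, Y z = inner ℝ z.2.1 γ + inner ℝ z.1 θ + z.2.2)
    (hYhat : Measurable Yhat) (hs : Measurable s)
    (hsae : (fun z : Obs d m => s (z.1, Yhat z)) =ᵐ[gaussianLaw SX SW σ]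
      linScore 0 (recalibration SW γ γt • γt) 0)
    (hcons : R.ScoreConsistent (gaussianLaw SX SW σ) s)
    (hZ : ∀ i, Measurable (Z i)) (hind : iIndepFun Z P)
    (hlaw : ∀ i, P.map (Z i) = gaussianLaw SX SW σ) (k : Fin 3) :
    Tendsto (R.weight k) (inProb P) (𝓝 1) := by
  have hI := R.eventually_le_mul_card_fold (2 - k)
  have hsm : Measurable fun z : Obs d m => s (z.1, Yhat z) :=
    hs.comp (measurable_fst.prodMk hYhat)
  have hmom : ∀ j, HasAllMoments (gaussianLaw SX SW σ)
      fun z : Obs d m => s (z.1, Yhat z) j := fun j =>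
    (hasAllMoments_linScore 0 (recalibration SW γ γt • γt) 0 j).congr
      (hsae.mono fun z hz => by simp only [hz])
  have hlearn := R.tendsto_avg_sq_learned_sub hYhat hs hcons hZ hlaw k
  have hgrad := R.tendsto_avg_sq_gradLoss_initial hSX hSW hY hZ hind hlaw k
    (by norm_num : (0 : ℝ) ≤ 5) hI
  have h1 := tendsto_sampleCov hZ hind hlaw (by norm_num : (0 : ℝ) ≤ 5) hI
    (measurable_linScore 0 γ 1) hsm (hasAllMoments_linScore 0 γ 1) hmom hgrad hlearn
  have h2 := tendsto_sampleCov hZ hind hlaw (by norm_num : (0 : ℝ) ≤ 5) hI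
    hsm hsm hmom hmom hlearn hlearn
  -- Both sample covariances now have the same invertible limit, so their quotient tends to the
  -- identity.
  rw [covMat_congr EventuallyEq.rfl hsae, covMat_linScore_recalibration hSX.posSemidef hSW hγt]
    at h1
  rw [covMat_congr hsae hsae] at h2
  have hdet := det_covMat_linScore_ne_zero (σ := σ) hSX hSW hγt hγ
  have h := h1.mul (tendsto_matrix_inv hdet h2)
  rw [Matrix.mul_nonsing_inv _ hdet.isUnit] at h
  exact h

/-- The estimates of the single fits are asymptotically linear in the score contrast. -/
lemma tendsto_foldEst_add_contrast (hSX : SX.PosDef) (hSW : SW.PosSemidef)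
    (hγt : bform SW γt γt ≠ 0) (hγ : bform SW γ γt ≠ 0)
    (hY : ∀ z, Y z = inner ℝ z.2.1 γ + inner ℝ z.1 θ + z.2.2)
    (hYhat : Measurable Yhat) (hs : Measurable s)
    (hsae : (fun z : Obs d m => s (z.1, Yhat z)) =ᵐ[gaussianLaw SX SW σ]
      linScore 0 (recalibration SW γ γt • γt) 0)
    (hcons : R.ScoreConsistent (gaussianLaw SX SW σ) s)
    (hZ : ∀ i, Measurable (Z i)) (hind : iIndepFun Z P)
    (hlaw : ∀ i, P.map (Z i) = gaussianLaw SX SW σ) (hN : ∀ n, 0 < N n)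
    (hr : Tendsto (fun n : ℕ => (n : ℝ) / (N n : ℝ)) atTop (𝓝 r)) (k : Fin 3)
    (hbdd : ∀ i, BddInProb P fun q => contrast Z (linScore 0 γ 1)
      (fun z => s (z.1, Yhat z)) (1 + r)⁻¹ (fun n => R.fold n (2 - k)) (unlabelled N) q i) :
    Tendsto (fun q : ℕ × Ω => √(q.1 : ℝ) • (R.foldEst q.1 k q.2 - θ) +
      Matrix.toEuclideanCLM (𝕜 := ℝ) ((2 : ℝ) • SX)⁻¹
        (contrast Z (linScore 0 γ 1) (fun z => s (z.1, Yhat z)) (1 + r)⁻¹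
          (fun n => R.fold n (2 - k)) (unlabelled N) q)) (inProb P) (𝓝 0) := by
  have hr0 := ratio_limit_nonneg hr
  have hI := R.eventually_le_mul_card_fold (2 - k)
  have hsm : Measurable fun z : Obs d m => s (z.1, Yhat z) :=
    hs.comp (measurable_fst.prodMk hYhat)
  have hs2 : MemLp (fun z : Obs d m => s (z.1, Yhat z)) 2 (gaussianLaw SX SW σ) :=
    (memLp_congr_ae hsae).2 (memLp_linScore _ _ _)
  have hA := tendsto_avg_gram hZ hind hlaw hasAllMoments_gram (H := (2 : ℝ) • SX)
    (integral_gram hSX.posSemidef hSW) (by norm_num) hI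
  have hPD : ((2 : ℝ) • SX).PosDef := hSX.smul two_pos
  have hpos := hPD.eventually_posDef hA fun q => isHermitian_avg_gram _ _
  set c : ℕ × Ω → ℝ := fun q => (1 + (q.1 : ℝ) / N q.1)⁻¹ with hcdef
  have hc : Tendsto c (inProb P) (𝓝 (1 + r)⁻¹) :=
    ((hr.const_add 1).inv₀ (by positivity)).comp tendsto_fst_inProb
  have hW : Tendsto (fun q => c q • R.weight k q) (inProb P) (𝓝 ((1 + r)⁻¹ • 1)) :=
    hc.smul (R.tendsto_weight hSX hSW hγt hγ hY hYhat hs hsae hcons hZ hind hlaw k)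
  set Δ' : ℕ × Ω → Vec d := fun q => avg (R.fold q.1 (2 - k)) (R.learned k q) -
    avg (unlabelled N q.1) (R.learned k q) with hΔ'
  have h := tendsto_solution_sub (det_two_smul_ne_zero hSX) hA
    (T := fun q => √(q.1 : ℝ) • (R.foldEst q.1 k q.2 - θ))
    (B := fun q => -(√(q.1 : ℝ) • (avg (R.fold q.1 (2 - k)) (fun i => linScore 0 γ 1 (Z i q.2)) -
        c q • Matrix.toEuclideanCLM (𝕜 := ℝ) (R.weight k q) (Δ' q))))
    (C := fun q => -contrast Z (linScore 0 γ 1) (fun z => s (z.1, Yhat z)) (1 + r)⁻¹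
      (fun n => R.fold n (2 - k)) (unlabelled N) q) ?_ ?_ ?_
  · refine h.congr fun q => ?_
    rw [map_neg, sub_neg_eq_add]
  · filter_upwards [hpos, eventually_inProb_of_ae
      (p := fun q => IsArgmin (ppiObjective Y Yhat (fun i => Z i q.2) (R.fold q.1 (2 - k))
        (unlabelled N q.1) fun t x y => c q *
          (t.ofLp ⬝ᵥ (R.weight k q *ᵥ (R.score q.1 k q.2 (x, y)).ofLp)))
        (R.foldEst q.1 k q.2))
      fun n => R.foldEst_argmin n k] with q hq hmin
    set L := (Matrix.toEuclideanCLM (𝕜 := ℝ) (R.weight k q)) with hL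
    have hquad := (HasQuadExpansion.avg (θ := θ) (R.fold q.1 (2 - k)) fun i =>
        hasQuadExpansion_sqLoss θ (Z i q.2).1 (Y (Z i q.2))).sub
      (((HasQuadExpansion.avg (θ := θ) (R.fold q.1 (2 - k)) fun i =>
        HasQuadExpansion.linear (L (R.learned k q i))).sub
      (HasQuadExpansion.avg (θ := θ) (unlabelled N q.1) fun i =>
        HasQuadExpansion.linear (L (R.learned k q i)))).const_mul (c q))
    have h0 : ∀ I : Finset ℕ, avg I (fun _ => (0 : Matrix (Fin d) (Fin d) ℝ)) = 0 := fun I => by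
      simp [avg]
    have hin : ∀ (t : Vec d) i, t.ofLp ⬝ᵥ (R.weight k q *ᵥ (R.learned k q i).ofLp) =
        inner ℝ (L (R.learned k q i)) t := fun t i => by
      rw [EuclideanSpace.inner_eq_star_dotProduct, hL]
      simp
    simp only [h0, sub_zero, smul_zero] at hquad
    have := hquad.mulVec_sub_eq_neg hq (IsArgmin.congr hmin fun t => by
      simp only [ppiObjective, avg_mul_left, ← hin]
      simp only [learned]
      ring)
    have hmapL : ∀ I : Finset ℕ, avg I (fun i => L (R.learned k q i)) =
        L (avg I (R.learned k q)) := fun I => avg_map I (L : Vec d →ₗ[ℝ] Vec d) _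
    rw [WithLp.ofLp_smul, Matrix.mulVec_smul, this, hmapL, hmapL, ← map_sub]
    simp only [WithLp.ofLp_neg, WithLp.ofLp_smul, smul_neg, gradLoss_outcome hY, hΔ']
  · rw [tendsto_vec_iff]
    intro i
    have hdiff := R.tendsto_sqrt_learned_contrast_sub hYhat hs hcons hZ hind hlaw hN hr k
    have hb : ∀ j, BddInProb P fun q : ℕ × Ω => √(q.1 : ℝ) *
        (avg (R.fold q.1 (2 - k)) (fun i => s ((Z i q.2).1, Yhat (Z i q.2))) -
          avg (unlabelled N q.1) fun i => s ((Z i q.2).1, Yhat (Z i q.2))) j := fun j => by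
      have := bddInProb_sqrt_avg_sub_avg hZ hind hlaw (v := fun z => s (z.1, Yhat z) j)
        (by fun_prop) (hs2.eval_piLp j) (by norm_num : (0 : ℝ) ≤ 5) (by positivity) hI
        (eventually_le_mul_card hN hr)
      simpa only [PiLp.sub_apply, avg_apply] using this
    have hWij : ∀ j, Tendsto (fun q => (c q • R.weight k q) i j) (inProb P)
        (𝓝 (((1 + r)⁻¹ • (1 : Matrix (Fin d) (Fin d) ℝ)) i j)) := tendsto_matrix_iff.1 hW i
    -- With `Ŵ` the scaled estimated weight and `W = (1 + r)⁻¹ • 1`, the error is split as `Ŵ √n Δ'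
    -- - W √n Δ = Ŵ (√n Δ' - √n Δ) + (Ŵ - W) √n Δ`, where `Δ'` uses the learned score and `Δ` the
    -- true one.
    have h1 : ∀ j, Tendsto (fun q => (c q • R.weight k q) i j * (√(q.1 : ℝ) * Δ' q j -
        √(q.1 : ℝ) * (avg (R.fold q.1 (2 - k)) (fun i => s ((Z i q.2).1, Yhat (Z i q.2))) -
          avg (unlabelled N q.1) fun i => s ((Z i q.2).1, Yhat (Z i q.2))) j)) (inProb P)
        (𝓝 0) := fun j => by
      have h := (hWij j).mul (hdiff j)
      rwa [mul_zero] at h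
    have h2 := fun j => (hb j).tendsto_mul (tendsto_sub_nhds_zero_iff.2 (hWij j))
    have h3 := (tendsto_finsetSum Finset.univ fun j _ => h1 j).add
      (tendsto_finsetSum Finset.univ fun j _ => h2 j)
    simp only [Finset.sum_const_zero, add_zero, ← Finset.sum_add_distrib] at h3
    refine h3.congr fun q => ?_
    set Δ : Vec d := avg (R.fold q.1 (2 - k)) (fun i => s ((Z i q.2).1, Yhat (Z i q.2))) -
      avg (unlabelled N q.1) fun i => s ((Z i q.2).1, Yhat (Z i q.2)) with hΔ
    have e : ∑ j, ((1 + r)⁻¹ • (1 : Matrix (Fin d) (Fin d) ℝ)) i j * Δ j = (1 + r)⁻¹ * Δ i := by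
      simp [Matrix.one_apply]
    have e' : (Matrix.toEuclideanCLM (𝕜 := ℝ) (R.weight k q) (Δ' q)) i =
        ∑ j, R.weight k q i j * Δ' q j := by
      simp [Matrix.mulVec, dotProduct]
    have e'' : ∀ j, (c q • R.weight k q) i j * (√(q.1 : ℝ) * Δ' q j - √(q.1 : ℝ) * Δ j) +
        ((c q • R.weight k q) i j - ((1 + r)⁻¹ • (1 : Matrix (Fin d) (Fin d) ℝ)) i j) *
          (√(q.1 : ℝ) * Δ j) = √(q.1 : ℝ) * (c q * (R.weight k q i j * Δ' q j) -
            ((1 + r)⁻¹ • (1 : Matrix (Fin d) (Fin d) ℝ)) i j * Δ j) := fun j => by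
      rw [Matrix.smul_apply, smul_eq_mul]
      ring
    rw [Finset.sum_congr rfl fun j _ => e'' j, ← Finset.mul_sum, Finset.sum_sub_distrib,
      ← Finset.mul_sum, e, ← e', contrast, ← hΔ]
    simp only [PiLp.sub_apply, PiLp.neg_apply, PiLp.smul_apply, smul_eq_mul]
    ring
  · intro i
    convert! (hbdd i).const_mul (-1) using 2
    simp

/-- The cross-fitted estimator has the asymptotic covariance of PPI with the optimal linear imputed
loss. -/
theorem hasAsymptoticCovariance_estimate (hSX : SX.PosDef) (hSW : SW.PosSemidef)
    (hγt : bform SW γt γt ≠ 0) (hγ : bform SW γ γt ≠ 0)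
    (hY : ∀ z, Y z = inner ℝ z.2.1 γ + inner ℝ z.1 θ + z.2.2)
    (hYhat : Measurable Yhat) (hs : Measurable s)
    (hsae : (fun z : Obs d m => s (z.1, Yhat z)) =ᵐ[gaussianLaw SX SW σ]
      linScore 0 (recalibration SW γ γt • γt) 0)
    (hcons : R.ScoreConsistent (gaussianLaw SX SW σ) s)
    (hZ : ∀ i, Measurable (Z i)) (hind : iIndepFun Z P)
    (hlaw : ∀ i, P.map (Z i) = gaussianLaw SX SW σ) (hN : ∀ n, 0 < N n)
    (hr : Tendsto (fun n : ℕ => (n : ℝ) / (N n : ℝ)) atTop (𝓝 r)) :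
    HasAsymptoticCovariance P R.estimate θ
      (avarPPI (gaussianLaw SX SW σ) Y θ r fun z => (1 + r)⁻¹ • s (z.1, Yhat z)) := by
  have hr0 := ratio_limit_nonneg hr
  have hsm : Measurable fun z : Obs d m => s (z.1, Yhat z) :=
    hs.comp (measurable_fst.prodMk hYhat)
  have hs2 : MemLp (fun z : Obs d m => s (z.1, Yhat z)) 2 (gaussianLaw SX SW σ) :=
    (memLp_congr_ae hsae).2 (memLp_linScore _ _ _)
  have hu0 : ∀ i, ∫ z, linScore (0 : Vec d) γ 1 z i ∂gaussianLaw SX SW σ = 0 := fun i => by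
    rw [integral_linScore hSX.posSemidef hSW]; simp
  set C : Fin 3 → ℕ × Ω → Vec d := fun j => contrast Z (linScore 0 γ 1)
    (fun z => s (z.1, Yhat z)) (1 + r)⁻¹ (fun n => R.fold n j) (unlabelled N) with hC
  have hbdd : ∀ j i, BddInProb P fun q => C j q i := fun j =>
    bddInProb_contrast hZ hind hlaw (measurable_linScore 0 γ 1) (memLp_linScore 0 γ 1) hu0
      hsm hs2 _ (by norm_num : (0 : ℝ) ≤ 5) (by positivity) (R.eventually_le_mul_card_fold j)
      (eventually_le_mul_card hN hr)
  set w : Fin 3 → ℕ × Ω → ℝ := fun j q => ((R.fold q.1 j).card : ℝ) / q.1 with hw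
  have hwlim : ∀ j, Tendsto (w j) (inProb P) (𝓝 (1 / 3)) := fun j =>
    (R.tendsto_fold_weight j).comp tendsto_fst_inProb
  have hfold : ∀ k, Tendsto (fun q : ℕ × Ω => w k q • (√(q.1 : ℝ) • (R.foldEst q.1 k q.2 - θ) +
      Matrix.toEuclideanCLM (𝕜 := ℝ) ((2 : ℝ) • SX)⁻¹ (C (2 - k) q))) (inProb P) (𝓝 0) := by
    intro k
    have h := (hwlim k).smul (R.tendsto_foldEst_add_contrast hSX hSW hγt hγ hY hYhat hs hsae hcons
      hZ hind hlaw hN hr k (hbdd (2 - k)))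
    rwa [smul_zero] at h
  -- The estimate `θ̂ᵏ` is fitted on fold `2 - k` but weighted by the size of fold `k`. Both weights
  -- tend to `1 / 3`, so exchanging them is negligible.
  have hweights : ∀ k, Tendsto (fun q : ℕ × Ω => Matrix.toEuclideanCLM (𝕜 := ℝ) ((2 : ℝ) • SX)⁻¹
      ((w (2 - k) q - w k q) • C (2 - k) q)) (inProb P) (𝓝 0) := by
    intro k
    have h : Tendsto (fun q : ℕ × Ω => (w (2 - k) q - w k q) • C (2 - k) q) (inProb P)
        (𝓝 0) := by
      rw [tendsto_vec_iff]
      intro i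
      have h0 : Tendsto (fun q => w (2 - k) q - w k q) (inProb P) (𝓝 0) := by
        simpa using (hwlim (2 - k)).sub (hwlim k)
      exact (hbdd (2 - k) i).tendsto_mul h0
    have h' := ((Matrix.toEuclideanCLM (𝕜 := ℝ) ((2 : ℝ) • SX)⁻¹).continuous.tendsto 0).comp h
    rwa [map_zero] at h'
  refine hasAsymptoticCovariance_of_contrast hSX hSW hY hZ hind hlaw hN hr hsm hs2 _ ?_ ?_
  · intro n
    exact Finset.aemeasurable_fun_sum _ fun k _ => (R.foldEst_measurable n k).const_smul
      (((R.fold n k).card : ℝ) / n)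
  · have h := (tendsto_finsetSum Finset.univ fun k _ => hfold k).add
      (tendsto_finsetSum Finset.univ fun k _ => hweights k)
    simp only [Finset.sum_const_zero, add_zero, ← Finset.sum_add_distrib] at h
    refine h.congr' ?_
    filter_upwards [tendsto_fst_inProb.eventually (eventually_gt_atTop 0)] with q hq
    have hsum : ∑ k, w k q = 1 := R.sum_fold_weight hq
    -- The map `k ↦ 2 - k` permutes the folds, size-weighted fold averages give the full labelled
    -- average, and the shared unlabelled average is preserved because the weights sum to one.
    have hrange : contrast Z (linScore 0 γ 1) (fun z => s (z.1, Yhat z)) (1 + r)⁻¹ Finset.range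
        (unlabelled N) q = ∑ k, w (2 - k) q • C (2 - k) q := by
      have hperm : ∑ k, w (2 - k) q • C (2 - k) q = ∑ j, w j q • C j q :=
        (Equiv.subLeft (2 : Fin 3)).sum_comp fun j => w j q • C j q
      rw [hperm, contrast, ← R.sum_fold_weight_smul_avg, ← R.sum_fold_weight_smul_avg]
      rw [show avg (unlabelled N q.1) (fun i => s ((Z i q.2).1, Yhat (Z i q.2))) =
        ∑ k, w k q • avg (unlabelled N q.1) (fun i => s ((Z i q.2).1, Yhat (Z i q.2))) by
          rw [← Finset.sum_smul, hsum, one_smul]]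
      rw [← Finset.sum_sub_distrib, Finset.smul_sum, ← Finset.sum_sub_distrib, Finset.smul_sum]
      refine Finset.sum_congr rfl fun j _ => ?_
      simp only [hC, hw, contrast]
      module
    have hest : R.estimate q.1 q.2 - θ = ∑ k, w k q • (R.foldEst q.1 k q.2 - θ) := by
      simp only [smul_sub, Finset.sum_sub_distrib, ← Finset.sum_smul, hsum, one_smul]
      rfl
    rw [hrange, hest, map_sum, Finset.smul_sum, ← Finset.sum_add_distrib]
    refine Finset.sum_congr rfl fun k _ => ?_
    simp only [map_smul]
    module

end PPI.RePPIRun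

end CrossFitting
-- Assembly: asymptotic covariances, optimal tuning and comparison of traces.
theorem proposition2 {d m : ℕ} (hd : 0 < d)
    -- the Gaussian linear model and the linear prediction rule
    (θ θt : Vec d) (γ γt : Vec m)
    (SX : Matrix (Fin d) (Fin d) ℝ) (hSX : SX.PosDef)
    (SW : Matrix (Fin m) (Fin m) ℝ) (hSW : SW.PosSemidef)
    (σ : ℝ≥0) (hγt : bform SW γt γt ≠ 0)
    (Y Yhat : Obs d m → ℝ)
    (hY : ∀ z, Y z = inner ℝ z.2.1 γ + inner ℝ z.1 θ + z.2.2)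
    (hYhat : ∀ z, Yhat z = inner ℝ z.1 θt + inner ℝ z.2.1 γt)
    (μ : Measure (Obs d m)) (hμ : μ = gaussianLaw SX SW σ)
    -- the data: i.i.d. units, the first `n` labelled, the next `N n` unlabelled, `n / N → r`
    {Ω : Type*} [MeasurableSpace Ω] (P : Measure Ω) [IsProbabilityMeasure P]
    (Z : ℕ → Ω → Obs d m) (hZ : ∀ i, Measurable (Z i)) (hZindep : iIndepFun Z P)
    (hZlaw : ∀ i, P.map (Z i) = μ)
    (N : ℕ → ℕ) (hN : ∀ n, 0 < N n) (r : ℝ)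
    (hr : Tendsto (fun n : ℕ => (n : ℝ) / (N n : ℝ)) atTop (𝓝 r)) :
    -- the target is `θ`
    (∀ t, t ≠ θ → risk μ Y θ < risk μ Y t) ∧
    -- asymptotic covariance of the XY-only estimator
    (∀ est, IsPPIEstimator P Y Yhat Z N (fun _ _ _ _ _ => 0) est →
      HasAsymptoticCovariance P est θ (avarScaled μ Y Yhat θ r 0)) ∧
    -- asymptotic covariance of the PPI estimator
    (∀ est, IsPPIEstimator P Y Yhat Z N (fun _ _ t x y => sqLoss t x y) est →
      HasAsymptoticCovariance P est θ (avarScaled μ Y Yhat θ r 1)) ∧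
    -- asymptotic covariance of RePPI with a consistently learned regression function
    (∀ s, IsOptimalScore μ Y Yhat θ s →
      -- the PPI estimator with the linear optimal imputed loss
      (∀ est, IsPPIEstimator P Y Yhat Z N
          (fun _ _ t x y => (1 + r)⁻¹ * inner ℝ t (s (x, y))) est →
        HasAsymptoticCovariance P est θ (avarRePPI μ Y Yhat θ r)) ∧
      -- the cross-fitted estimator, when `Cov(s(X, Ŷ))` is invertible
      (bform SW γ γt ≠ 0 → ∀ R : RePPIRun P Y Yhat Z N, R.ScoreConsistent μ s →
        HasAsymptoticCovariance P R.estimate θ (avarRePPI μ Y Yhat θ r))) ∧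
    -- closed forms: XY-only, PPI, RePPI
    (avarScaled μ Y Yhat θ r 0).trace = ((σ : ℝ) ^ 2 + bform SW γ γ) * SX⁻¹.trace ∧
    (avarScaled μ Y Yhat θ r 1).trace =
      (1 + r) * ‖θ - θt‖ ^ 2 +
        ((σ : ℝ) ^ 2 + (1 + r) * bform SX (θ - θt) (θ - θt) + r * bform SW γt γt +
          bform SW (γ - γt) (γ - γt)) * SX⁻¹.trace ∧
    (avarRePPI μ Y Yhat θ r).trace =
      ((σ : ℝ) ^ 2 + bform SW γ γ -
        1 / (1 + r) * (bform SW γ γt ^ 2 / bform SW γt γt)) * SX⁻¹.trace ∧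
    -- PPI++: `lam` is the unique optimal tuning parameter
    ∃ lam : ℝ,
      (∀ l, l ≠ lam →
        (avarScaled μ Y Yhat θ r lam).trace < (avarScaled μ Y Yhat θ r l).trace) ∧
      -- asymptotic covariance of the PPI++ estimator, for any consistent tuning
      (∀ lamHat : ℕ → Ω → ℝ, (∀ n, AEMeasurable (lamHat n) P) →
        TendstoInMeasure P lamHat atTop (fun _ => lam) →
        ∀ est, IsPPIEstimator P Y Yhat Z N
            (fun n ω t x y => lamHat n ω * sqLoss t x y) est →
          HasAsymptoticCovariance P est θ (avarScaled μ Y Yhat θ r lam)) ∧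
      -- closed form: PPI++
      (avarScaled μ Y Yhat θ r lam).trace =
        ((σ : ℝ) ^ 2 + bform SW γ γ -
          1 / (1 + r) * (bform SW γ γt ^ 2 /
            (bform SW γt γt + bform SX (θ - θt) (θ - θt) + ‖θ - θt‖ ^ 2 / SX⁻¹.trace))) *
          SX⁻¹.trace ∧
      -- the ordering
      (avarRePPI μ Y Yhat θ r).trace ≤ (avarScaled μ Y Yhat θ r lam).trace ∧
      (avarScaled μ Y Yhat θ r lam).trace ≤
        min (avarScaled μ Y Yhat θ r 0).trace (avarScaled μ Y Yhat θ r 1).trace := by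
  subst hμ
  have hr0 := ratio_limit_nonneg hr
  have hYm : Measurable Yhat := by
    rw [funext hYhat]
    fun_prop
  have hτ : 0 < SX⁻¹.trace := trace_inv_pos hd hSX
  have hw : 0 < bform SW γt γt := (bform_self_nonneg hSW γt).lt_of_ne' hγt
  have hb : 0 ≤ bform SX (θ - θt) (θ - θt) := bform_self_nonneg hSX.posSemidef _
  set τ := SX⁻¹.trace
  set b := bform SX (θ - θt) (θ - θt)
  set w := bform SW γt γt
  set v := bform SW γ γt with hv
  have hD : 0 < (b + w) * τ + ‖θ - θt‖ ^ 2 := by positivity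
  have htrace := trace_avarScaled (σ := σ) hSX hSW hY hYhat r
  have hscaled : ∀ (l : ℝ) (lamHat : ℕ → Ω → ℝ),
      TendstoInMeasure P lamHat atTop (fun _ => l) → ∀ est,
      IsPPIEstimator P Y Yhat Z N (fun n ω t x y => lamHat n ω * sqLoss t x y) est →
      HasAsymptoticCovariance P est θ (avarScaled (gaussianLaw SX SW σ) Y Yhat θ r l) :=
    fun l lamHat hlam est hest =>
      hasAsymptoticCovariance_scaled hSX hSW hY hYhat hZ hZindep hZlaw hN hr hlam hest
  have hconst : ∀ l : ℝ, TendstoInMeasure P (fun (_ : ℕ) (_ : Ω) => l) atTop fun _ => l :=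
    fun l => tendstoInMeasure_iff_tendsto_inProb (X := fun _ => l).2 tendsto_const_nhds
  have hRePPI : ∀ s, IsOptimalScore (gaussianLaw SX SW σ) Y Yhat θ s →
      avarRePPI (gaussianLaw SX SW σ) Y Yhat θ r =
        avarPPI (gaussianLaw SX SW σ) Y θ r fun z => (1 + r)⁻¹ • s (z.1, Yhat z) := fun s hs => by
    rw [avarRePPI_eq_avarPPI hSX.posSemidef hSW hγt hY hYhat hr0]
    refine avarPPI_congr ?_
    filter_upwards [hs.ae_eq hSX.posSemidef hSW hγt hY hYhat] with z hz
    rw [hz, smul_linScore, smul_zero, mul_zero, smul_smul]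
  refine ⟨fun t ht => risk_lt hSX hSW hY ht, fun est hest => ?_, fun est hest => ?_,
    fun s hs => ⟨fun est hest => ?_, fun hγ R hR => ?_⟩, ?_, ?_, ?_, ?_⟩
  · exact hscaled 0 _ (hconst 0) est (by simpa only [zero_mul] using hest)
  · exact hscaled 1 _ (hconst 1) est (by simpa only [one_mul] using hest)
  · rw [hRePPI s hs]
    exact hasAsymptoticCovariance_linear hSX hSW hY hYm hZ hZindep hZlaw hN hr hs.1
      ((memLp_congr_ae (hs.ae_eq hSX.posSemidef hSW hγt hY hYhat)).2 (memLp_linScore _ _ _)) _ hest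
  · rw [hRePPI s hs]
    exact R.hasAsymptoticCovariance_estimate hSX hSW hγt hγ hY hYm hs.1
      (hs.ae_eq hSX.posSemidef hSW hγt hY hYhat) hR hZ hZindep hZlaw hN hr
  · rw [htrace]
    ring
  · have e : bform SW (γ - γt) (γ - γt) = bform SW γ γ - 2 * v + w := by
      rw [bform_sub_left, bform_sub_right, bform_sub_right, bform_comm hSW.1 γt γ]
      ring
    rw [htrace, e]
    ring
  · exact trace_avarRePPI hSX hSW hγt hY hYhat hr0
  -- With `D = (b + w) τ + ‖θ - θt‖²`, the trace is `(1 + r) D l² - 2 v τ l` plus a constant, with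
  -- vertex `v τ / ((1 + r) D)`. Completing the square gives strict minimality, and at `l = 0` and
  -- `l = 1` the comparison with XY-only and PPI.
  have hmin : ∀ l, (avarScaled (gaussianLaw SX SW σ) Y Yhat θ r l).trace =
      (avarScaled (gaussianLaw SX SW σ) Y Yhat θ r
        (v * τ / ((1 + r) * ((b + w) * τ + ‖θ - θt‖ ^ 2)))).trace +
      (1 + r) * ((b + w) * τ + ‖θ - θt‖ ^ 2) *
        (l - v * τ / ((1 + r) * ((b + w) * τ + ‖θ - θt‖ ^ 2))) ^ 2 := fun l => by
    rw [htrace, htrace]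
    generalize (b + w) * τ + ‖θ - θt‖ ^ 2 = D at hD ⊢
    field_simp
    ring
  have hclosed : (avarScaled (gaussianLaw SX SW σ) Y Yhat θ r
        (v * τ / ((1 + r) * ((b + w) * τ + ‖θ - θt‖ ^ 2)))).trace =
      ((σ : ℝ) ^ 2 + bform SW γ γ - 1 / (1 + r) * (v ^ 2 / (w + b + ‖θ - θt‖ ^ 2 / τ))) * τ := by
    have e : w + b + ‖θ - θt‖ ^ 2 / τ = ((b + w) * τ + ‖θ - θt‖ ^ 2) / τ := by
      field_simp
      ring
    rw [htrace, e]
    generalize (b + w) * τ + ‖θ - θt‖ ^ 2 = D at hD ⊢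
    field_simp
    ring
  refine ⟨v * τ / ((1 + r) * ((b + w) * τ + ‖θ - θt‖ ^ 2)), fun l hl => ?_,
    fun lamHat _ hlam est hest => hscaled _ lamHat hlam est hest, hclosed, ?_, le_min ?_ ?_⟩
  · rw [hmin l]
    have := sub_ne_zero.2 hl
    exact lt_add_of_pos_right _ (by positivity)
  · rw [hclosed, trace_avarRePPI hSX hSW hγt hY hYhat hr0]
    -- The two closed forms differ only in this denominator; PPI++ pays for the `X`-error of the
    -- prediction rule, RePPI does not.
    have : w ≤ w + b + ‖θ - θt‖ ^ 2 / τ := by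
      rw [add_assoc]
      exact le_add_of_nonneg_right (by positivity)
    gcongr
  · rw [hmin 0]
    exact le_add_of_nonneg_right (by positivity)
  · rw [hmin 1]
    exact le_add_of_nonneg_right (by positivity)
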